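/- Setting ($\hbar=1$). Phase space of $n\ge 1$ modes is $\mathbb{R}^{2n}$, $u=u_1\oplus\dots\oplus u_n$, $u_j=(q_j,p_j)$, with Euclidean norm $|\cdot|$; $\|\cdot\|$ is the operator norm. Let $\rho=\rho_1\otimes\dots\otimes\rho_n$ be a product state of $n$ modes whose Wigner functions $W_{\rho_j}(q,p)=(2\pi)^{-1}\int\langle q-y/2|\rho_j|q+y/2\rangle e^{ipy}\,dy$ are non-negative with finite second moments, means $\mu_j$ and covariance matrices $V_{\rho_j}$, and put $W_\rho(u)=\prod_jW_{\rho_j}(u_j)$. Let $T\in\mathbb{R}^{2n\times 2n}$ be symplectic, $x\in\mathbb{R}^{2n}$, and let $U_{T,x}$ be the unitary with $U_{T,x}^\dagger RU_{T,x}=TR+x$ for the vector $R$ of quadratures (in Weyl form). For each $j$ let $V_{\mathcal M,j}$ be a positive definite $2\times2$ matrix of determinant $1$, let $G_j(k_j)$ be the pure Gaussian state with Wigner function $z\mapsto\pi^{-1}e^{-(z-k_j)^TV_{\mathcal M,j}^{-1}(z-k_j)}$, and let $M(k|u)=\prod_j\pi^{-1}e^{-(k_j-u_j)^TV_{\mathcal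 M,j}^{-1}(k_j-u_j)}$. Measuring $U_{T,x}\rho U_{T,x}^\dagger$ with the POVM $(2\pi)^{-n}\bigotimes_j|G_j(k_j)\rangle\langle G_j(k_j)|\,dk$ has the Born-rule outcome density $p(k)$. For $\Gamma>0$ and any origin $o\in\mathbb{R}^{2n}$, put $\Pr_{\rm quant}(k)=\int_{N_\Gamma(k)}p$ for $k\in o+\Gamma\mathbb{Z}^{2n}$, where $N_\Gamma(k)$ is the cube of side $\Gamma$ centred at $k$. Sampler. Inputs: $\mu_j$, $V_{\mathcal M,j}$, $T$, $x$, $\delta,\Gamma,|\mathcal A|,\epsilon_2$, $o$, where $\sqrt{|\mathcal A|}$ and $\Gamma$ are odd multiples of $\delta>0$, and oracles with $|\mathcal W_{\rho_j,\eta}(l,m)-W_{\rho_j}(\mu_j+\delta(l,m))|<\eta$ for all integers $l,m$. (1) For each $j$ draw $(l,m)$ with $|l|,|m|\le\sqrt{|\mathcal A|}/(2\delta)$ with probability proportional to $\max(0,\mathcal W_{\rho_j,\eta}(l,m))$, and put $u_j=\mu_j+\delta(l,m)$. (2) Compute $\tilde u$ with $|\tilde u-(Tu+x)|\le\epsilon_2$.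 (3) For each $j$ draw $(l,m)$ in the same range with probability proportional to $e^{-\delta^2(l,m)V_{\mathcal M,j}^{-1}(l,m)^T}$, and return as $k_j$ the mode-$j$ part of the centre of the cube of the tiling $\{N_\Gamma(k)\}_{k\in o+\Gamma\mathbb{Z}^{2n}}$ that contains $\tilde u_j+\delta(l,m)$. Let $\Pr_{\rm sim}$ be the law of $k$. Theorem. Let $0<\epsilon<1$ and suppose that $W_\rho$ is differentiable and, with real $\beta,\Lambda$, for all $u,k\in\mathbb{R}^{2n}$: (a) $|\nabla W_\rho(u)|\le n\beta/|\mathcal A|^n$ and $|\nabla_kM(k|u)|\le n\Lambda/|\mathcal A|^n$; (b) $\delta\le\min\{\delta_*,\Gamma\}$ with $\delta_*=\epsilon/\big(16[(1+\|T\|)\Lambda+\beta]n\sqrt{2n}\big)$; (c) $\epsilon_2\le\|T\|\delta\sqrt{n/2}$; (d) $|\mathcal A|\ge a_*$ with $a_*=16n\max_{i,j}([V_{\rho_i}]_{11}+[V_{\rho_i}]_{22}+[V_{\mathcal M,j}]_{11}+[V_{\mathcal M,j}]_{22})/\epsilon$; (e) $\eta\le\epsilon/(8n|\mathcal A|^n)$.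 (i) Accuracy: for every (possibly randomized) subroutine for step (2) with the stated error, $\sum_{k\in o+\Gamma\mathbb{Z}^{2n}}|\Pr_{\rm quant}(k)-\Pr_{\rm sim}(k)|\le\epsilon$. (ii) Cost: charge one step for each oracle call, each evaluation of a Gaussian, each arithmetic operation on a table entry and each entry scanned in a draw, a fixed number of steps per mode for forming $u_j$ and $k_j$, and charge the fixed-point arithmetic of step (2) in (schoolbook) bit operations. For all $c,B$ there is $C$, depending only on $c$ and $B$, such that whenever moreover $|\mathcal A|\le c\,a_*$, $\delta\ge\delta_*/c$, $\epsilon_2\ge\|T\|\delta\sqrt{n/2}/c$, and $\|x\|$ and the entries of the $\mu_j$ are bounded by $B$, some number of binary digits achieves the error $\epsilon_2$ in step (2) on all points that step (1) can produce, and every run then takes at most $$C\,n^5\big(\max_i\|V_{\rho_i}\|+\max_j\|V_{\mathcal M,j}\|\big)\big[\Lambda^2\|T\|^2+\beta^2\big]/\epsilon^3$$ steps. (iii) Efficiency: in the situation of (ii), if also $\|V_{\rho_j}\|,\|V_{\mathcal M,j}\|,\|T\|,\beta,\Lambda\le B$, the sampler with step (2) in fixed-point arithmetic reaches 1-norm accuracy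 $\epsilon$ in at most $C(n/\epsilon)^d$ steps, where $C,d$ depend only on $c,B$. -/

import Mathlib

open MeasureTheory

noncomputable section

namespace PhaseSim

/-! ### Phase space -/

/-- Phase space of `n` modes with its Euclidean norm: `u (j, 0)` is the position `q_j` and
`u (j, 1)` the momentum `p_j` of mode `j`. -/
abbrev PhaseSpace (n : ℕ) : Type := EuclideanSpace ℝ (Fin n × Fin 2)

/-- The `j`-th mode of a phase space point. -/
def mode {n : ℕ} (u : PhaseSpace n) (j : Fin n) : Fin 2 → ℝ := fun a => u (j, a)

/-- Gluing `n` single-mode points together. -/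
def ofModes {n : ℕ} (u : Fin n → Fin 2 → ℝ) : PhaseSpace n := WithLp.toLp 2 fun i => u i.1 i.2

/-- The standard symplectic form. -/
def symplForm {n : ℕ} (u v : PhaseSpace n) : ℝ :=
  ∑ j, (u (j, 0) * v (j, 1) - u (j, 1) * v (j, 0))

/-- The linear map of a square matrix on Euclidean space. -/
def act {ι : Type} [Fintype ι] [DecidableEq ι] (T : Matrix ι ι ℝ) :
    EuclideanSpace ℝ ι →L[ℝ] EuclideanSpace ℝ ι :=
  Matrix.toEuclideanCLM (𝕜 := ℝ) T

/-- The operator norm of a square matrix with respect to the Euclidean norm. -/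
def opNorm {ι : Type} [Fintype ι] [DecidableEq ι] (T : Matrix ι ι ℝ) : ℝ := ‖act T‖

def IsSymplectic {n : ℕ} (T : Matrix (Fin n × Fin 2) (Fin n × Fin 2) ℝ) : Prop :=
  ∀ u v, symplForm (act T u) (act T v) = symplForm u v

/-! ### States and Wigner functions (units with `ℏ = 1`) -/

/-- The Hilbert space `L²(ℝⁿ)` of `n` modes. -/
abbrev WaveFn (n : ℕ) : Type := Lp ℂ 2 (volume : Measure (Fin n → ℝ))

/-- A density operator `∑ᵢ wᵢ |ψᵢ⟩⟨ψᵢ|` of one mode, given by an ensemble of unit vectors of `L²(ℝ)`. -/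
structure ModeState where
  weight : ℕ → ℝ
  weight_nonneg : ∀ i, 0 ≤ weight i
  hasSum_weight : HasSum weight 1
  vec : ℕ → Lp ℂ 2 (volume : Measure ℝ)
  norm_vec : ∀ i, ‖vec i‖ = 1

/-- The Wigner function `(2π)⁻¹ ∫ ψ(q - y/2) conj(ψ(q + y/2)) exp(i p y) dy` of a pure state; the
integral is real. -/
def wignerPure (ψ : ℝ → ℂ) (z : Fin 2 → ℝ) : ℝ :=
  (2 * Real.pi)⁻¹ *
    (∫ y : ℝ, ψ (z 0 - y / 2) * (starRingEnd ℂ) (ψ (z 0 + y / 2)) *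
      Complex.exp (Complex.I * (z 1 * y : ℝ))).re

/-- The Wigner function of a single-mode state. -/
def ModeState.wigner (ρ : ModeState) (z : Fin 2 → ℝ) : ℝ :=
  ∑' i, ρ.weight i * wignerPure (ρ.vec i) z

/-- The Wigner function of the product state `ρ₁ ⊗ ⋯ ⊗ ρₙ`. -/
def wignerProd {n : ℕ} (ρ : Fin n → ModeState) (u : PhaseSpace n) : ℝ :=
  ∏ j, (ρ j).wigner (mode u j)

/-- `W` has finite second moments, mean `m` and covariance matrix `V`. -/
structure HasMeanCov (W : (Fin 2 → ℝ) → ℝ) (m : Fin 2 → ℝ) (V : Matrix (Fin 2) (Fin 2) ℝ) :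
    Prop where
  integrable : Integrable fun z => (1 + ‖z‖ ^ 2) * W z
  mean : ∀ a, ∫ z, z a * W z = m a
  cov : ∀ a b, ∫ z, (z a - m a) * (z b - m b) * W z = V a b

theorem memLp_prod {n : ℕ} (ψ : Fin n → Lp ℂ 2 (volume : Measure ℝ)) :
    MemLp (fun y : Fin n → ℝ => ∏ j, ψ j (y j)) 2 volume := by
  have hm : AEStronglyMeasurable (fun y : Fin n → ℝ => ∏ j, ψ j (y j)) volume := by
    have h : ∀ j ∈ Finset.univ, AEStronglyMeasurable (fun y : Fin n → ℝ => ψ j (y j)) volume :=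
      fun j _ => (Lp.aestronglyMeasurable (ψ j)).comp_quasiMeasurePreserving
        (Measure.quasiMeasurePreserving_eval _ j)
    exact Finset.aestronglyMeasurable_fun_prod _ h
  rw [memLp_two_iff_integrable_sq_norm hm]
  have h : ∀ j, Integrable (fun t : ℝ => ‖ψ j t‖ ^ 2) volume := fun j =>
    (memLp_two_iff_integrable_sq_norm (Lp.aestronglyMeasurable (ψ j))).1 (Lp.memLp (ψ j))
  have := Integrable.fintype_prod (f := fun j (t : ℝ) => ‖ψ j t‖ ^ 2) h
  refine Integrable.congr this (ae_of_all _ fun y => ?_)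
  simp [norm_prod, Finset.prod_pow]

/-- The product vector `ψ₁ ⊗ ⋯ ⊗ ψₙ`. -/
def tensorVec {n : ℕ} (ψ : Fin n → Lp ℂ 2 (volume : Measure ℝ)) : WaveFn n :=
  (memLp_prod ψ).toLp _

/-! ### Linear optics -/

/-- The displacement (Weyl) operator `exp(i (a_p · Q - a_q · P))` in the position representation. -/
def displace {n : ℕ} (a : PhaseSpace n) (f : (Fin n → ℝ) → ℂ) : (Fin n → ℝ) → ℂ := fun y =>
  Complex.exp (Complex.I * (∑ j, a (j, 1) * (y j - a (j, 0) / 2) : ℝ)) * f fun j => y j - a (j, 0)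

/-- `U` is the (up to a phase unique) unitary `U_{T,x}` whose Heisenberg action on the quadratures
`R` is `R ↦ T R + x`. In terms of the displacement operators `D` this reads
`U D(b) = exp(-i σ(x, T b)) D(T b) U` for all `b`. -/
def Implements {n : ℕ} (T : Matrix (Fin n × Fin 2) (Fin n × Fin 2) ℝ) (x : PhaseSpace n)
    (U : WaveFn n ≃ₗᵢ[ℂ] WaveFn n) : Prop :=
  ∀ (b : PhaseSpace n) (f g : WaveFn n), (⇑g =ᵐ[volume] displace b ⇑f) →
    ⇑(U g) =ᵐ[volume] fun y =>
      Complex.exp (-(Complex.I * (symplForm x (act T b) : ℝ))) * displace (act T b) (⇑(U f)) y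

/-! ### Gaussian measurements and the Born rule -/

/-- The wave function of the pure one-mode Gaussian state with mean `k` and matrix `V`, `det V = 1`,
that is, with Wigner function `z ↦ π⁻¹ exp(-(z - k)ᵀ V⁻¹ (z - k))`. -/
def gaussWave (k : Fin 2 → ℝ) (V : Matrix (Fin 2) (Fin 2) ℝ) (y : ℝ) : ℂ :=
  (((Real.pi * V 0 0) ^ (-(1 / 4) : ℝ) : ℝ) : ℂ) *
    Complex.exp (-((1 - Complex.I * (V 0 1 : ℝ)) / (2 * (V 0 0 : ℝ)) * ((y - k 0 : ℝ) : ℂ) ^ 2)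
      + Complex.I * (k 1 * y : ℝ))

/-- The phase space kernel `M(k | u)` of the separable Gaussian measurement. -/
def gaussKernel {n : ℕ} (V : Fin n → Matrix (Fin 2) (Fin 2) ℝ) (k u : PhaseSpace n) : ℝ :=
  ∏ j, (Real.pi * Real.sqrt (V j).det)⁻¹ *
    Real.exp (-((mode (k - u) j) ⬝ᵥ ((V j)⁻¹.mulVec (mode (k - u) j))))

/-- The Born rule density at `k` of the POVM `(2π)⁻ⁿ |G(k)⟩⟨G(k)| dk`,
`G(k) = G(k₁, V₁) ⊗ ⋯ ⊗ G(kₙ, Vₙ)`, in the state `U (ρ₁ ⊗ ⋯ ⊗ ρₙ) U†`. -/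
def bornDensity {n : ℕ} (ρ : Fin n → ModeState) (U : WaveFn n ≃ₗᵢ[ℂ] WaveFn n)
    (V : Fin n → Matrix (Fin 2) (Fin 2) ℝ) (k : PhaseSpace n) : ℝ :=
  ((2 * Real.pi) ^ n)⁻¹ * ∑' i : Fin n → ℕ, (∏ j, (ρ j).weight (i j)) *
    ‖∫ y : Fin n → ℝ, (starRingEnd ℂ) (∏ j, gaussWave (mode k j) (V j) (y j)) *
      U (tensorVec fun j => (ρ j).vec (i j)) y‖ ^ 2

/-- The cube with centre `k` and side `s`. -/
def cube {n : ℕ} (k : PhaseSpace n) (s : ℝ) : Set (PhaseSpace n) := {v | ∀ i, |v i - k i| ≤ s / 2}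

/-- The probability that the quantum outcome lies in the cube with centre `k` and side `Γ`. -/
def quantProb {n : ℕ} (ρ : Fin n → ModeState) (U : WaveFn n ≃ₗᵢ[ℂ] WaveFn n)
    (V : Fin n → Matrix (Fin 2) (Fin 2) ℝ) (Γ : ℝ) (k : PhaseSpace n) : ℝ :=
  ∫ v in cube k Γ, bornDensity ρ U V v

/-! ### Randomized computations with a step counter -/

/-- A randomized computation: the joint law of its result and of the number of steps it takes. -/
structure Comp (α : Type) where
  law : PMF (α × ℕ)

instance : Monad Comp where
  pure a := ⟨PMF.pure (a, 0)⟩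
  bind m f := ⟨m.law.bind fun r => (f r.1).law.map fun s => (s.1, r.2 + s.2)⟩

/-- Spend `c` steps. -/
def tick (c : ℕ) : Comp Unit := ⟨PMF.pure ((), c)⟩

/-- A random draw; its cost is charged separately. -/
def draw {α : Type} (p : PMF α) : Comp α := ⟨p.map fun a => (a, 0)⟩

/-- Run a computation for each entry of a list and store the results in a table. -/
def tabulate {ι : Type} [DecidableEq ι] : List ι → (ι → Comp ℝ) → Comp (ι → ℝ)
  | [], _ => pure 0
  | i :: is, f => do
    let a ← f i
    let t ← tabulate is f
    pure (Function.update t i a)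

/-- Add up the entries of a table. -/
def total {ι : Type} : List ι → (ι → ℝ) → Comp ℝ
  | [], _ => pure 0
  | i :: is, t => do
    let s ← total is t
    tick 1
    pure (t i + s)

/-- Run a computation for each mode. -/
def forModes {α : Type} : {n : ℕ} → (Fin n → Comp α) → Comp (Fin n → α)
  | 0, _ => pure fun j => j.elim0
  | _ + 1, f => do
    let a ← f 0
    let as ← forModes fun j => f j.succ
    pure (Fin.cons (α := fun _ => α) a as)

open Classical in
/-- The law on the entries of `pts` proportional to the non-negative table `t`. -/
def tableLaw {ι : Type} [Inhabited ι] (pts : List ι) (t : ι → ℝ) : PMF ι :=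
  if h : (∑' i, if i ∈ pts then ENNReal.ofReal (t i) else 0) ≠ 0 ∧
      (∑' i, if i ∈ pts then ENNReal.ofReal (t i) else 0) ≠ ⊤ then
    PMF.normalize (fun i => if i ∈ pts then ENNReal.ofReal (t i) else 0) h.1 h.2
  else PMF.pure default

/-- Tabulate `f · δ²` on `pts` (one step for a value of `f`, one for the product), normalize the
table, and draw an entry by scanning the table. -/
def drawFromTable (pts : List (ℤ × ℤ)) (f : ℤ × ℤ → ℝ) (δ : ℝ) : Comp (ℤ × ℤ) := do
  let t ← tabulate pts fun z => do
    tick 2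
    pure (f z * δ ^ 2)
  let s ← total pts t
  let t' ← tabulate pts fun z => do
    tick 1
    pure (t z / s)
  tick pts.length
  draw (tableLaw pts t')

/-! ### Fixed-point arithmetic, charged in bit operations -/

/-- Binary length of an integer, with sign. -/
def bitLen (a : ℤ) : ℕ := Nat.size a.natAbs + 1

def mulInt (a b : ℤ) : Comp ℤ := do
  tick (bitLen a * bitLen b)
  pure (a * b)

def addInt (a b : ℤ) : Comp ℤ := do
  tick (bitLen a + bitLen b)
  pure (a + b)

/-- `acc + ∑ a k * b k`. -/
def dotInt {ι : Type} : List ι → (ι → ℤ) → (ι → ℤ) → ℤ → Comp ℤ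
  | [], _, _, acc => pure acc
  | k :: ks, a, b, acc => do
    let m ← mulInt (a k) (b k)
    let s ← addInt acc m
    dotInt ks a b s

/-- `y` rounded to `p` binary digits after the point, in units of `2⁻ᵖ`. -/
def toFixed (p : ℕ) (y : ℝ) : ℤ := round (2 ^ p * y)

/-- Evaluation of `T u + x` with all entries of `T`, `u`, `x` rounded to `p` binary digits. -/
def fixedPointAffine {n : ℕ} (p : ℕ) (T : Matrix (Fin n × Fin 2) (Fin n × Fin 2) ℝ)
    (x u : PhaseSpace n) : Comp (PhaseSpace n) := do
  let v ← tabulate (Finset.univ : Finset (Fin n × Fin 2)).toList fun i => do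
    let x0 ← mulInt (2 ^ p) (toFixed p (x i))
    let s ← dotInt (Finset.univ : Finset (Fin n × Fin 2)).toList
      (fun k => toFixed p (T i k)) (fun k => toFixed p (u k)) x0
    pure ((s : ℝ) / 4 ^ p)
  pure (WithLp.toLp 2 v)

/-! ### The finite-precision sampler -/

/-- The labels of the squares of side `δ` into which the centred square of area `A` is divided. -/
def gridLabels (A δ : ℝ) : List (ℤ × ℤ) :=
  (Finset.Icc (-⌊Real.sqrt A / (2 * δ)⌋) ⌊Real.sqrt A / (2 * δ)⌋ ×ˢ
    Finset.Icc (-⌊Real.sqrt A / (2 * δ)⌋) ⌊Real.sqrt A / (2 * δ)⌋).toList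

/-- `c + δ (l, m)`. -/
def gridPoint (c : Fin 2 → ℝ) (δ : ℝ) (z : ℤ × ℤ) : Fin 2 → ℝ := ![c 0 + δ * z.1, c 1 + δ * z.2]

/-- The inputs of the sampler besides the measurement and the affine map: mean values `mean` of the
input modes, grid spacing `δ`, output spacing `Γ`, truncation area `A`, bound `ε₂` on the numerical
error of the affine map, centre `origin` of one of the output cubes, and the oracles. -/
structure SimInput (n : ℕ) where
  mean : PhaseSpace n
  δ : ℝ
  Γ : ℝ
  A : ℝ
  ε₂ : ℝ
  origin : PhaseSpace n
  oracle : Fin n → ℤ × ℤ → ℝ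

/-- First stage: draw a grid point of mode `j` with probability proportional to the oracle
(negative oracle values are replaced by zero). -/
def sampleMode {n : ℕ} (I : SimInput n) (j : Fin n) : Comp (Fin 2 → ℝ) := do
  let z ← drawFromTable (gridLabels I.A I.δ) (fun z => max 0 (I.oracle j z)) I.δ
  tick 4
  pure (gridPoint (mode I.mean j) I.δ z)

/-- The centre of the cell containing `y` in the division of the line into cells of length `Γ`,
one of which has centre `o`. -/
def rebin (o Γ y : ℝ) : ℝ := o + Γ * (⌊(y - o) / Γ + 1 / 2⌋ : ℤ)

/-- Third stage: draw a displacement `δ (l, m)` from the discretized Gaussian, add it to the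
evolved point `v`, and report the centre of the output cell in which the result lies. -/
def measureMode {n : ℕ} (I : SimInput n) (V : Fin n → Matrix (Fin 2) (Fin 2) ℝ)
    (v : PhaseSpace n) (j : Fin n) : Comp (Fin 2 → ℝ) := do
  let z ← drawFromTable (gridLabels I.A I.δ)
    (fun z => Real.exp (-((gridPoint 0 I.δ z) ⬝ᵥ ((V j)⁻¹.mulVec (gridPoint 0 I.δ z))))) I.δ
  tick 16
  pure fun a => rebin (I.origin (j, a)) I.Γ (gridPoint (mode v j) I.δ z a)

/-- The sampler, with a subroutine `aff` for the affine map. -/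
def simulate {n : ℕ} (I : SimInput n) (V : Fin n → Matrix (Fin 2) (Fin 2) ℝ)
    (aff : PhaseSpace n → Comp (PhaseSpace n)) : Comp (PhaseSpace n) := do
  let u ← forModes (sampleMode I)
  let v ← aff (ofModes u)
  let k ← forModes (measureMode I V v)
  pure (ofModes k)

/-- The probability that the sampler returns `k`. -/
def simProb {n : ℕ} (I : SimInput n) (V : Fin n → Matrix (Fin 2) (Fin 2) ℝ)
    (aff : PhaseSpace n → Comp (PhaseSpace n)) (k : PhaseSpace n) : ℝ :=
  (((simulate I V aff).law.map Prod.fst) k).toReal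

/-- On all points that the first stage can produce, `aff` computes `T u + x` up to an error of
Euclidean norm at most `ε₂`. -/
def AffineAccurate {n : ℕ} (I : SimInput n) (T : Matrix (Fin n × Fin 2) (Fin n × Fin 2) ℝ)
    (x : PhaseSpace n) (aff : PhaseSpace n → Comp (PhaseSpace n)) : Prop :=
  ∀ z : Fin n → ℤ × ℤ, (∀ j, z j ∈ gridLabels I.A I.δ) →
    ∀ r ∈ (aff (ofModes fun j => gridPoint (mode I.mean j) I.δ (z j))).law.support,
      ‖r.1 - (act T (ofModes fun j => gridPoint (mode I.mean j) I.δ (z j)) + x)‖ ≤ I.ε₂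

/-! ### The experiments and the conditions on the parameters -/

/-- A product input with non-negative Wigner functions of finite covariance, an affine symplectic
evolution, and a separable Gaussian measurement. -/
structure Experiment (n : ℕ) where
  ρ : Fin n → ModeState
  wigner_nonneg : ∀ j z, 0 ≤ (ρ j).wigner z
  mean : PhaseSpace n
  Vρ : Fin n → Matrix (Fin 2) (Fin 2) ℝ
  meanCov : ∀ j, HasMeanCov (ρ j).wigner (mode mean j) (Vρ j)
  T : Matrix (Fin n × Fin 2) (Fin n × Fin 2) ℝ
  symplectic : IsSymplectic T
  x : PhaseSpace n
  U : WaveFn n ≃ₗᵢ[ℂ] WaveFn n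
  implements : Implements T x U
  VM : Fin n → Matrix (Fin 2) (Fin 2) ℝ
  VM_posDef : ∀ j, (VM j).PosDef
  VM_det : ∀ j, (VM j).det = 1

/-- The upper bound on the grid spacing that comes from the accuracy `ε`. -/
def spacingBound {n : ℕ} (E : Experiment n) (ε β Λ : ℝ) : ℝ :=
  ε / (16 * ((1 + opNorm E.T) * Λ + β) * n * Real.sqrt (2 * n))

/-- For the modes `i`, `j`, the lower bound on the truncation area. -/
def areaBound {n : ℕ} (E : Experiment n) (ε : ℝ) (i j : Fin n) : ℝ :=
  16 * n * (E.Vρ i 0 0 + E.Vρ i 1 1 + E.VM j 0 0 + E.VM j 1 1) / ε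

/-- The conditions on the inputs of the sampler for accuracy `ε`. -/
structure Admissible {n : ℕ} (E : Experiment n) (I : SimInput n) (ε β Λ η : ℝ) : Prop where
  modes_pos : 1 ≤ n
  mean_eq : I.mean = E.mean
  δ_pos : 0 < I.δ
  A_pos : 0 < I.A
  ε_pos : 0 < ε
  ε_lt : ε < 1
  A_odd : ∃ h : ℕ, Real.sqrt I.A = (2 * h + 1) * I.δ
  Γ_odd : ∃ h : ℕ, I.Γ = (2 * h + 1) * I.δ
  wigner_diff : Differentiable ℝ (wignerProd E.ρ)
  wigner_grad : ∀ u, ‖gradient (wignerProd E.ρ) u‖ ≤ n * β / I.A ^ n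
  kernel_grad : ∀ k u, ‖gradient (fun k' => gaussKernel E.VM k' u) k‖ ≤ n * Λ / I.A ^ n
  δ_le : I.δ ≤ min (spacingBound E ε β Λ) I.Γ
  ε₂_le : I.ε₂ ≤ opNorm E.T * I.δ * Real.sqrt (n / 2)
  A_ge : ∀ i j, areaBound E ε i j ≤ I.A
  oracle_acc : ∀ j z, |I.oracle j z - (E.ρ j).wigner (gridPoint (mode E.mean j) I.δ z)| < η
  η_le : η ≤ ε / (8 * n * I.A ^ n)

/-- The sampler's law is within `ε` in 1-norm of the Born rule distribution, binned into the cubes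
of side `Γ` that tile phase space. -/
def CloseToBorn {n : ℕ} (E : Experiment n) (I : SimInput n)
    (aff : PhaseSpace n → Comp (PhaseSpace n)) (ε : ℝ) : Prop :=
  let d : (Fin n × Fin 2 → ℤ) → ℝ := fun r =>
    let k : PhaseSpace n := WithLp.toLp 2 fun i => I.origin i + I.Γ * r i
    |quantProb E.ρ E.U E.VM I.Γ k - simProb I E.VM aff k|
  Summable d ∧ ∑' r, d r ≤ ε

/-- The spacing, the area and the error allowed in the affine map are within a factor `c` of the
bounds imposed on them, and the entries of the means and of the displacement are at most `B`. -/
structure Proportional {n : ℕ} (E : Experiment n) (I : SimInput n) (ε β Λ c B : ℝ) : Prop where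
  δ_ge : spacingBound E ε β Λ ≤ c * I.δ
  A_le : ∃ i j, I.A ≤ c * areaBound E ε i j
  ε₂_ge : opNorm E.T * I.δ * Real.sqrt (n / 2) ≤ c * I.ε₂
  mean_le : ∀ i, |E.mean i| ≤ B
  x_le : ‖E.x‖ ≤ B

/-- `n⁵ (max ‖V_ρ‖ + max ‖V_M‖) (Λ² ‖T‖² + β²) / ε³`. -/
def costScale {n : ℕ} (E : Experiment n) (ε β Λ : ℝ) : ℝ :=
  n ^ 5 * ((⨆ i, opNorm (E.Vρ i)) + ⨆ j, opNorm (E.VM j)) *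
    (Λ ^ 2 * opNorm E.T ^ 2 + β ^ 2) / ε ^ 3

/-- Every run of the sampler that occurs with positive probability takes at most `t` steps. -/
def RunsIn {n : ℕ} (E : Experiment n) (I : SimInput n)
    (aff : PhaseSpace n → Comp (PhaseSpace n)) (t : ℝ) : Prop :=
  ∀ r ∈ (simulate I E.VM aff).law.support, (r.2 : ℝ) ≤ t

end PhaseSim

end

noncomputable section

namespace PhaseSim

/-! ### Coordinates on phase space -/

/-! In phase space the experiment is classical. Let χ denote characteristic functions. The squared
overlap of a vector with a pure Gaussian state is, up to powers of 2π, the integral of the conjugate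
χ of the Gaussian against the χ of the vector (`integral_prod_charKernel_mul_charFn`). The unitary
acts on χ by the substitution b ↦ T b and a phase (`charFn_of_implements`), and the χ of a mode is
almost everywhere the symplectic Fourier transform of its Wigner function
(`ModeState.ae_charFn_eq`). Since T preserves volume, Fubini gives `bornDensity_eq`: p(k) = ∫ W(u)
M(k | T u + x) du. As W ≥ 0 and ∫ W = 1 (`ModeState.integral_wigner`), the outcome is a point drawn
from W, mapped affinely, plus Gaussian noise. The sampler discretizes exactly this.

A 1-norm distance is the supremum of ∑ s(k) (difference at k) over finite sets of outcomes and signs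
s, so the two laws are compared through expectations of bounded test functions.
`abs_integral_sub_sum_div_le` replaces an integral by a normalized grid sum at four costs: variation
of the test function on a cell, mass off the grid, discretization error of the density, and the
defect of normalization. It is applied twice. For the noise the test function is a discontinuous
function of the output bin. Shifting the grid into line with the output tiling makes it constant on
every cell, because Γ is an odd multiple of δ; the shift is paid for by the Lipschitz constant of
the noise density (`abs_integral_noise_sub_le`). The resulting expectation serves as the test
function for the input stage. Masses off the grid are bounded by Chebyshev's inequality
(`integral_outside_le`). In the total, tails account for ε/2, the spacing and the affine error for
ε/4, and the oracle for ε/4.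

For the cost, the tables take O(n A/δ²) steps, which proportionality bounds by the asserted
expression (`costScale_ge`). The affine map takes O(n²) schoolbook products of numbers with O(log)
digits. Symplecticity forces ‖T‖ ≥ 1 and the height of the Gaussian forces Λ ≥ 1, so n δ ≤ 1 and n,
A, ‖T‖ are at most y = A/δ. Bounding log y by a multiple of √y makes the bit cost O(n² y), hence O(n
A/δ²): it never exceeds the order of the table work. -/

theorem measurePreserving_uncurry (n : ℕ) :
    MeasurePreserving (MeasurableEquiv.curry (Fin n) (Fin 2) ℝ).symm := by
  refine ⟨MeasurableEquiv.measurable _, ?_⟩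
  refine (Measure.pi_eq fun s _ => ?_).symm
  rw [MeasurableEquiv.map_apply]
  have : (MeasurableEquiv.curry (Fin n) (Fin 2) ℝ).symm ⁻¹' (Set.univ.pi s) =
      Set.univ.pi fun j => Set.univ.pi fun a => s (j, a) := by
    ext f
    simp only [Set.mem_preimage, Set.mem_pi, Set.mem_univ, true_imp_iff]
    exact ⟨fun h j a => h (j, a), fun h i => h i.1 i.2⟩
  rw [this, volume_pi_pi]
  simp_rw [volume_pi_pi]
  rw [Fintype.prod_prod_type]

/-- Phase space as a product of the single-mode phase spaces. -/
def modesEquiv (n : ℕ) : (Fin n → Fin 2 → ℝ) ≃ᵐ PhaseSpace n :=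
  (MeasurableEquiv.curry (Fin n) (Fin 2) ℝ).symm.trans (MeasurableEquiv.toLp 2 _)

theorem modesEquiv_apply {n : ℕ} (u : Fin n → Fin 2 → ℝ) : modesEquiv n u = ofModes u := rfl

theorem mode_ofModes {n : ℕ} (u : Fin n → Fin 2 → ℝ) (j : Fin n) : mode (ofModes u) j = u j := rfl

theorem measurePreserving_modesEquiv (n : ℕ) : MeasurePreserving (modesEquiv n) :=
  (measurePreserving_uncurry n).trans (PiLp.volume_preserving_toLp _)

theorem measurable_mode {n : ℕ} (j : Fin n) : Measurable fun u : PhaseSpace n => mode u j := by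
  unfold mode
  fun_prop

/-- Phase space as the product of position space and momentum space. -/
def posMomEquiv (n : ℕ) : (Fin n → ℝ) × (Fin n → ℝ) ≃ᵐ PhaseSpace n :=
  ((MeasurableEquiv.arrowProdEquivProdArrow ℝ ℝ (Fin n)).symm.trans
    (MeasurableEquiv.piCongrRight fun _ => MeasurableEquiv.finTwoArrow.symm)).trans (modesEquiv n)

theorem measurePreserving_posMomEquiv (n : ℕ) : MeasurePreserving (posMomEquiv n) := by
  refine MeasurePreserving.trans (MeasurePreserving.trans
    (volume_measurePreserving_arrowProdEquivProdArrow ℝ ℝ (Fin n)).symm ?_)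
    (measurePreserving_modesEquiv n)
  exact volume_preserving_pi fun _ => (volume_preserving_finTwoArrow ℝ).symm

@[simp] theorem posMomEquiv_zero {n : ℕ} (z : (Fin n → ℝ) × (Fin n → ℝ)) (j : Fin n) :
    posMomEquiv n z (j, 0) = z.1 j := rfl

@[simp] theorem posMomEquiv_one {n : ℕ} (z : (Fin n → ℝ) × (Fin n → ℝ)) (j : Fin n) :
    posMomEquiv n z (j, 1) = z.2 j := rfl

theorem mode_posMomEquiv {n : ℕ} (z : (Fin n → ℝ) × (Fin n → ℝ)) (j : Fin n) :
    mode (posMomEquiv n z) j = ![z.1 j, z.2 j] := by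
  ext a
  fin_cases a <;> rfl

theorem integral_prod_modes {𝕜 : Type*} [RCLike 𝕜] {n : ℕ} (f : Fin n → (Fin 2 → ℝ) → 𝕜) :
    ∫ u : PhaseSpace n, ∏ j, f j (mode u j) = ∏ j, ∫ z, f j z := by
  rw [← (measurePreserving_modesEquiv n).integral_comp']
  simp only [modesEquiv_apply, mode_ofModes]
  exact integral_fintype_prod_volume_eq_prod f

theorem integrable_prod_modes {𝕜 : Type*} [RCLike 𝕜] {n : ℕ} {f : Fin n → (Fin 2 → ℝ) → 𝕜}
    (hf : ∀ j, Integrable (f j)) : Integrable fun u : PhaseSpace n => ∏ j, f j (mode u j) := by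
  rw [← (measurePreserving_modesEquiv n).integrable_comp_emb (MeasurableEquiv.measurableEmbedding _)]
  exact Integrable.fintype_prod (f := f) hf

theorem integral_finTwo {E : Type*} [NormedAddCommGroup E] [NormedSpace ℝ E]
    (f : (Fin 2 → ℝ) → E) (hf : Integrable f) : ∫ z, f z = ∫ q : ℝ, ∫ p : ℝ, f ![q, p] := by
  rw [← (volume_preserving_finTwoArrow ℝ).symm.integral_comp', Measure.volume_eq_prod,
    integral_prod]
  · rfl
  · exact ((volume_preserving_finTwoArrow ℝ).symm.integrable_comp_emb
      (MeasurableEquiv.measurableEmbedding _)).2 hf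

theorem integrable_finTwo_iff {E : Type*} [NormedAddCommGroup E]
    (f : (Fin 2 → ℝ) → E) : Integrable f ↔ Integrable fun z : ℝ × ℝ => f ![z.1, z.2] :=
  ((volume_preserving_finTwoArrow ℝ).symm.integrable_comp_emb
      (MeasurableEquiv.measurableEmbedding _)).symm

/-! ### One-mode Gaussian integrals -/

/-- The complex conjugate of the characteristic function of the one-mode Gaussian state with mean
`k` and matrix `V`. -/
def charKernel (k : Fin 2 → ℝ) (V : Matrix (Fin 2) (Fin 2) ℝ) (b : Fin 2 → ℝ) : ℂ :=
  Complex.exp (((-(V 0 0 * b 1 ^ 2 - 2 * V 0 1 * b 1 * b 0 + V 1 1 * b 0 ^ 2) / 4 : ℝ) : ℂ) -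
    Complex.I * (k 0 * b 1 - k 1 * b 0 : ℝ))

/-- The normalized Gaussian of the one-mode measurement. -/
def gaussMode (V : Matrix (Fin 2) (Fin 2) ℝ) (w : Fin 2 → ℝ) : ℝ :=
  Real.pi⁻¹ * Real.exp (-(w ⬝ᵥ (V⁻¹.mulVec w)))

theorem dotProduct_inv_mulVec {V : Matrix (Fin 2) (Fin 2) ℝ} (hs : V 1 0 = V 0 1) (hd : V.det = 1)
    (w : Fin 2 → ℝ) :
    w ⬝ᵥ (V⁻¹.mulVec w) = V 1 1 * w 0 ^ 2 - 2 * V 0 1 * w 0 * w 1 + V 0 0 * w 1 ^ 2 := by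
  rw [Matrix.inv_def, hd]
  simp [Matrix.adjugate_fin_two, Matrix.mulVec, dotProduct, Fin.sum_univ_two, hs]
  ring

/-- Matches the prefactor of the Gaussian integral over momentum with the squared normalization
constant of `gaussWave`. -/
theorem sqrt_four_pi_div {v : ℝ} (hv : 0 < v) :
    ((Real.pi : ℂ) / -(-(v : ℂ) / 4)) ^ (1 / 2 : ℂ) =
      2 * Real.pi * (((Real.pi * v) ^ (-(1 / 4) : ℝ) : ℝ) : ℂ) ^ 2 := by
  have h1 : ((Real.pi : ℂ) / -(-(v : ℂ) / 4)) = ((4 * Real.pi / v : ℝ) : ℂ) := by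
    push_cast
    field_simp
  have h2 : (1 / 2 : ℂ) = ((1 / 2 : ℝ) : ℂ) := by norm_num
  have hp := Real.pi_pos
  rw [h1, h2, ← Complex.ofReal_cpow (by positivity)]
  norm_cast
  rw [← Real.rpow_natCast ((Real.pi * v) ^ _), ← Real.rpow_mul (by positivity)]
  have : (-(1 / 4 : ℝ) * ((2 : ℕ) : ℝ)) = -(1 / 2) := by norm_num
  rw [this, Real.rpow_neg (by positivity), ← Real.sqrt_eq_rpow, ← Real.sqrt_eq_rpow]
  rw [Real.sqrt_eq_iff_mul_self_eq (by positivity) (by positivity)]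
  have := Real.mul_self_sqrt (show 0 ≤ Real.pi * v by positivity)
  field_simp
  rw [Real.sq_sqrt (by positivity)]
  ring

theorem integrable_charKernel_snd (k : Fin 2 → ℝ) {V : Matrix (Fin 2) (Fin 2) ℝ} (h0 : 0 < V 0 0)
    (q : ℝ) : Integrable fun p : ℝ => charKernel k V ![q, p] := by
  have := integrable_cexp_quadratic' (b := -(V 0 0 : ℂ) / 4) (by simp; linarith)
    (V 0 1 * q / 2 - Complex.I * k 0) (-(V 1 1 * q ^ 2) / 4 + Complex.I * k 1 * q)
  refine this.congr (ae_of_all _ fun p => ?_)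
  simp only [charKernel, Matrix.cons_val_zero, Matrix.cons_val_one]
  congr 1
  push_cast
  ring

/-- A partial Fourier transform in momentum turns a characteristic function into an integral kernel.
The kernel factorizes because the state is pure: det V = 1 eliminates `V 1 1`, and the exponent
splits into two single-variable parts. -/
theorem integral_charKernel_snd (k : Fin 2 → ℝ) {V : Matrix (Fin 2) (Fin 2) ℝ} (h0 : 0 < V 0 0)
    (hs : V 1 0 = V 0 1) (hd : V.det = 1) (q s : ℝ) :
    ∫ p : ℝ, charKernel k V ![q, p] * Complex.exp (Complex.I * (p * s : ℝ)) =
      2 * Real.pi * (gaussWave k V (s + q / 2) * (starRingEnd ℂ) (gaussWave k V (s - q / 2))) := by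
  have h0' : (V 0 0 : ℂ) ≠ 0 := by exact_mod_cast h0.ne'
  have hd' : (V 1 1 : ℂ) = (1 + V 0 1 ^ 2) / V 0 0 := by
    rw [Matrix.det_fin_two, hs] at hd
    rw [eq_div_iff h0']
    norm_cast
    linarith
  have := integral_cexp_quadratic (b := -(V 0 0 : ℂ) / 4) (by simp; linarith)
    (V 0 1 * q / 2 + Complex.I * (s - k 0)) (-(V 1 1 * q ^ 2) / 4 + Complex.I * k 1 * q)
  have e : ∀ p : ℝ, charKernel k V ![q, p] * Complex.exp (Complex.I * (p * s : ℝ)) =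
      Complex.exp (-(V 0 0 : ℂ) / 4 * p ^ 2 + (V 0 1 * q / 2 + Complex.I * (s - k 0)) * p +
        (-(V 1 1 * q ^ 2) / 4 + Complex.I * k 1 * q)) := fun p => by
    simp only [charKernel, Matrix.cons_val_zero, Matrix.cons_val_one]
    rw [← Complex.exp_add]
    congr 1
    push_cast
    ring
  simp_rw [e]
  rw [this, sqrt_four_pi_div h0]
  unfold gaussWave
  simp only [map_mul, Complex.conj_ofReal, ← Complex.exp_conj]
  have : ∀ a b c d : ℂ, a * (c * b * (c * d)) = a * c ^ 2 * (b * d) := by intros; ring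
  rw [this, ← Complex.exp_add]
  congr 2
  simp only [map_add, map_neg, map_mul, map_sub, map_div₀, map_one, map_ofNat, map_pow,
    Complex.conj_I, Complex.conj_ofReal]
  rw [hd']
  push_cast
  have hI : Complex.I ^ 2 = -1 := Complex.I_sq
  field_simp
  ring_nf
  simp only [hI]
  ring

theorem integrable_charKernel (k : Fin 2 → ℝ) {V : Matrix (Fin 2) (Fin 2) ℝ} (h0 : 0 < V 0 0)
    (hs : V 1 0 = V 0 1) (hd : V.det = 1) : Integrable (charKernel k V) := by
  rw [integrable_finTwo_iff]
  have hm : Continuous fun z : ℝ × ℝ => charKernel k V ![z.1, z.2] := by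
    unfold charKernel
    simp only [Matrix.cons_val_zero, Matrix.cons_val_one]
    fun_prop
  have h11 : V 1 1 = (1 + V 0 1 ^ 2) / V 0 0 := by
    rw [Matrix.det_fin_two, hs] at hd
    rw [eq_div_iff h0.ne']
    linarith
  -- Completing the square in p leaves a Gaussian in q times a shifted Gaussian in p, whose integral
  -- does not depend on q.
  have hn : ∀ q p : ℝ, ‖charKernel k V ![q, p]‖ =
      Real.exp (-(4 * V 0 0)⁻¹ * q ^ 2) * Real.exp (-(V 0 0 / 4) * (p - V 0 1 / V 0 0 * q) ^ 2) := by
    intro q p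
    rw [charKernel, Complex.norm_exp, ← Real.exp_add]
    congr 1
    simp only [Matrix.cons_val_zero, Matrix.cons_val_one, Complex.sub_re, Complex.ofReal_re,
      Complex.mul_re, Complex.I_re, Complex.I_im, Complex.ofReal_im]
    rw [h11]
    field_simp
    ring
  rw [Measure.volume_eq_prod, integrable_prod_iff hm.aestronglyMeasurable]
  refine ⟨ae_of_all _ fun q => integrable_charKernel_snd k h0 q, ?_⟩
  simp_rw [hn, integral_const_mul]
  have : ∀ q : ℝ, ∫ p : ℝ, Real.exp (-(V 0 0 / 4) * (p - V 0 1 / V 0 0 * q) ^ 2) =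
      ∫ p : ℝ, Real.exp (-(V 0 0 / 4) * p ^ 2) := fun q =>
    integral_sub_right_eq_self (fun p => Real.exp (-(V 0 0 / 4) * p ^ 2)) _
  simp_rw [this]
  exact (integrable_exp_neg_mul_sq (by positivity)).mul_const _

/-- The momentum integral is `integral_charKernel_snd` at s = `z 0`, so only a one-dimensional
Gaussian integral in q remains. -/
theorem integral_charKernel_mul_exp (k : Fin 2 → ℝ) {V : Matrix (Fin 2) (Fin 2) ℝ} (h0 : 0 < V 0 0)
    (hs : V 1 0 = V 0 1) (hd : V.det = 1) (z : Fin 2 → ℝ) :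
    ∫ b, charKernel k V b * Complex.exp (Complex.I * (z 0 * b 1 - z 1 * b 0 : ℝ)) =
      (2 * Real.pi) ^ 2 * (gaussMode V (z - k) : ℝ) := by
  have hi : Integrable fun b : Fin 2 → ℝ =>
      charKernel k V b * Complex.exp (Complex.I * (z 0 * b 1 - z 1 * b 0 : ℝ)) := by
    refine (integrable_charKernel k h0 hs hd).mul_bdd (c := 1) ?_ (ae_of_all _ fun b => ?_)
    · exact Continuous.aestronglyMeasurable (by fun_prop)
    · rw [mul_comm, Complex.norm_exp_ofReal_mul_I]
  rw [integral_finTwo _ hi]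
  have h1 : ∀ q : ℝ, ∫ p : ℝ, charKernel k V ![q, p] *
      Complex.exp (Complex.I * (z 0 * (![q, p] : Fin 2 → ℝ) 1 - z 1 * (![q, p] : Fin 2 → ℝ) 0 : ℝ)) =
      2 * Real.pi * (((Real.pi * V 0 0) ^ (-(1 / 4) : ℝ) : ℝ) : ℂ) ^ 2 *
        Complex.exp (-(((4 * (V 0 0 : ℝ))⁻¹ : ℝ) : ℂ) * q ^ 2 +
          (Complex.I * ((V 0 1 * (z 0 - k 0) / V 0 0 - (z 1 - k 1) : ℝ) : ℂ)) * q +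
          (-(z 0 - k 0) ^ 2 / V 0 0 : ℝ)) := by
    intro q
    have e : ∀ p : ℝ, charKernel k V ![q, p] * Complex.exp (Complex.I *
        (z 0 * (![q, p] : Fin 2 → ℝ) 1 - z 1 * (![q, p] : Fin 2 → ℝ) 0 : ℝ)) =
        charKernel k V ![q, p] * Complex.exp (Complex.I * (p * z 0 : ℝ)) *
          Complex.exp (-Complex.I * (z 1 * q : ℝ)) := fun p => by
      rw [mul_assoc, ← Complex.exp_add]
      simp only [Matrix.cons_val_zero, Matrix.cons_val_one]
      congr 2
      push_cast
      ring
    simp_rw [e]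
    rw [integral_mul_const, integral_charKernel_snd k h0 hs hd]
    unfold gaussWave
    simp only [map_mul, Complex.conj_ofReal, ← Complex.exp_conj]
    have : ∀ a b c d e : ℂ, a * (c * b * (c * d)) * e = a * c ^ 2 * (b * d * e) := by intros; ring
    rw [this, ← Complex.exp_add, ← Complex.exp_add]
    congr 2
    simp only [map_add, map_neg, map_mul, map_sub, map_div₀, map_one, map_ofNat, map_pow,
      Complex.conj_I, Complex.conj_ofReal]
    have h0' : (V 0 0 : ℂ) ≠ 0 := by exact_mod_cast h0.ne'
    push_cast
    field_simp
    ring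
  simp_rw [h1]
  rw [integral_const_mul, integral_cexp_quadratic (by simpa using h0)]
  have hV : (Real.pi : ℂ) / -(-(((4 * (V 0 0 : ℝ))⁻¹ : ℝ) : ℂ)) = ((4 * Real.pi * V 0 0 : ℝ) : ℂ) := by
    push_cast
    rw [neg_neg, div_inv_eq_mul]
    ring
  have h2 : (1 / 2 : ℂ) = ((1 / 2 : ℝ) : ℂ) := by norm_num
  have hp := Real.pi_pos
  have h3 : ((((Real.pi * V 0 0) ^ (-(1 / 4) : ℝ) : ℝ) : ℂ) ^ 2) =
      (((Real.sqrt (Real.pi * V 0 0))⁻¹ : ℝ) : ℂ) := by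
    norm_cast
    rw [← Real.rpow_natCast ((Real.pi * _) ^ _), ← Real.rpow_mul (by positivity)]
    have : (-(1 / 4 : ℝ) * ((2 : ℕ) : ℝ)) = -(1 / 2) := by norm_num
    rw [this, Real.rpow_neg (by positivity), ← Real.sqrt_eq_rpow]
  have h4 : ((4 * Real.pi * V 0 0 : ℝ) : ℂ) ^ (1 / 2 : ℂ) =
      ((2 * Real.sqrt (Real.pi * V 0 0) : ℝ) : ℂ) := by
    rw [h2, ← Complex.ofReal_cpow (by positivity), ← Real.sqrt_eq_rpow, mul_assoc,
      Real.sqrt_mul (by norm_num)]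
    congr 2
    rw [show (4 : ℝ) = 2 ^ 2 by norm_num, Real.sqrt_sq (by norm_num)]
  rw [hV, h3, h4]
  have hsq : Real.sqrt (Real.pi * V 0 0) ≠ 0 := (Real.sqrt_pos.2 (by positivity)).ne'
  unfold gaussMode
  rw [dotProduct_inv_mulVec hs hd]
  have h11 : V 1 1 = (1 + V 0 1 ^ 2) / V 0 0 := by
    rw [Matrix.det_fin_two, hs] at hd
    rw [eq_div_iff h0.ne']
    linarith
  have e : (((-(z 0 - k 0) ^ 2 / V 0 0 : ℝ) : ℂ) -
      (Complex.I * ((V 0 1 * (z 0 - k 0) / V 0 0 - (z 1 - k 1) : ℝ) : ℂ)) ^ 2 /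
        (4 * -(((4 * (V 0 0 : ℝ))⁻¹ : ℝ) : ℂ))) =
      ((-(V 1 1 * (z - k) 0 ^ 2 - 2 * V 0 1 * (z - k) 0 * (z - k) 1 + V 0 0 * (z - k) 1 ^ 2) : ℝ) : ℂ) := by
    have h0' : (V 0 0 : ℂ) ≠ 0 := by exact_mod_cast h0.ne'
    rw [h11, mul_pow, Complex.I_sq]
    simp only [Pi.sub_apply]
    push_cast
    field_simp
    ring
  rw [e, ← Complex.ofReal_exp]
  norm_cast
  field_simp

/-! ### Characteristic functions -/

theorem integrable_norm_sq_Lp {E : Type*} [MeasureSpace E] (f : Lp ℂ 2 (volume : Measure E)) :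
    Integrable fun y => ‖f y‖ ^ 2 :=
  (memLp_two_iff_integrable_sq_norm (Lp.aestronglyMeasurable f)).1 (Lp.memLp f)

section Shift

variable {E : Type*} [AddGroup E] [MeasureSpace E] [MeasurableAdd₂ E]
  [(volume : Measure E).IsAddRightInvariant]

theorem memLp_sub_right (f : Lp ℂ 2 (volume : Measure E)) (a : E) :
    MemLp (fun y => f (y - a)) 2 :=
  (Lp.memLp f).comp_measurePreserving (measurePreserving_sub_right volume a)

theorem integrable_conj_mul_sub (f : Lp ℂ 2 (volume : Measure E)) (a : E) :
    Integrable fun y => (starRingEnd ℂ) (f y) * f (y - a) :=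
  MemLp.integrable_mul (p := 2) (q := 2) (Lp.memLp f).star (memLp_sub_right f a)

/-- The inequality 2|xy| ≤ |x|² + |y|² and translation invariance suffice here. The bound is uniform
in the shift. -/
theorem integral_norm_conj_mul_sub_le (f : Lp ℂ 2 (volume : Measure E)) (a : E) :
    ∫ y, ‖(starRingEnd ℂ) (f y) * f (y - a)‖ ≤ ∫ y, ‖f y‖ ^ 2 := by
  have h1 := integrable_norm_sq_Lp f
  have h2 : Integrable fun y => ‖f (y - a)‖ ^ 2 :=
    (memLp_two_iff_integrable_sq_norm (memLp_sub_right f a).1).1 (memLp_sub_right f a)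
  have h3 : ∫ y, ‖f (y - a)‖ ^ 2 = ∫ y, ‖f y‖ ^ 2 :=
    integral_sub_right_eq_self (fun y => ‖f y‖ ^ 2) a
  calc ∫ y, ‖(starRingEnd ℂ) (f y) * f (y - a)‖
      ≤ ∫ y, (‖f y‖ ^ 2 + ‖f (y - a)‖ ^ 2) / 2 := by
        refine integral_mono (integrable_conj_mul_sub f a).norm ((h1.add h2).div_const 2) fun y => ?_
        simp only [norm_mul, RCLike.norm_conj]
        nlinarith [sq_nonneg (‖f y‖ - ‖f (y - a)‖)]
    _ = ∫ y, ‖f y‖ ^ 2 := by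
        rw [integral_div, integral_add h1 h2, h3]
        ring

end Shift

/-- The characteristic function `b ↦ ⟨f, D(b) f⟩`. -/
def charFn {n : ℕ} (f : (Fin n → ℝ) → ℂ) (b : PhaseSpace n) : ℂ :=
  ∫ y, (starRingEnd ℂ) (f y) * displace b f y

/-- The characteristic function of a single-mode wave function. -/
def charFnMode (f : ℝ → ℂ) (b : Fin 2 → ℝ) : ℂ :=
  ∫ y, (starRingEnd ℂ) (f y) * (Complex.exp (Complex.I * (b 1 * (y - b 0 / 2) : ℝ)) * f (y - b 0))

theorem norm_displace {n : ℕ} (b : PhaseSpace n) (f : (Fin n → ℝ) → ℂ) (y : Fin n → ℝ) :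
    ‖displace b f y‖ = ‖f (y - fun j => b (j, 0))‖ := by
  rw [displace, norm_mul, mul_comm Complex.I, Complex.norm_exp_ofReal_mul_I, one_mul]
  rfl

theorem stronglyMeasurable_conj_mul_displace {n : ℕ} {f : (Fin n → ℝ) → ℂ}
    (hf : StronglyMeasurable f) :
    StronglyMeasurable fun z : PhaseSpace n × (Fin n → ℝ) =>
      (starRingEnd ℂ) (f z.2) * displace z.1 f z.2 := by
  have hf' := hf.measurable
  have hc : Measurable fun z : ℂ => (starRingEnd ℂ) z := Complex.continuous_conj.measurable
  refine Measurable.stronglyMeasurable ?_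
  unfold displace
  refine (hc.comp (hf'.comp measurable_snd)).mul (Measurable.mul ?_ (hf'.comp ?_))
  · exact Continuous.measurable (by fun_prop)
  · refine measurable_pi_lambda _ fun j => ?_
    exact Continuous.measurable (by fun_prop)

theorem stronglyMeasurable_charFn {n : ℕ} {f : (Fin n → ℝ) → ℂ} (hf : StronglyMeasurable f) :
    StronglyMeasurable (charFn f) :=
  (stronglyMeasurable_conj_mul_displace hf).integral_prod_right

theorem norm_charFn_le {n : ℕ} (f : WaveFn n) (b : PhaseSpace n) :
    ‖charFn f b‖ ≤ ∫ y, ‖f y‖ ^ 2 := by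
  refine (norm_integral_le_integral_norm _).trans ?_
  refine le_of_eq_of_le ?_ (integral_norm_conj_mul_sub_le f fun j => b (j, 0))
  simp only [norm_mul, norm_displace]

theorem charFnMode_bound (f : Lp ℂ 2 (volume : Measure ℝ)) (b : Fin 2 → ℝ) :
    ‖charFnMode f b‖ ≤ ∫ y, ‖f y‖ ^ 2 := by
  refine (norm_integral_le_integral_norm _).trans ?_
  refine le_of_eq_of_le ?_ (integral_norm_conj_mul_sub_le f (b 0))
  congr 1
  ext y
  rw [norm_mul, norm_mul, mul_comm Complex.I, Complex.norm_exp_ofReal_mul_I, one_mul, norm_mul]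

theorem integral_norm_sq_Lp {E : Type*} [MeasureSpace E] (f : Lp ℂ 2 (volume : Measure E)) :
    ∫ y, ‖f y‖ ^ 2 = ‖f‖ ^ 2 := by
  have h := L2.inner_def (𝕜 := ℂ) f f
  rw [inner_self_eq_norm_sq_to_K] at h
  have : ∫ a, inner ℂ (f a) (f a) = ((∫ y, ‖f y‖ ^ 2 : ℝ) : ℂ) := by
    rw [← integral_complex_ofReal]
    congr 1
    ext a
    rw [inner_self_eq_norm_sq_to_K]
    push_cast
    rfl
  rw [this] at h
  have h' : ((‖f‖ ^ 2 : ℝ) : ℂ) = ((∫ y, ‖f y‖ ^ 2 : ℝ) : ℂ) := by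
    push_cast
    exact h
  exact_mod_cast h'.symm

theorem charFn_tensorVec {n : ℕ} (ψ : Fin n → Lp ℂ 2 (volume : Measure ℝ)) (b : PhaseSpace n) :
    charFn (tensorVec ψ) b = ∏ j, charFnMode (ψ j) (mode b j) := by
  have h1 : ⇑(tensorVec ψ) =ᵐ[volume] fun y => ∏ j, ψ j (y j) := MemLp.coeFn_toLp _
  -- The product formula holds only almost everywhere; translations preserve null sets, so it also
  -- holds at the shifted argument.
  have h2 : (fun y : Fin n → ℝ => tensorVec ψ (y - fun j => b (j, 0))) =ᵐ[volume]
      fun y => ∏ j, ψ j (y j - b (j, 0)) :=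
    (measurePreserving_sub_right volume (fun j => b (j, 0))).quasiMeasurePreserving.ae_eq_comp h1
  unfold charFn charFnMode
  rw [← integral_fintype_prod_volume_eq_prod (fun j y => (starRingEnd ℂ) (ψ j y) *
    (Complex.exp (Complex.I * (mode b j 1 * (y - mode b j 0 / 2) : ℝ)) * ψ j (y - mode b j 0)))]
  refine integral_congr_ae ?_
  filter_upwards [h1, h2] with y h1 h2
  have h2' : tensorVec ψ (fun j => y j - b (j, 0)) = ∏ j, ψ j (y j - b (j, 0)) := h2
  rw [displace, h1, h2', map_prod, Finset.prod_mul_distrib, Finset.prod_mul_distrib,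
    ← Complex.exp_sum]
  congr 3
  rw [← Finset.mul_sum]
  push_cast
  rfl

/-- Unitarity gives ⟨f, D(b) f⟩ = ⟨U f, U D(b) f⟩, and the Weyl relation moves U past D(b). The
phase of that relation cancels against the one in the statement. -/
theorem charFn_of_implements {n : ℕ} {T : Matrix (Fin n × Fin 2) (Fin n × Fin 2) ℝ}
    {x : PhaseSpace n} {U : WaveFn n ≃ₗᵢ[ℂ] WaveFn n} (hU : Implements T x U) (f : WaveFn n)
    (b : PhaseSpace n) :
    charFn (U f) (act T b) = Complex.exp (Complex.I * (symplForm x (act T b) : ℝ)) * charFn f b := by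
  have hm : MemLp (displace b f) 2 volume := by
    have h1 : MemLp (fun y => f (y - fun j => b (j, 0))) 2 := memLp_sub_right f _
    refine h1.of_le ?_ (ae_of_all _ fun y => (norm_displace b f y).le)
    refine AEStronglyMeasurable.mul ?_ h1.1
    exact Continuous.aestronglyMeasurable (by fun_prop)
  have hg : ⇑(hm.toLp) =ᵐ[volume] displace b f := MemLp.coeFn_toLp _
  have h := hU b f hm.toLp hg
  have e : ∀ u v : WaveFn n, inner ℂ u v = ∫ y, (starRingEnd ℂ) (u y) * v y := fun u v => by
    rw [L2.inner_def]
    simp [RCLike.inner_apply, mul_comm]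
  have h1 : charFn f b = inner ℂ f hm.toLp := by
    rw [e]
    refine integral_congr_ae ?_
    filter_upwards [hg] with y hy
    rw [hy]
  rw [h1, ← LinearIsometryEquiv.inner_map_map U, e, ← integral_const_mul]
  refine integral_congr_ae ?_
  filter_upwards [h] with y hy
  rw [hy]
  have : ∀ a b c d : ℂ, a * (b * (c * d)) = (a * c) * (b * d) := by intros; ring
  rw [this, ← Complex.exp_add, add_neg_cancel, Complex.exp_zero, one_mul]

/-! ### Overlaps with Gaussian states -/

theorem norm_gaussWave (k : Fin 2 → ℝ) (V : Matrix (Fin 2) (Fin 2) ℝ) (h0 : 0 < V 0 0) (y : ℝ) :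
    ‖gaussWave k V y‖ = (Real.pi * V 0 0) ^ (-(1 / 4) : ℝ) *
      Real.exp (-(2 * V 0 0)⁻¹ * (y - k 0) ^ 2) := by
  have hp := Real.pi_pos
  rw [gaussWave, norm_mul, Complex.norm_exp, Complex.norm_real, Real.norm_of_nonneg (by positivity)]
  congr 2
  have : (-((1 - Complex.I * (V 0 1 : ℝ)) / (2 * (V 0 0 : ℝ)) * ((y - k 0 : ℝ) : ℂ) ^ 2)
      + Complex.I * (k 1 * y : ℝ)) = ((-(2 * V 0 0)⁻¹ * (y - k 0) ^ 2 : ℝ) : ℂ) +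
      ((V 0 1 / (2 * V 0 0) * (y - k 0) ^ 2 + k 1 * y : ℝ) : ℂ) * Complex.I := by
    have h0' : (V 0 0 : ℂ) ≠ 0 := by exact_mod_cast h0.ne'
    push_cast
    field_simp
    ring
  rw [this]
  simp only [Complex.add_re, Complex.ofReal_re, Complex.re_ofReal_mul, Complex.I_re, mul_zero,
    add_zero]

theorem memLp_prod_gaussWave {n : ℕ} (k : PhaseSpace n) {V : Fin n → Matrix (Fin 2) (Fin 2) ℝ}
    (h0 : ∀ j, 0 < V j 0 0) :
    MemLp (fun y : Fin n → ℝ => ∏ j, gaussWave (mode k j) (V j) (y j)) 2 := by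
  have hc : Continuous fun y : Fin n → ℝ => ∏ j, gaussWave (mode k j) (V j) (y j) := by
    unfold gaussWave
    fun_prop
  rw [memLp_two_iff_integrable_sq_norm hc.aestronglyMeasurable]
  have h : ∀ j, Integrable (fun t : ℝ => ‖gaussWave (mode k j) (V j) t‖ ^ 2) volume := fun j => by
    simp_rw [norm_gaussWave _ _ (h0 j), mul_pow, ← Real.exp_nat_mul]
    refine Integrable.const_mul ?_ _
    have hi := (integrable_exp_neg_mul_sq (b := (V j 0 0)⁻¹) (by have := h0 j; positivity)).comp_sub_right
      (mode k j 0)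
    refine hi.congr (ae_of_all _ fun y => ?_)
    simp only
    congr 1
    have := (h0 j).ne'
    push_cast
    field_simp
  have := Integrable.fintype_prod (f := fun j (t : ℝ) => ‖gaussWave (mode k j) (V j) t‖ ^ 2) h
  refine this.congr (ae_of_all _ fun y => ?_)
  simp [norm_prod, Finset.prod_pow]

/-- After exchanging the integrals, q ↦ y - q separates them into ∫ h and its conjugate. -/
theorem integral_integral_mul_conj_sub {E : Type*} [AddCommGroup E] [MeasureSpace E]
    [MeasurableAdd₂ E] [MeasurableNeg E] [SFinite (volume : Measure E)]
    [(volume : Measure E).IsAddLeftInvariant] [(volume : Measure E).IsNegInvariant]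
    {h : E → ℂ} (hi : Integrable h) :
    ∫ q, ∫ y, h y * (starRingEnd ℂ) (h (y - q)) = (‖∫ y, h y‖ ^ 2 : ℝ) := by
  have hc : Integrable fun y => (starRingEnd ℂ) (h y) :=
    (RCLike.conjCLE (K := ℂ)).toContinuousLinearMap.integrable_comp hi
  rw [integral_integral_swap]
  · have : ∀ y, ∫ q, h y * (starRingEnd ℂ) (h (y - q)) = h y * (starRingEnd ℂ) (∫ q, h q) := by
      intro y
      rw [integral_const_mul, integral_sub_left_eq_self (fun t => (starRingEnd ℂ) (h t)),
        integral_conj]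
    simp_rw [this]
    rw [integral_mul_const, Complex.mul_conj, Complex.normSq_eq_norm_sq]
  · have := (hi.mul_prod hc)
    -- This shear transports the integrability of the tensor product of h with its conjugate to the
    -- integrand.
    have hmp : MeasurePreserving (fun z : E × E => (z.2, z.2 - z.1))
        ((volume : Measure E).prod volume) (volume.prod volume) := by
      have := (measurePreserving_prod_sub (volume : Measure E) (volume : Measure E))
      have h2 := ((MeasurePreserving.id (volume : Measure E)).prod
        (Measure.measurePreserving_neg (volume : Measure E))).comp
          (this.comp Measure.measurePreserving_swap)
      convert h2 using 2 with z
      simp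
    exact hmp.integrable_comp_of_integrable this

/-- A Parseval identity for characteristic functions. For fixed position part q, the momentum
integral produces g(y) times the conjugate of g(y - q). Together with the two factors of f this is
h(y) times the conjugate of h(y - q), where h = g · conj f, and `integral_integral_mul_conj_sub`
applies. -/
theorem integral_prod_charKernel_mul_charFn {n : ℕ} (k : PhaseSpace n)
    {V : Fin n → Matrix (Fin 2) (Fin 2) ℝ} (h0 : ∀ j, 0 < V j 0 0)
    (hs : ∀ j, V j 1 0 = V j 0 1) (hd : ∀ j, (V j).det = 1) (f : WaveFn n) :
    ∫ b, (∏ j, charKernel (mode k j) (V j) (mode b j)) * charFn f b =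
      (2 * Real.pi) ^ n * (‖∫ y : Fin n → ℝ,
        (starRingEnd ℂ) (∏ j, gaussWave (mode k j) (V j) (y j)) * f y‖ ^ 2 : ℝ) := by
  set g : (Fin n → ℝ) → ℂ := fun y => ∏ j, gaussWave (mode k j) (V j) (y j) with hg
  set h : (Fin n → ℝ) → ℂ := fun y => g y * (starRingEnd ℂ) (f y) with hh
  have hgm := memLp_prod_gaussWave k h0
  have hhi : Integrable h := MemLp.integrable_mul (p := 2) (q := 2) hgm (Lp.memLp f).star
  have hK : Integrable fun b : PhaseSpace n => ∏ j, charKernel (mode k j) (V j) (mode b j) :=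
    integrable_prod_modes fun j => integrable_charKernel _ (h0 j) (hs j) (hd j)
  have hint : Integrable fun b : PhaseSpace n =>
      (∏ j, charKernel (mode k j) (V j) (mode b j)) * charFn f b :=
    hK.mul_bdd (stronglyMeasurable_charFn (Lp.stronglyMeasurable f)).aestronglyMeasurable
      (ae_of_all _ (norm_charFn_le f))
  have hint' := ((measurePreserving_posMomEquiv n).integrable_comp_emb
    (MeasurableEquiv.measurableEmbedding _)).2 hint
  rw [← (measurePreserving_posMomEquiv n).integral_comp', Measure.volume_eq_prod,
    integral_prod (fun z => (∏ j, charKernel (mode k j) (V j) (mode (posMomEquiv n z) j)) *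
      charFn f (posMomEquiv n z)) hint']
  have inner : ∀ q : Fin n → ℝ, ∫ p : Fin n → ℝ,
      (∏ j, charKernel (mode k j) (V j) (mode (posMomEquiv n (q, p)) j)) *
        charFn f (posMomEquiv n (q, p)) =
      (2 * Real.pi) ^ n * ∫ y, h y * (starRingEnd ℂ) (h (y - q)) := by
    intro q
    simp only [mode_posMomEquiv, charFn, displace, posMomEquiv_zero, posMomEquiv_one]
    simp_rw [← integral_const_mul]
    have hqK : Integrable fun p : Fin n → ℝ =>
        ∏ j, charKernel (mode k j) (V j) ![q j, p j] :=
      Integrable.fintype_prod (f := fun j (p : ℝ) => charKernel (mode k j) (V j) ![q j, p])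
        fun j => integrable_charKernel_snd _ (h0 j) _
    rw [integral_integral_swap]
    · refine integral_congr_ae (ae_of_all _ fun y => ?_)
      have e : ∀ p : Fin n → ℝ, (∏ j, charKernel (mode k j) (V j) ![q j, p j]) *
          ((starRingEnd ℂ) (f y) * (Complex.exp (Complex.I *
            (∑ j, p j * (y j - q j / 2) : ℝ)) * f fun j => y j - q j)) =
          ((starRingEnd ℂ) (f y) * f (y - q)) * ∏ j, (charKernel (mode k j) (V j) ![q j, p j] *
            Complex.exp (Complex.I * (p j * (y j - q j / 2) : ℝ))) := fun p => by
        rw [Finset.prod_mul_distrib, ← Complex.exp_sum, ← Finset.mul_sum]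
        push_cast
        change _ = (starRingEnd ℂ (f y) * f (fun j => y j - q j)) * _
        ring
      simp_rw [e]
      rw [integral_const_mul, integral_fintype_prod_volume_eq_prod (fun j (p : ℝ) =>
        charKernel (mode k j) (V j) ![q j, p] *
          Complex.exp (Complex.I * (p * (y j - q j / 2) : ℝ)))]
      simp_rw [integral_charKernel_snd _ (h0 _) (hs _) (hd _)]
      have e1 : ∀ j, y j - q j / 2 + q j / 2 = y j := fun j => by ring
      have e2 : ∀ j, y j - q j / 2 - q j / 2 = (y - q) j := fun j => by
        simp only [Pi.sub_apply]
        ring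
      simp_rw [e1, e2]
      rw [Finset.prod_mul_distrib, Finset.prod_const, Finset.card_univ, Fintype.card_fin,
        Finset.prod_mul_distrib, ← map_prod]
      simp only [hh, hg, map_mul, Complex.conj_conj]
      ring
    · have h1 := hqK.mul_prod (integrable_conj_mul_sub f q)
      have h2 : Integrable (fun z : (Fin n → ℝ) × (Fin n → ℝ) =>
          ((∏ j, charKernel (mode k j) (V j) ![q j, z.1 j]) *
          ((starRingEnd ℂ) (f z.2) * f (z.2 - q))) *
          Complex.exp (Complex.I * (∑ j, z.1 j * (z.2 j - q j / 2) : ℝ)))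
          ((volume : Measure (Fin n → ℝ)).prod volume) := by
        refine h1.mul_bdd (c := 1) ?_ (ae_of_all _ fun z => ?_)
        · exact Continuous.aestronglyMeasurable (by fun_prop)
        · rw [mul_comm, Complex.norm_exp_ofReal_mul_I]
      refine h2.congr (ae_of_all _ fun z => ?_)
      change (_ * (starRingEnd ℂ (f z.2) * f (fun j => z.2 j - q j))) * _ = _
      simp only [Function.uncurry]
      ring
  simp_rw [inner]
  rw [integral_const_mul, integral_integral_mul_conj_sub hhi]
  congr 3
  rw [← norm_star, ← starRingEnd_apply, ← integral_conj]
  congr 2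
  ext y
  simp only [hh, hg, map_mul, Complex.conj_conj]

/-! ### Fourier inversion for integrable functions -/

open FourierTransform in
-- No continuity of f is available, since it will be a slice of an integral kernel. Both sides are
-- therefore tested against smooth compactly supported functions; moving the transform across the
-- pairing twice reduces the claim to inversion for Schwartz functions.
theorem fourierInv_fourier_ae_eq {f : ℝ → ℂ} (hf : Integrable f) (hf' : Integrable (𝓕 f)) :
    𝓕⁻ (𝓕 f) =ᵐ[volume] f := by
  have hcont : Continuous (𝓕 (𝓕 f)) :=
    VectorFourier.fourierIntegral_continuous Real.continuous_fourierChar continuous_inner hf'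
  have hneg : 𝓕⁻ (𝓕 f) = fun x => 𝓕 (𝓕 f) (-x) := by
    ext x
    exact Real.fourierInv_eq_fourier_neg (𝓕 f) x
  refine ae_eq_of_integral_contDiff_smul_eq ?_ hf.locallyIntegrable fun g hg hgc => ?_
  · rw [hneg]
    exact (hcont.comp continuous_neg).locallyIntegrable
  have hg₁ : HasCompactSupport (Complex.ofRealCLM ∘ g) := hgc.comp_left rfl
  have hg₂ : ContDiff ℝ _ (Complex.ofRealCLM ∘ g) := Complex.ofRealCLM.contDiff.comp hg
  set φ : SchwartzMap ℝ ℂ := hg₁.toSchwartzMap hg₂ with hφ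
  have flip : ∀ a b : ℝ → ℂ, Integrable a → Integrable b →
      ∫ x, 𝓕 a x * b x = ∫ x, a x * 𝓕 b x := fun a b ha hb => by
    simpa using! (VectorFourier.integral_fourierIntegral_smul_eq_flip (L := innerₗ ℝ)
      Real.continuous_fourierChar continuous_inner ha hb)
  obtain ⟨χ, hχ⟩ : ∃ χ : SchwartzMap ℝ ℂ, χ = 𝓕⁻ φ := ⟨_, rfl⟩
  have h1 : 𝓕 (⇑χ) = φ := by
    rw [← SchwartzMap.fourier_coe, hχ, FourierTransform.fourier_fourierInv_eq]
  have h2 : ⇑χ = 𝓕 fun x => φ (-x) := by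
    rw [hχ, SchwartzMap.fourierInv_coe, Real.fourierInv_eq_fourier_comp_neg]
  have hφi : Integrable fun x => φ (-x) := φ.integrable.comp_neg
  calc ∫ x, g x • 𝓕⁻ (𝓕 f) x = ∫ x, 𝓕 (𝓕 f) (-x) * φ x := by
        rw [hneg]
        refine integral_congr_ae (ae_of_all _ fun x => ?_)
        simp only [Complex.real_smul]
        rw [mul_comm]
        rfl
    _ = ∫ x, 𝓕 (𝓕 f) x * φ (-x) := by
        rw [← integral_neg_eq_self]
        simp
    _ = ∫ x, f x * φ x := by
        rw [flip _ _ hf' hφi, ← h2, flip _ _ hf χ.integrable, h1]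
    _ = ∫ x, g x • f x := by
        refine integral_congr_ae (ae_of_all _ fun x => ?_)
        simp only [Complex.real_smul]
        rw [mul_comm]
        rfl

theorem eq_integral_of_integrable_exp {h : ℝ → ℂ} (hh : Integrable h)
    (hi : Integrable fun p : ℝ => ∫ y, h y * Complex.exp (Complex.I * (p * y : ℝ))) :
    ∀ᵐ y : ℝ, h y = ∫ p : ℝ, ((2 * Real.pi)⁻¹ * ∫ t, h t * Complex.exp (Complex.I * (p * t : ℝ))) *
      Complex.exp (Complex.I * (-(p * y) : ℝ)) := by
  set H : ℝ → ℂ := fun p : ℝ => ∫ y, h y * Complex.exp (Complex.I * (p * y : ℝ)) with hH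
  have hp := Real.pi_pos
  -- The two conventions differ by the substitution p = -2π w, which also accounts for the factor
  -- (2π)⁻¹.
  have hF : FourierTransform.fourier h = fun w => H (w * (-2 * Real.pi)) := by
    ext w
    rw [Real.fourier_real_eq_integral_exp_smul, hH]
    refine integral_congr_ae (ae_of_all _ fun y => ?_)
    simp only [smul_eq_mul]
    rw [mul_comm]
    congr 2
    push_cast
    ring
  have hF' : Integrable (FourierTransform.fourier h) := by
    rw [hF]
    exact hi.comp_mul_right' (by simp [hp.ne'])
  filter_upwards [fourierInv_fourier_ae_eq hh hF'] with y hy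
  rw [← hy, Real.fourierInv_eq', hF]
  have := Measure.integral_comp_mul_right (fun p : ℝ => ((2 * Real.pi)⁻¹ * H p) *
      Complex.exp (Complex.I * (-(p * y) : ℝ))) (-2 * Real.pi)
  have hpc : (Real.pi : ℂ) ≠ 0 := by exact_mod_cast hp.ne'
  have e : ∀ w : ℝ, Complex.exp ((2 * Real.pi * (inner ℝ w y) : ℝ) * Complex.I) =
      Complex.exp (Complex.I * (-(w * (-2 * Real.pi) * y) : ℝ)) := fun w => by
    congr 1
    simp only [RCLike.inner_apply, conj_trivial]
    push_cast
    ring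
  have hc : (2 * Real.pi : ℂ) * ((2 * Real.pi)⁻¹ : ℝ) = 1 := by
    push_cast
    field_simp
  calc _ = (2 * Real.pi : ℂ) * ∫ x : ℝ, (2 * Real.pi)⁻¹ * H (x * (-2 * Real.pi)) *
        Complex.exp (Complex.I * (-(x * (-2 * Real.pi) * y) : ℝ)) := by
        rw [← integral_const_mul]
        refine integral_congr_ae (ae_of_all _ fun w => ?_)
        simp only [smul_eq_mul, e]
        linear_combination (-(Complex.exp (Complex.I * (-(w * (-2 * Real.pi) * y) : ℝ)) *
          H (w * (-2 * Real.pi)))) * hc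
    _ = _ := by
        rw [this, abs_inv, abs_mul, abs_neg, abs_of_pos hp, abs_two, Complex.real_smul,
          ← mul_assoc, hc, one_mul]

/-! ### Single-mode states: Wigner function and characteristic function -/

theorem integrable_tsum {α : Type*} [MeasurableSpace α] {μ : Measure α} {f : ℕ → α → ℂ}
    (hf : ∀ i, Integrable (f i) μ) (hs : Summable fun i => ∫ a, ‖f i a‖ ∂μ) :
    Integrable (fun a => ∑' i, f i a) μ := by
  have hfin : ∑' i, ∫⁻ a, ‖f i a‖ₑ ∂μ ≠ ⊤ := by
    have (i : ℕ) : ∫⁻ a, ‖f i a‖ₑ ∂μ = ENNReal.ofReal (∫ a, ‖f i a‖ ∂μ) :=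
      (ofReal_integral_norm_eq_lintegral_enorm (hf i)).symm
    simp_rw [this]
    exact hs.tsum_ofReal_ne_top
  have hm : ∀ i, AEMeasurable (fun a => ‖f i a‖ₑ) μ := fun i => (hf i).1.enorm
  refine ⟨?_, ?_⟩
  · obtain ⟨g, hg⟩ : ∃ g : ℕ → α → ℂ, ∀ i, Measurable (g i) ∧ f i =ᵐ[μ] g i :=
      ⟨fun i => (hf i).1.aemeasurable.mk _, fun i =>
        ⟨(hf i).1.aemeasurable.measurable_mk, (hf i).1.aemeasurable.ae_eq_mk⟩⟩
    refine (Measurable.tsum (L := SummationFilter.unconditional ℕ) fun i => (hg i).1).aestronglyMeasurable.congr ?_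
    filter_upwards [ae_all_iff.2 fun i => (hg i).2] with a ha
    simp [ha]
  · rw [hasFiniteIntegral_iff_enorm]
    refine lt_of_le_of_lt (lintegral_mono fun a => enorm_tsum_le_tsum_enorm) ?_
    rw [lintegral_tsum hm]
    exact hfin.lt_top

/-- The integral kernel of the state in midpoint coordinates, at `q - y / 2` and `q + y / 2`. -/
def ModeState.kernel (ρ : ModeState) (q y : ℝ) : ℂ :=
  ∑' i, ρ.weight i * (ρ.vec i (q - y / 2) * (starRingEnd ℂ) (ρ.vec i (q + y / 2)))

/-- The characteristic function of a single-mode state. -/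
def ModeState.charFn (ρ : ModeState) (b : Fin 2 → ℝ) : ℂ :=
  ∑' i, ρ.weight i * charFnMode (ρ.vec i) b

theorem measurable_Lp {E : Type*} [MeasureSpace E] (f : Lp ℂ 2 (volume : Measure E)) :
    Measurable f := (Lp.stronglyMeasurable f).measurable

theorem measurable_conj : Measurable fun z : ℂ => (starRingEnd ℂ) z :=
  Complex.continuous_conj.measurable

theorem ModeState.measurable_kernel (ρ : ModeState) :
    Measurable fun z : ℝ × ℝ => ρ.kernel z.1 z.2 := by
  refine Measurable.tsum fun i => Measurable.const_mul (Measurable.mul ?_ ?_) _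
  · exact (measurable_Lp _).comp (by fun_prop)
  · exact measurable_conj.comp ((measurable_Lp _).comp (by fun_prop))

section Vec

variable (ψ : Lp ℂ 2 (volume : Measure ℝ))

theorem integrable_midpoint_snd (q : ℝ) :
    Integrable fun y : ℝ => ψ (q - y / 2) * (starRingEnd ℂ) (ψ (q + y / 2)) := by
  have h1 : MemLp (fun t => ψ (q - t)) 2 :=
    (Lp.memLp ψ).comp_measurePreserving (Measure.measurePreserving_sub_left volume q)
  have h2 : MemLp (fun t => ψ (q + t)) 2 :=
    (Lp.memLp ψ).comp_measurePreserving (measurePreserving_add_left volume q)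
  exact (MemLp.integrable_mul (p := 2) (q := 2) h1 h2.star).comp_div two_ne_zero

theorem integral_norm_midpoint_snd_le (q : ℝ) :
    ∫ y : ℝ, ‖ψ (q - y / 2) * (starRingEnd ℂ) (ψ (q + y / 2))‖ ≤ 2 * ‖ψ‖ ^ 2 := by
  have h1 : Integrable fun t : ℝ => ‖ψ (q - t / 2)‖ ^ 2 :=
    ((integrable_norm_sq_Lp ψ).comp_sub_left q).comp_div two_ne_zero
  have h2 : Integrable fun t : ℝ => ‖ψ (q + t / 2)‖ ^ 2 :=
    ((integrable_norm_sq_Lp ψ).comp_add_left q).comp_div two_ne_zero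
  have e1 : ∫ t : ℝ, ‖ψ (q - t / 2)‖ ^ 2 = 2 * ‖ψ‖ ^ 2 := by
    rw [Measure.integral_comp_div (fun t => ‖ψ (q - t)‖ ^ 2),
      integral_sub_left_eq_self (fun t => ‖ψ t‖ ^ 2), integral_norm_sq_Lp]
    simp
  have e2 : ∫ t : ℝ, ‖ψ (q + t / 2)‖ ^ 2 = 2 * ‖ψ‖ ^ 2 := by
    rw [Measure.integral_comp_div (fun t => ‖ψ (q + t)‖ ^ 2),
      integral_add_left_eq_self (fun t => ‖ψ t‖ ^ 2), integral_norm_sq_Lp]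
    simp
  calc ∫ y : ℝ, ‖ψ (q - y / 2) * (starRingEnd ℂ) (ψ (q + y / 2))‖
      ≤ ∫ y : ℝ, (‖ψ (q - y / 2)‖ ^ 2 + ‖ψ (q + y / 2)‖ ^ 2) / 2 := by
        refine integral_mono (integrable_midpoint_snd ψ q).norm ((h1.add h2).div_const 2) fun y => ?_
        simp only [norm_mul, RCLike.norm_conj]
        nlinarith [sq_nonneg (‖ψ (q - y / 2)‖ - ‖ψ (q + y / 2)‖)]
    _ = 2 * ‖ψ‖ ^ 2 := by
        rw [integral_div, integral_add h1 h2, e1, e2]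
        ring

theorem integrable_midpoint_fst (y : ℝ) :
    Integrable fun q : ℝ => ψ (q - y / 2) * (starRingEnd ℂ) (ψ (q + y / 2)) := by
  refine ((integrable_conj_mul_sub ψ y).comp_add_right (y / 2)).congr (ae_of_all _ fun q => ?_)
  simp only
  rw [mul_comm, show q + y / 2 - y = q - y / 2 by ring]

theorem integral_norm_midpoint_fst_le (y : ℝ) :
    ∫ q : ℝ, ‖ψ (q - y / 2) * (starRingEnd ℂ) (ψ (q + y / 2))‖ ≤ ‖ψ‖ ^ 2 := by
  rw [← integral_norm_sq_Lp]
  refine le_of_eq_of_le ?_ (integral_norm_conj_mul_sub_le ψ y)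
  rw [← integral_add_right_eq_self (fun t => ‖(starRingEnd ℂ) (ψ t) * ψ (t - y)‖) (y / 2)]
  congr 1
  ext q
  rw [mul_comm, show q + y / 2 - y = q - y / 2 by ring]

theorem charFnMode_eq (b : Fin 2 → ℝ) :
    charFnMode ψ b = ∫ q : ℝ, (ψ (q - b 0 / 2) * (starRingEnd ℂ) (ψ (q + b 0 / 2))) *
      Complex.exp (Complex.I * (b 1 * q : ℝ)) := by
  rw [charFnMode, ← integral_add_right_eq_self _ (b 0 / 2)]
  congr 1
  ext q
  rw [add_sub_cancel_right, show q + b 0 / 2 - b 0 = q - b 0 / 2 by ring]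
  ring

/-- The reflection y ↦ -y shows that the integral equals its own conjugate, so taking the real part
loses nothing. -/
theorem wignerPure_eq (z : Fin 2 → ℝ) :
    (wignerPure ψ z : ℂ) = (2 * Real.pi : ℂ)⁻¹ * ∫ y : ℝ,
      (ψ (z 0 - y / 2) * (starRingEnd ℂ) (ψ (z 0 + y / 2))) *
        Complex.exp (Complex.I * (z 1 * y : ℝ)) := by
  have : (starRingEnd ℂ) (∫ y : ℝ, (ψ (z 0 - y / 2) * (starRingEnd ℂ) (ψ (z 0 + y / 2))) *
        Complex.exp (Complex.I * (z 1 * y : ℝ))) =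
      ∫ y : ℝ, (ψ (z 0 - y / 2) * (starRingEnd ℂ) (ψ (z 0 + y / 2))) *
        Complex.exp (Complex.I * (z 1 * y : ℝ)) := by
    rw [← integral_conj, ← integral_neg_eq_self]
    congr 1
    ext y
    simp only [map_mul, Complex.conj_conj, ← Complex.exp_conj, Complex.conj_I, Complex.conj_ofReal]
    rw [neg_div, sub_neg_eq_add, ← sub_eq_add_neg, mul_comm (starRingEnd ℂ _)]
    congr 2
    push_cast
    ring
  rw [wignerPure, Complex.ofReal_mul, Complex.conj_eq_iff_re.1 this]
  push_cast
  rfl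

theorem abs_wignerPure_le (z : Fin 2 → ℝ) : |wignerPure ψ z| ≤ Real.pi⁻¹ * ‖ψ‖ ^ 2 := by
  have hp := Real.pi_pos
  rw [← Real.norm_eq_abs, ← Complex.norm_real, wignerPure_eq, norm_mul]
  have h := (norm_integral_le_integral_norm (fun y : ℝ =>
      (ψ (z 0 - y / 2) * (starRingEnd ℂ) (ψ (z 0 + y / 2))) *
        Complex.exp (Complex.I * (z 1 * y : ℝ)))).trans
    (le_of_eq_of_le (by
      congr 1
      ext y
      rw [norm_mul, mul_comm Complex.I, Complex.norm_exp_ofReal_mul_I, mul_one])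
      (integral_norm_midpoint_snd_le ψ (z 0)))
  have e : ‖(2 * Real.pi : ℂ)⁻¹‖ = (2 * Real.pi)⁻¹ := by
    rw [norm_inv, norm_mul, Complex.norm_real, Real.norm_of_nonneg hp.le]
    simp
  rw [e]
  calc (2 * Real.pi)⁻¹ * _ ≤ (2 * Real.pi)⁻¹ * (2 * ‖ψ‖ ^ 2) := by gcongr
    _ = Real.pi⁻¹ * ‖ψ‖ ^ 2 := by
      field_simp

end Vec

namespace ModeState

variable (ρ : ModeState)

/-- Summable weights and one bound for all the L¹ norms justify exchanging the ensemble sum with the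
integral. -/
theorem hasSum_integral_kernel_mul {α : Type*} [MeasurableSpace α] {μ : Measure α}
    {f : ℕ → α → ℂ} {C : ℝ} (hf : ∀ i, Integrable (f i) μ) (hC : ∀ i, ∫ a, ‖f i a‖ ∂μ ≤ C) :
    Integrable (fun a => ∑' i, ρ.weight i * f i a) μ ∧
      HasSum (fun i => ρ.weight i * ∫ a, f i a ∂μ) (∫ a, ∑' i, ρ.weight i * f i a ∂μ) := by
  have h1 : ∀ i, Integrable (fun a => ρ.weight i * f i a) μ := fun i => (hf i).const_mul _
  have h2 : Summable fun i => ∫ a, ‖ρ.weight i * f i a‖ ∂μ := by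
    refine Summable.of_nonneg_of_le (fun i => integral_nonneg fun a => norm_nonneg _) (fun i => ?_)
      (ρ.hasSum_weight.summable.mul_right C)
    simp only [norm_mul, Complex.norm_real, Real.norm_of_nonneg (ρ.weight_nonneg i)]
    rw [integral_const_mul]
    exact mul_le_mul_of_nonneg_left (hC i) (ρ.weight_nonneg i)
  refine ⟨integrable_tsum h1 h2, ?_⟩
  have := hasSum_integral_of_summable_integral_norm h1 h2
  simp_rw [integral_const_mul] at this
  exact this

theorem summable_wigner (z : Fin 2 → ℝ) :
    Summable fun i => ρ.weight i * wignerPure (ρ.vec i) z := by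
  refine Summable.of_norm_bounded (ρ.hasSum_weight.summable.mul_right Real.pi⁻¹) fun i => ?_
  rw [norm_mul, Real.norm_of_nonneg (ρ.weight_nonneg i)]
  refine mul_le_mul_of_nonneg_left ?_ (ρ.weight_nonneg i)
  simpa [ρ.norm_vec i] using abs_wignerPure_le (ρ.vec i) z

theorem wigner_le (z : Fin 2 → ℝ) : ρ.wigner z ≤ Real.pi⁻¹ := by
  have h := (ρ.summable_wigner z).tsum_le_tsum (fun i => ?_) (ρ.hasSum_weight.summable.mul_right Real.pi⁻¹)
  · rw [tsum_mul_right, ρ.hasSum_weight.tsum_eq, one_mul] at h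
    exact h
  · refine mul_le_mul_of_nonneg_left ((le_abs_self _).trans ?_) (ρ.weight_nonneg i)
    simpa [ρ.norm_vec i] using abs_wignerPure_le (ρ.vec i) z

theorem norm_midpoint_mul_exp (i : ℕ) (q y t : ℝ) :
    ‖(ρ.vec i (q - y / 2) * (starRingEnd ℂ) (ρ.vec i (q + y / 2))) *
      Complex.exp (Complex.I * (t : ℝ))‖ =
    ‖ρ.vec i (q - y / 2) * (starRingEnd ℂ) (ρ.vec i (q + y / 2))‖ := by
  rw [norm_mul, mul_comm Complex.I, Complex.norm_exp_ofReal_mul_I, mul_one]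

theorem integrable_kernel_snd (q : ℝ) : Integrable fun y => ρ.kernel q y :=
  (ρ.hasSum_integral_kernel_mul (fun i => integrable_midpoint_snd (ρ.vec i) q)
    (fun i => integral_norm_midpoint_snd_le (ρ.vec i) q |>.trans_eq (by rw [ρ.norm_vec i]))).1

theorem wigner_eq (z : Fin 2 → ℝ) :
    (ρ.wigner z : ℂ) =
      (2 * Real.pi : ℂ)⁻¹ * ∫ y, ρ.kernel (z 0) y * Complex.exp (Complex.I * (z 1 * y : ℝ)) := by
  have h := (ρ.hasSum_integral_kernel_mul (f := fun i (y : ℝ) =>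
    (ρ.vec i (z 0 - y / 2) * (starRingEnd ℂ) (ρ.vec i (z 0 + y / 2))) *
      Complex.exp (Complex.I * (z 1 * y : ℝ))) (C := 2) (μ := volume) (fun i =>
      (integrable_midpoint_snd (ρ.vec i) (z 0)).mul_bdd (c := 1)
        (Continuous.aestronglyMeasurable (by fun_prop)) (ae_of_all _ fun y => by
          rw [mul_comm Complex.I, Complex.norm_exp_ofReal_mul_I])) (fun i => by
      simp only [norm_midpoint_mul_exp]
      exact integral_norm_midpoint_snd_le (ρ.vec i) (z 0) |>.trans_eq (by simp [ρ.norm_vec i]))).2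
  have h' := h.mul_left ((2 * Real.pi : ℂ)⁻¹)
  rw [wigner, Complex.ofReal_tsum]
  have e : ∀ y : ℝ, ρ.kernel (z 0) y * Complex.exp (Complex.I * (z 1 * y : ℝ)) =
      ∑' i, ρ.weight i * ((ρ.vec i (z 0 - y / 2) * (starRingEnd ℂ) (ρ.vec i (z 0 + y / 2))) *
        Complex.exp (Complex.I * (z 1 * y : ℝ))) := fun y => by
    rw [kernel, ← tsum_mul_right]
    congr 1
    ext i
    ring
  simp_rw [e]
  rw [← h'.tsum_eq]
  congr 1
  ext i
  rw [Complex.ofReal_mul, wignerPure_eq]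
  ring

theorem charFn_eq (b : Fin 2 → ℝ) :
    HasSum (fun i => ρ.weight i * charFnMode (ρ.vec i) b)
      (∫ q, ρ.kernel q (b 0) * Complex.exp (Complex.I * (b 1 * q : ℝ))) := by
  have h := (ρ.hasSum_integral_kernel_mul (f := fun i (q : ℝ) =>
    (ρ.vec i (q - b 0 / 2) * (starRingEnd ℂ) (ρ.vec i (q + b 0 / 2))) *
      Complex.exp (Complex.I * (b 1 * q : ℝ))) (C := 1) (μ := volume) (fun i =>
      (integrable_midpoint_fst (ρ.vec i) (b 0)).mul_bdd (c := 1)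
        (Continuous.aestronglyMeasurable (by fun_prop)) (ae_of_all _ fun y => by
          rw [mul_comm Complex.I, Complex.norm_exp_ofReal_mul_I])) (fun i => by
      simp only [norm_midpoint_mul_exp]
      exact integral_norm_midpoint_fst_le (ρ.vec i) (b 0) |>.trans_eq (by simp [ρ.norm_vec i]))).2
  have e : ∀ q : ℝ, ρ.kernel q (b 0) * Complex.exp (Complex.I * (b 1 * q : ℝ)) =
      ∑' i, ρ.weight i * ((ρ.vec i (q - b 0 / 2) * (starRingEnd ℂ) (ρ.vec i (q + b 0 / 2))) *
        Complex.exp (Complex.I * (b 1 * q : ℝ))) := fun y => by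
    rw [kernel, ← tsum_mul_right]
    congr 1
    ext i
    ring
  simp_rw [e, charFnMode_eq]
  exact h

theorem measurable_wigner : Measurable ρ.wigner := by
  have h : Measurable fun z : (Fin 2 → ℝ) × ℝ =>
      ρ.kernel (z.1 0) z.2 * Complex.exp (Complex.I * (z.1 1 * z.2 : ℝ)) := by
    refine Measurable.mul ?_ (Continuous.measurable (by fun_prop))
    have hg : Measurable fun z : (Fin 2 → ℝ) × ℝ => (z.1 0, z.2) := by fun_prop
    have := ρ.measurable_kernel.comp hg
    simpa only [Function.comp_def] using this
  have h2 := (h.stronglyMeasurable.integral_prod_right' (ν := (volume : Measure ℝ))).measurable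
  have e : ρ.wigner = fun z => ((2 * Real.pi : ℂ)⁻¹ *
      ∫ y, ρ.kernel (z 0) y * Complex.exp (Complex.I * (z 1 * y : ℝ))).re := by
    ext z
    rw [← ρ.wigner_eq z, Complex.ofReal_re]
  rw [e]
  exact Complex.measurable_re.comp (h2.const_mul _)

/-- For fixed q the Wigner function is the Fourier transform of the kernel in y, integrable in p for
almost every q, so inversion recovers the kernel at almost every (q, y). Transforming in q then
gives χ. The exceptional set concerns only y; keeping every t allows a restriction to the line t = 0
later. -/
theorem ae_charFn_eq_fst (hW : Integrable ρ.wigner) :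
    ∀ᵐ y : ℝ, ∀ t : ℝ, ρ.charFn ![y, t] =
      ∫ z, (ρ.wigner z : ℂ) * Complex.exp (Complex.I * (z 0 * t - z 1 * y : ℝ)) := by
  have hW2 := (integrable_finTwo_iff _).1 hW
  have h1 : ∀ᵐ q : ℝ, ∀ᵐ y : ℝ, ρ.kernel q y =
      ∫ p : ℝ, (ρ.wigner ![q, p] : ℂ) * Complex.exp (Complex.I * (-(p * y) : ℝ)) := by
    have hWq := hW2.prod_right_ae
    filter_upwards [hWq] with q hq
    have hi : Integrable fun p : ℝ =>
        ∫ y, ρ.kernel q y * Complex.exp (Complex.I * (p * y : ℝ)) := by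
      have := (hq.ofReal (𝕜 := ℂ)).const_mul (2 * Real.pi)
      refine this.congr (ae_of_all _ fun p => ?_)
      have hp : (Real.pi : ℂ) ≠ 0 := by exact_mod_cast Real.pi_pos.ne'
      have := ρ.wigner_eq ![q, p]
      simp only [Matrix.cons_val_zero, Matrix.cons_val_one] at this
      change (2 * Real.pi : ℂ) * (ρ.wigner ![q, p] : ℂ) = _
      rw [this]
      field_simp
    filter_upwards [eq_integral_of_integrable_exp (ρ.integrable_kernel_snd q) hi] with y hy
    rw [hy]
    congr 1
    ext p
    rw [ρ.wigner_eq ![q, p], Complex.ofReal_inv, Complex.ofReal_mul, Complex.ofReal_ofNat]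
    rfl
  -- Measurability of this set is what permits swapping "almost every q" with "almost every y".
  have hmeas : MeasurableSet {z : ℝ × ℝ | ρ.kernel z.1 z.2 =
      ∫ p : ℝ, (ρ.wigner ![z.1, p] : ℂ) * Complex.exp (Complex.I * (-(p * z.2) : ℝ))} := by
    refine measurableSet_eq_fun ρ.measurable_kernel ?_
    refine StronglyMeasurable.measurable ?_
    refine StronglyMeasurable.integral_prod_right' (f := fun z : (ℝ × ℝ) × ℝ =>
      (ρ.wigner ![z.1.1, z.2] : ℂ) * Complex.exp (Complex.I * (-(z.2 * z.1.2) : ℝ))) ?_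
    refine Measurable.stronglyMeasurable (Measurable.mul ?_ (Continuous.measurable (by fun_prop)))
    exact Complex.measurable_ofReal.comp (ρ.measurable_wigner.comp
      (measurable_pi_lambda _ fun a => by fin_cases a <;> simp <;> fun_prop))
  have h2 := (Measure.ae_ae_comm hmeas).1 h1
  filter_upwards [h2] with y hy t
  have hint : Integrable fun z : Fin 2 → ℝ =>
      (ρ.wigner z : ℂ) * Complex.exp (Complex.I * (z 0 * t - z 1 * y : ℝ)) :=
    (hW.ofReal (𝕜 := ℂ)).mul_bdd (c := 1) (Continuous.aestronglyMeasurable (by fun_prop))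
      (ae_of_all _ fun z => by rw [mul_comm Complex.I, Complex.norm_exp_ofReal_mul_I])
  rw [charFn, (ρ.charFn_eq ![y, t]).tsum_eq, integral_finTwo _ hint]
  refine integral_congr_ae ?_
  filter_upwards [hy] with q hq
  simp only [Matrix.cons_val_zero, Matrix.cons_val_one]
  rw [hq, ← integral_mul_const]
  congr 1
  ext p
  rw [mul_assoc, ← Complex.exp_add]
  congr 2
  push_cast
  ring

theorem ae_charFn_eq (hW : Integrable ρ.wigner) :
    ∀ᵐ b : Fin 2 → ℝ, ρ.charFn b =
      ∫ z, (ρ.wigner z : ℂ) * Complex.exp (Complex.I * (z 0 * b 1 - z 1 * b 0 : ℝ)) := by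
  have h := (Measure.quasiMeasurePreserving_eval (fun _ : Fin 2 => (volume : Measure ℝ)) 0).ae
    (ρ.ae_charFn_eq_fst hW)
  refine (show ∀ᵐ b : Fin 2 → ℝ, _ from h).mono fun b hb => ?_
  rw [← hb (b 1)]
  congr 1
  ext a
  fin_cases a <;> rfl

/-- The integral of W should be χ(0) = 1, but the formula for χ is known only almost everywhere. On
the line t = 0 both sides are continuous in y, by strong continuity of translations in L² and by
dominated convergence, so they agree at y = 0. -/
theorem integral_wigner (hW : Integrable ρ.wigner) : ∫ z, ρ.wigner z = 1 := by
  have hc1 : Continuous fun y : ℝ => ρ.charFn ![y, 0] := by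
    refine continuous_tsum (u := ρ.weight) (fun i => ?_) ρ.hasSum_weight.summable fun i y => ?_
    · refine Continuous.const_mul ?_ _
      have hg : Continuous fun y : ℝ => (⟨fun t => t - y, by fun_prop⟩ : C(ℝ, ℝ)) :=
        ContinuousMap.continuous_of_continuous_uncurry _ (by
          simp only [Function.uncurry_def, ContinuousMap.coe_mk]
          fun_prop)
      have h := (continuous_const (y := ρ.vec i)).compMeasurePreservingLp hg
        (fun y => measurePreserving_sub_right (volume : Measure ℝ) y) (by norm_num : (2 : ENNReal) ≠ ⊤)
      have h' : Continuous fun y => inner ℂ (ρ.vec i) (Lp.compMeasurePreserving _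
        (measurePreserving_sub_right (volume : Measure ℝ) y) (ρ.vec i)) := continuous_const.inner h
      refine h'.congr fun y => ?_
      rw [L2.inner_def, charFnMode]
      refine integral_congr_ae ?_
      filter_upwards [Lp.coeFn_compMeasurePreserving (ρ.vec i)
        (measurePreserving_sub_right (volume : Measure ℝ) y)] with t ht
      rw [ht]
      simp [mul_comm]
    · rw [norm_mul, Complex.norm_real, Real.norm_of_nonneg (ρ.weight_nonneg i)]
      refine mul_le_of_le_one_right (ρ.weight_nonneg i) ((charFnMode_bound _ _).trans ?_)
      rw [integral_norm_sq_Lp, ρ.norm_vec i]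
      norm_num
  have hc2 : Continuous fun y : ℝ =>
      ∫ z, (ρ.wigner z : ℂ) * Complex.exp (Complex.I * (z 0 * 0 - z 1 * y : ℝ)) := by
    refine continuous_of_dominated (bound := fun z => ‖ρ.wigner z‖) (fun y => ?_) (fun y => ?_)
      hW.norm ?_
    · exact (hW.ofReal (𝕜 := ℂ)).1.mul (Continuous.aestronglyMeasurable (by fun_prop))
    · refine ae_of_all _ fun z => ?_
      rw [norm_mul, mul_comm Complex.I, Complex.norm_exp_ofReal_mul_I, mul_one, Complex.norm_real]
    · exact ae_of_all _ fun z => by fun_prop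
  have heq := (hc1.ae_eq_iff_eq (μ := volume) hc2).1
    ((ρ.ae_charFn_eq_fst hW).mono fun y hy => hy 0)
  have h0 := congrFun heq 0
  have e1 : ∀ i, charFnMode (ρ.vec i) ![0, 0] = 1 := fun i => by
    rw [charFnMode]
    simp only [Matrix.cons_val_zero, Matrix.cons_val_one, zero_mul, Complex.ofReal_zero, mul_zero,
      Complex.exp_zero, one_mul, sub_zero]
    have := integral_norm_sq_Lp (ρ.vec i)
    rw [ρ.norm_vec i, one_pow] at this
    have h' := congrArg (fun r : ℝ => (r : ℂ)) this
    simp only [← integral_complex_ofReal] at h'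
    rw [Complex.ofReal_one] at h'
    rw [← h']
    congr 1
    ext y
    rw [mul_comm, Complex.mul_conj, Complex.normSq_eq_norm_sq]
  simp only [charFn, e1, mul_one, mul_zero, sub_zero, Complex.ofReal_zero, Complex.exp_zero] at h0
  rw [← Complex.ofReal_tsum, ρ.hasSum_weight.tsum_eq, integral_complex_ofReal] at h0
  exact_mod_cast h0.symm

end ModeState

/-! ### Symplectic maps preserve the volume -/

theorem act_apply {ι : Type} [Fintype ι] [DecidableEq ι] (T : Matrix ι ι ℝ)
    (u : EuclideanSpace ℝ ι) (i : ι) : act T u i = ∑ k, T i k * u k := by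
  rw [act, Matrix.ofLp_toEuclideanCLM]
  rfl

/-- The matrix of the standard symplectic form. -/
def symplMatrix (n : ℕ) : Matrix (Fin n × Fin 2) (Fin n × Fin 2) ℝ :=
  Matrix.kroneckerMap (fun a b => a * b) (1 : Matrix (Fin n) (Fin n) ℝ) !![0, 1; -1, 0]

theorem symplForm_eq {n : ℕ} (u v : PhaseSpace n) :
    symplForm u v = (WithLp.ofLp u) ⬝ᵥ (symplMatrix n).mulVec (WithLp.ofLp v) := by
  simp only [symplForm, dotProduct, Matrix.mulVec, symplMatrix, Matrix.kroneckerMap_apply,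
    Fintype.sum_prod_type, Fin.sum_univ_two, Matrix.one_apply]
  refine Finset.sum_congr rfl fun j _ => ?_
  simp
  ring

theorem det_symplMatrix (n : ℕ) : (symplMatrix n).det = 1 := by
  rw [symplMatrix, Matrix.det_kronecker]
  simp [Matrix.det_fin_two]

theorem IsSymplectic.transpose_mul_mul {n : ℕ} {T : Matrix (Fin n × Fin 2) (Fin n × Fin 2) ℝ}
    (h : IsSymplectic T) : T.transpose * symplMatrix n * T = symplMatrix n := by
  ext i j
  have := h (EuclideanSpace.single i 1) (EuclideanSpace.single j 1)
  rw [symplForm_eq, symplForm_eq, act, Matrix.ofLp_toEuclideanCLM, Matrix.ofLp_toEuclideanCLM] at this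
  simp only [PiLp.ofLp_single] at this
  rw [Matrix.mulVec_mulVec, Matrix.dotProduct_mulVec, Matrix.vecMul_mulVec] at this
  simp at this
  rw [← this, Matrix.mul_assoc]

/-- Taking determinants in TᵀJT = J gives det² = 1. The sign is irrelevant for the volume. -/
theorem IsSymplectic.abs_det {n : ℕ} {T : Matrix (Fin n × Fin 2) (Fin n × Fin 2) ℝ}
    (h : IsSymplectic T) : |T.det| = 1 := by
  have := congrArg Matrix.det h.transpose_mul_mul
  rw [Matrix.det_mul, Matrix.det_mul, Matrix.det_transpose, det_symplMatrix, mul_one] at this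
  rw [abs_eq zero_le_one]
  exact mul_self_eq_one_iff.1 this

theorem IsSymplectic.measurePreserving {n : ℕ} {T : Matrix (Fin n × Fin 2) (Fin n × Fin 2) ℝ}
    (h : IsSymplectic T) : MeasurePreserving (act T) := by
  have hd : LinearMap.det (act T : PhaseSpace n →ₗ[ℝ] PhaseSpace n) = T.det := by
    rw [act, Matrix.coe_toEuclideanCLM_eq_toEuclideanLin, Matrix.toEuclideanLin_eq_toLin_orthonormal,
      LinearMap.det_toLin]
  have h0 : T.det ≠ 0 := fun h0 => by simpa [h0] using h.abs_det
  refine ⟨(act T).continuous.measurable, ?_⟩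
  have := Measure.map_linearMap_addHaar_eq_smul_addHaar (volume : Measure (PhaseSpace n))
    (f := (act T : PhaseSpace n →ₗ[ℝ] PhaseSpace n)) (by rwa [hd])
  rw [hd, abs_inv, h.abs_det, inv_one, ENNReal.ofReal_one, one_smul] at this
  exact this

theorem IsSymplectic.measurableEmbedding {n : ℕ} {T : Matrix (Fin n × Fin 2) (Fin n × Fin 2) ℝ}
    (h : IsSymplectic T) : MeasurableEmbedding (act T) := by
  have h0 : T.det ≠ 0 := fun h0 => by simpa [h0] using h.abs_det
  refine (act T).continuous.measurableEmbedding fun u v huv => ?_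
  have := congrArg WithLp.ofLp huv
  rw [act, Matrix.ofLp_toEuclideanCLM, Matrix.ofLp_toEuclideanCLM] at this
  have h2 := Matrix.mulVec_injective_of_isUnit ((Matrix.isUnit_iff_isUnit_det T).2 h0.isUnit) this
  exact WithLp.ofLp_injective _ h2

/-! ### Products of sums -/

theorem hasSum_prod_pi {𝕜 : Type*} [RCLike 𝕜] : ∀ {n : ℕ} {f : Fin n → ℕ → 𝕜},
    (∀ j, Summable fun i => ‖f j i‖) →
      (Summable fun i : Fin n → ℕ => ‖∏ j, f j (i j)‖) ∧
        ∑' i : Fin n → ℕ, ∏ j, f j (i j) = ∏ j, ∑' i, f j i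
  | 0, f, _ => by
    constructor
    · exact (hasSum_unique _).summable
    · rw [tsum_eq_single (default : Fin 0 → ℕ) fun b hb => (hb (Subsingleton.elim _ _)).elim]
      simp
  | n + 1, f, hf => by
    obtain ⟨h1, h2⟩ := hasSum_prod_pi fun j : Fin n => hf j.succ
    obtain ⟨E, hE⟩ : ∃ E : ℕ × (Fin n → ℕ) ≃ (Fin (n + 1) → ℕ),
        ∀ i, E i = Fin.cons (α := fun _ => ℕ) i.1 i.2 := ⟨Fin.consEquiv fun _ => ℕ, fun _ => rfl⟩
    have e : ∀ i : ℕ × (Fin n → ℕ), ∏ j, f j (E i j) =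
        f 0 i.1 * ∏ j : Fin n, f j.succ (i.2 j) := fun i => by
      rw [Fin.prod_univ_succ, hE]
      simp
    constructor
    · rw [← E.summable_iff]
      simp only [Function.comp_def, e]
      exact Summable.mul_norm (f := fun i : ℕ => f 0 i)
        (g := fun i : Fin n → ℕ => ∏ j : Fin n, f j.succ (i j)) (hf 0) h1
    · rw [← E.tsum_eq]
      simp only [e]
      rw [Fin.prod_univ_succ, ← h2, tsum_mul_tsum_of_summable_norm (f := fun i : ℕ => f 0 i)
        (g := fun i : Fin n → ℕ => ∏ j : Fin n, f j.succ (i j)) (hf 0) h1]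

/-! ### The Born rule in phase space -/

/-- The density `w ↦ M(w | 0)` of the measurement noise. -/
def noiseDensity {n : ℕ} (V : Fin n → Matrix (Fin 2) (Fin 2) ℝ) (w : PhaseSpace n) : ℝ :=
  ∏ j, gaussMode (V j) (mode w j)

theorem gaussKernel_eq {n : ℕ} {V : Fin n → Matrix (Fin 2) (Fin 2) ℝ} (hd : ∀ j, (V j).det = 1)
    (k u : PhaseSpace n) : gaussKernel V k u = noiseDensity V (k - u) := by
  simp [gaussKernel, noiseDensity, gaussMode, hd]

theorem gaussMode_neg (V : Matrix (Fin 2) (Fin 2) ℝ) (w : Fin 2 → ℝ) :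
    gaussMode V (-w) = gaussMode V w := by
  simp only [gaussMode, Matrix.mulVec_neg, neg_dotProduct, dotProduct_neg, neg_neg]

theorem ae_mode {n : ℕ} {p : (Fin 2 → ℝ) → Prop} (h : ∀ᵐ z, p z) (j : Fin n) :
    ∀ᵐ b : PhaseSpace n, p (mode b j) := by
  have h1 := (Measure.quasiMeasurePreserving_eval
    (fun _ : Fin n => (volume : Measure (Fin 2 → ℝ))) j).ae h
  exact (measurePreserving_modesEquiv n).symm.quasiMeasurePreserving.ae h1

theorem integrable_wignerProd {n : ℕ} {ρ : Fin n → ModeState}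
    (hW : ∀ j, Integrable (ρ j).wigner) : Integrable (wignerProd ρ) :=
  integrable_prod_modes hW

theorem integral_prod_charKernel_mul_exp {n : ℕ} (k : PhaseSpace n)
    {V : Fin n → Matrix (Fin 2) (Fin 2) ℝ} (h0 : ∀ j, 0 < V j 0 0)
    (hs : ∀ j, V j 1 0 = V j 0 1) (hd : ∀ j, (V j).det = 1) (z : PhaseSpace n) :
    ∫ b, (∏ j, charKernel (mode k j) (V j) (mode b j)) *
      Complex.exp (Complex.I * (symplForm z b : ℝ)) =
      (2 * Real.pi) ^ (2 * n) * (noiseDensity V (k - z) : ℝ) := by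
  have e : ∀ b : PhaseSpace n, (∏ j, charKernel (mode k j) (V j) (mode b j)) *
      Complex.exp (Complex.I * (symplForm z b : ℝ)) =
      ∏ j, (charKernel (mode k j) (V j) (mode b j) * Complex.exp (Complex.I *
        (mode z j 0 * mode b j 1 - mode z j 1 * mode b j 0 : ℝ))) := fun b => by
    rw [Finset.prod_mul_distrib, ← Complex.exp_sum, ← Finset.mul_sum, symplForm]
    push_cast
    rfl
  simp_rw [e]
  rw [integral_prod_modes fun j b => charKernel (mode k j) (V j) b * Complex.exp (Complex.I *
        (mode z j 0 * b 1 - mode z j 1 * b 0 : ℝ))]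
  simp_rw [integral_charKernel_mul_exp _ (h0 _) (hs _) (hd _)]
  rw [Finset.prod_mul_distrib, Finset.prod_const, Finset.card_univ, Fintype.card_fin, ← pow_mul,
    noiseDensity, Complex.ofReal_prod]
  congr 2
  ext j
  rw [← gaussMode_neg, neg_sub]
  rfl

theorem symplForm_add_left {n : ℕ} (u v w : PhaseSpace n) :
    symplForm (u + v) w = symplForm u w + symplForm v w := by
  simp only [symplForm, ← Finset.sum_add_distrib, PiLp.add_apply]
  exact Finset.sum_congr rfl fun j _ => by ring

theorem continuous_symplForm {n : ℕ} :
    Continuous fun z : PhaseSpace n × PhaseSpace n => symplForm z.1 z.2 := by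
  unfold symplForm
  fun_prop

/-- Each pure term becomes an integral of characteristic functions, the ensemble sum is carried out
inside, and the product of the modes' χ is replaced by the symplectic Fourier transform of W. Fubini
then leaves the transform of the Gaussian χ, evaluated at T u + x. -/
theorem bornDensity_eq {n : ℕ} {ρ : Fin n → ModeState} (hW : ∀ j, Integrable (ρ j).wigner)
    {T : Matrix (Fin n × Fin 2) (Fin n × Fin 2) ℝ} (hT : IsSymplectic T) {x : PhaseSpace n}
    {U : WaveFn n ≃ₗᵢ[ℂ] WaveFn n} (hU : Implements T x U)
    {V : Fin n → Matrix (Fin 2) (Fin 2) ℝ} (h0 : ∀ j, 0 < V j 0 0)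
    (hs : ∀ j, V j 1 0 = V j 0 1) (hd : ∀ j, (V j).det = 1) (k : PhaseSpace n) :
    bornDensity ρ U V k = ∫ u, wignerProd ρ u * noiseDensity V (k - (act T u + x)) := by
  have hp := Real.pi_pos
  set K : PhaseSpace n → ℂ := fun b => ∏ j, charKernel (mode k j) (V j) (mode b j) with hK
  have hKi : Integrable K := integrable_prod_modes fun j =>
    integrable_charKernel _ (h0 j) (hs j) (hd j)
  -- The Gaussian factor after the volume-preserving substitution b ↦ T b, together with the phase
  -- of the displacement x.
  set G : PhaseSpace n → ℂ := fun b =>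
    K (act T b) * Complex.exp (Complex.I * (symplForm x (act T b) : ℝ)) with hG
  have hcs : ∀ z : PhaseSpace n, Continuous fun b => symplForm z b := fun z =>
    continuous_symplForm.comp (by fun_prop : Continuous fun b : PhaseSpace n => (z, b))
  have hphase : ∀ (z : PhaseSpace n) {f : PhaseSpace n → ℂ}, Integrable f →
      Integrable fun b => f b * Complex.exp (Complex.I * (symplForm z b : ℝ)) := fun z f hf => by
    refine hf.mul_bdd (c := 1) (Continuous.aestronglyMeasurable ?_) (ae_of_all _ fun b => ?_)
    · have := hcs z
      fun_prop
    · rw [mul_comm, Complex.norm_exp_ofReal_mul_I]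
  have hGi : Integrable G := (hT.measurePreserving.integrable_comp_emb hT.measurableEmbedding).2
    (hphase x hKi)
  -- the contribution of one pure state
  have hpure : ∀ i : Fin n → ℕ, ((2 * Real.pi) ^ n : ℂ) *
      ((‖∫ y : Fin n → ℝ, (starRingEnd ℂ) (∏ j, gaussWave (mode k j) (V j) (y j)) *
        U (tensorVec fun j => (ρ j).vec (i j)) y‖ ^ 2 : ℝ) : ℂ) =
      ∫ b, G b * ∏ j, charFnMode ((ρ j).vec (i j)) (mode b j) := fun i => by
    rw [← integral_prod_charKernel_mul_charFn k h0 hs hd,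
      ← hT.measurePreserving.integral_comp hT.measurableEmbedding]
    refine integral_congr_ae (ae_of_all _ fun b => ?_)
    simp only [hG, hK]
    rw [charFn_of_implements hU, charFn_tensorVec]
    ring
  have hχ : ∀ (i : Fin n → ℕ) (b : PhaseSpace n),
      ‖∏ j, charFnMode ((ρ j).vec (i j)) (mode b j)‖ ≤ 1 := fun i b => by
    rw [norm_prod]
    refine Finset.prod_le_one (fun j _ => norm_nonneg _) fun j _ => ?_
    refine (charFnMode_bound _ _).trans ?_
    rw [integral_norm_sq_Lp, (ρ j).norm_vec, one_pow]
  have hχm : ∀ i : Fin n → ℕ, AEStronglyMeasurable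
      (fun b : PhaseSpace n => ∏ j, charFnMode ((ρ j).vec (i j)) (mode b j)) volume := fun i => by
    simp_rw [← charFn_tensorVec]
    exact (stronglyMeasurable_charFn (Lp.stronglyMeasurable _)).aestronglyMeasurable
  have hFi : ∀ i : Fin n → ℕ, Integrable fun b => ((∏ j, (ρ j).weight (i j) : ℝ) : ℂ) *
      (G b * ∏ j, charFnMode ((ρ j).vec (i j)) (mode b j)) := fun i =>
    (hGi.mul_bdd (hχm i) (ae_of_all _ (hχ i))).const_mul _
  have hw : Summable fun i : Fin n → ℕ => ‖∏ j, (ρ j).weight (i j)‖ :=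
    (hasSum_prod_pi (f := fun j => (ρ j).weight) fun j => (ρ j).hasSum_weight.summable.norm).1
  have hFs : Summable fun i : Fin n → ℕ => ∫ b, ‖((∏ j, (ρ j).weight (i j) : ℝ) : ℂ) *
      (G b * ∏ j, charFnMode ((ρ j).vec (i j)) (mode b j))‖ := by
    refine Summable.of_nonneg_of_le (fun i => integral_nonneg fun b => norm_nonneg _) (fun i => ?_)
      (hw.mul_right (∫ b, ‖G b‖))
    rw [← integral_const_mul]
    refine integral_mono (hFi i).norm (hGi.norm.const_mul _) fun b => ?_
    simp only [norm_mul, Complex.norm_real]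
    exact mul_le_mul_of_nonneg_left (mul_le_of_le_one_right (norm_nonneg _) (hχ i b))
      (norm_nonneg _)
  have hsum := (hasSum_integral_of_summable_integral_norm hFi hFs).tsum_eq
  -- the sum of the characteristic functions
  have hprod : ∀ b : PhaseSpace n, ∑' i : Fin n → ℕ, ((∏ j, (ρ j).weight (i j) : ℝ) : ℂ) *
      (G b * ∏ j, charFnMode ((ρ j).vec (i j)) (mode b j)) =
      G b * ∏ j, (ρ j).charFn (mode b j) := fun b => by
    have h := (hasSum_prod_pi (f := fun j i => (((ρ j).weight i : ℝ) : ℂ) *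
      charFnMode ((ρ j).vec i) (mode b j)) fun j => by
        refine Summable.of_nonneg_of_le (fun i => norm_nonneg _) (fun i => ?_)
          (ρ j).hasSum_weight.summable
        rw [norm_mul, Complex.norm_real, Real.norm_of_nonneg ((ρ j).weight_nonneg i)]
        refine mul_le_of_le_one_right ((ρ j).weight_nonneg i) ((charFnMode_bound _ _).trans ?_)
        rw [integral_norm_sq_Lp, (ρ j).norm_vec, one_pow]).2
    simp only [ModeState.charFn]
    rw [← h, ← tsum_mul_left]
    congr 1
    ext i
    rw [Finset.prod_mul_distrib]
    push_cast
    ring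
  have hWc : Integrable fun u => (wignerProd ρ u : ℂ) := (integrable_wignerProd hW).ofReal
  have hchar : ∀ᵐ b : PhaseSpace n, ∏ j, (ρ j).charFn (mode b j) =
      ∫ u, (wignerProd ρ u : ℂ) * Complex.exp (Complex.I * (symplForm u b : ℝ)) := by
    filter_upwards [ae_all_iff.2 fun j => ae_mode ((ρ j).ae_charFn_eq (hW j)) j] with b hb
    simp_rw [hb]
    rw [← integral_prod_modes fun j z => ((ρ j).wigner z : ℂ) * Complex.exp (Complex.I *
      (z 0 * mode b j 1 - z 1 * mode b j 0 : ℝ))]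
    refine integral_congr_ae (ae_of_all _ fun u => ?_)
    simp only
    rw [Finset.prod_mul_distrib, ← Complex.exp_sum, ← Finset.mul_sum, symplForm, wignerProd]
    push_cast
    rfl
  have hfub : ∫ b, G b * ∏ j, (ρ j).charFn (mode b j) =
      ∫ u, (wignerProd ρ u : ℂ) * ((2 * Real.pi) ^ (2 * n) *
        (noiseDensity V (k - (act T u + x)) : ℝ)) := by
    calc ∫ b, G b * ∏ j, (ρ j).charFn (mode b j)
        = ∫ b, ∫ u, G b * ((wignerProd ρ u : ℂ) *
            Complex.exp (Complex.I * (symplForm u b : ℝ))) := by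
          refine integral_congr_ae ?_
          filter_upwards [hchar] with b hb
          rw [hb, integral_const_mul]
      _ = ∫ u, ∫ b, G b * ((wignerProd ρ u : ℂ) *
            Complex.exp (Complex.I * (symplForm u b : ℝ))) := by
          refine integral_integral_swap ?_
          have := (hGi.mul_prod hWc).mul_bdd (c := 1) (g := fun z : PhaseSpace n × PhaseSpace n =>
            Complex.exp (Complex.I * (symplForm z.2 z.1 : ℝ))) (Continuous.aestronglyMeasurable (by
              have := (continuous_symplForm (n := n)).comp continuous_swap
              simp only [Function.comp_def, Prod.fst_swap, Prod.snd_swap] at this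
              fun_prop)) (ae_of_all _ fun z => by rw [mul_comm, Complex.norm_exp_ofReal_mul_I])
          refine this.congr (ae_of_all _ fun z => ?_)
          simp only [Function.uncurry]
          ring
      _ = _ := by
          refine integral_congr_ae (ae_of_all _ fun u => ?_)
          simp only
          -- The substitution b ↦ T b is undone here: σ(u, b) = σ(T u, T b) merges the two phases
          -- into that of the point T u + x.
          rw [← integral_prod_charKernel_mul_exp k h0 hs hd,
            ← hT.measurePreserving.integral_comp hT.measurableEmbedding
              (fun b => (∏ j, charKernel (mode k j) (V j) (mode b j)) *
                Complex.exp (Complex.I * (symplForm (act T u + x) b : ℝ))), ← integral_const_mul]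
          refine integral_congr_ae (ae_of_all _ fun b => ?_)
          simp only [hG, hK]
          rw [symplForm_add_left, hT u b]
          push_cast
          rw [mul_add, Complex.exp_add]
          ring
  have key : (bornDensity ρ U V k : ℂ) =
      ((∫ u, wignerProd ρ u * noiseDensity V (k - (act T u + x)) : ℝ) : ℂ) := by
    have hpn : ((2 * Real.pi) ^ n : ℂ) ≠ 0 := by
      have : (Real.pi : ℂ) ≠ 0 := by exact_mod_cast hp.ne'
      exact pow_ne_zero _ (mul_ne_zero two_ne_zero this)
    rw [bornDensity, Complex.ofReal_mul, Complex.ofReal_tsum]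
    have e : ∀ i : Fin n → ℕ, (((∏ j, (ρ j).weight (i j)) *
        ‖∫ y : Fin n → ℝ, (starRingEnd ℂ) (∏ j, gaussWave (mode k j) (V j) (y j)) *
          U (tensorVec fun j => (ρ j).vec (i j)) y‖ ^ 2 : ℝ) : ℂ) =
        ((2 * Real.pi) ^ n : ℂ)⁻¹ * ∫ b, ((∏ j, (ρ j).weight (i j) : ℝ) : ℂ) *
          (G b * ∏ j, charFnMode ((ρ j).vec (i j)) (mode b j)) := fun i => by
      rw [integral_const_mul, ← hpure i, Complex.ofReal_mul]
      field_simp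
    simp_rw [e]
    rw [tsum_mul_left, hsum]
    simp_rw [hprod]
    rw [hfub, ← integral_complex_ofReal]
    push_cast
    rw [← integral_const_mul, ← integral_const_mul]
    refine integral_congr_ae (ae_of_all _ fun u => ?_)
    simp only
    field_simp
    ring
  exact_mod_cast key

/-! ### Moments of the Gaussian noise -/

section Quadratic

variable {v w c : ℝ}

theorem exp_quadratic_eq (hv : 0 < v) (h : w * v - c ^ 2 = 1) (a b : ℝ) :
    Real.exp (-(w * a ^ 2 - 2 * c * a * b + v * b ^ 2)) =
      Real.exp (-v⁻¹ * a ^ 2) * Real.exp (-v * (b - c / v * a) ^ 2) := by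
  rw [← Real.exp_add]
  congr 1
  have : w = (1 + c ^ 2) / v := by rw [eq_div_iff hv.ne']; linarith
  rw [this]
  field_simp
  ring

/-- The second variable enters through a shifted Gaussian whose integral is independent of the
first. -/
theorem integral_mul_exp_quadratic (hv : 0 < v) (h : w * v - c ^ 2 = 1) {g : ℝ → ℝ}
    (hg : Measurable g) (hi : Integrable fun a => g a * Real.exp (-v⁻¹ * a ^ 2)) :
    Integrable (fun z : ℝ × ℝ =>
      g z.1 * Real.exp (-(w * z.1 ^ 2 - 2 * c * z.1 * z.2 + v * z.2 ^ 2))) ∧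
    ∫ z : ℝ × ℝ, g z.1 * Real.exp (-(w * z.1 ^ 2 - 2 * c * z.1 * z.2 + v * z.2 ^ 2)) =
      (∫ a, g a * Real.exp (-v⁻¹ * a ^ 2)) * Real.sqrt (Real.pi / v) := by
  have hb := integrable_exp_neg_mul_sq hv
  have hshift : ∀ a : ℝ, ∫ b : ℝ, Real.exp (-v * (b - c / v * a) ^ 2) = Real.sqrt (Real.pi / v) :=
    fun a => by
      rw [integral_sub_right_eq_self (fun b => Real.exp (-v * b ^ 2)), integral_gaussian]
  have hint : Integrable (fun z : ℝ × ℝ =>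
      g z.1 * Real.exp (-(w * z.1 ^ 2 - 2 * c * z.1 * z.2 + v * z.2 ^ 2))) := by
    have hm : Measurable fun z : ℝ × ℝ =>
        g z.1 * Real.exp (-(w * z.1 ^ 2 - 2 * c * z.1 * z.2 + v * z.2 ^ 2)) :=
      (hg.comp measurable_fst).mul (Continuous.measurable (by fun_prop))
    rw [Measure.volume_eq_prod, integrable_prod_iff hm.aestronglyMeasurable]
    simp only [exp_quadratic_eq hv h, ← mul_assoc]
    refine ⟨ae_of_all _ fun a => (hb.comp_sub_right (c / v * a)).const_mul _, ?_⟩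
    simp only [norm_mul _ (Real.exp (-v * _)), Real.norm_of_nonneg (Real.exp_nonneg _)]
    simp_rw [integral_const_mul, hshift]
    exact hi.norm.mul_const _
  refine ⟨hint, ?_⟩
  rw [Measure.volume_eq_prod, integral_prod _ hint]
  simp only [exp_quadratic_eq hv h, ← mul_assoc]
  simp_rw [integral_const_mul, hshift]
  rw [integral_mul_const]

/-- The inequality t ≤ eᵗ - 1 at t = a²/(2v) bounds the integrand by a difference of two Gaussians.
The result is twice the exact second moment, which is affordable. -/
theorem sq_mul_exp_le (hv : 0 < v) :
    Integrable (fun a : ℝ => a ^ 2 * Real.exp (-v⁻¹ * a ^ 2)) ∧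
      ∫ a : ℝ, a ^ 2 * Real.exp (-v⁻¹ * a ^ 2) ≤ v * Real.sqrt (Real.pi * v) := by
  have hp := Real.pi_pos
  have h1 := integrable_exp_neg_mul_sq (b := v⁻¹) (by positivity)
  have h2 := integrable_exp_neg_mul_sq (b := (2 * v)⁻¹) (by positivity)
  have hle : ∀ a : ℝ, a ^ 2 * Real.exp (-v⁻¹ * a ^ 2) ≤
      2 * v * (Real.exp (-(2 * v)⁻¹ * a ^ 2) - Real.exp (-v⁻¹ * a ^ 2)) := fun a => by
    have e : Real.exp (-(2 * v)⁻¹ * a ^ 2) =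
        Real.exp (-v⁻¹ * a ^ 2) * Real.exp ((2 * v)⁻¹ * a ^ 2) := by
      rw [← Real.exp_add]
      congr 1
      field_simp
      ring
    have h3 := Real.add_one_le_exp ((2 * v)⁻¹ * a ^ 2)
    have h4 : a ^ 2 = 2 * v * ((2 * v)⁻¹ * a ^ 2) := by field_simp
    rw [e]
    have := Real.exp_pos (-v⁻¹ * a ^ 2)
    calc a ^ 2 * Real.exp (-v⁻¹ * a ^ 2)
        = 2 * v * (Real.exp (-v⁻¹ * a ^ 2) * ((2 * v)⁻¹ * a ^ 2)) := by
          rw [h4]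
          field_simp
      _ ≤ 2 * v * (Real.exp (-v⁻¹ * a ^ 2) * (Real.exp ((2 * v)⁻¹ * a ^ 2) - 1)) := by
          gcongr
          linarith
      _ = _ := by ring
  have hi : Integrable (fun a : ℝ => a ^ 2 * Real.exp (-v⁻¹ * a ^ 2)) := by
    refine ((h2.sub h1).const_mul (2 * v)).mono'
      (Continuous.aestronglyMeasurable (by fun_prop)) (ae_of_all _ fun a => ?_)
    rw [Real.norm_of_nonneg (by positivity)]
    exact hle a
  refine ⟨hi, (integral_mono hi ((h2.sub h1).const_mul (2 * v)) hle).trans ?_⟩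
  simp only [Pi.sub_apply]
  rw [integral_const_mul, integral_sub h2 h1, integral_gaussian, integral_gaussian, div_inv_eq_mul,
    div_inv_eq_mul]
  have e : Real.sqrt (Real.pi * (2 * v)) = Real.sqrt 2 * Real.sqrt (Real.pi * v) := by
    rw [← Real.sqrt_mul (by norm_num)]
    congr 1
    ring
  have h5 : Real.sqrt 2 ≤ 3 / 2 := by
    rw [Real.sqrt_le_left (by norm_num)]
    norm_num
  rw [e]
  have : 0 ≤ v * Real.sqrt (Real.pi * v) := by positivity
  nlinarith

theorem integral_exp_quadratic (hv : 0 < v) (h : w * v - c ^ 2 = 1) :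
    Integrable (fun z : ℝ × ℝ => Real.exp (-(w * z.1 ^ 2 - 2 * c * z.1 * z.2 + v * z.2 ^ 2))) ∧
    ∫ z : ℝ × ℝ, Real.exp (-(w * z.1 ^ 2 - 2 * c * z.1 * z.2 + v * z.2 ^ 2)) = Real.pi := by
  have hp := Real.pi_pos
  have := integral_mul_exp_quadratic hv h (g := fun _ => 1) measurable_const
    (by simpa using integrable_exp_neg_mul_sq (b := v⁻¹) (by positivity))
  simp only [one_mul] at this
  refine ⟨this.1, ?_⟩
  rw [this.2, integral_gaussian, div_inv_eq_mul, ← Real.sqrt_mul (by positivity)]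
  rw [show Real.pi * v * (Real.pi / v) = Real.pi ^ 2 by field_simp, Real.sqrt_sq hp.le]

theorem sq_fst_mul_exp_quadratic (hv : 0 < v) (h : w * v - c ^ 2 = 1) :
    Integrable (fun z : ℝ × ℝ =>
      z.1 ^ 2 * Real.exp (-(w * z.1 ^ 2 - 2 * c * z.1 * z.2 + v * z.2 ^ 2))) ∧
    ∫ z : ℝ × ℝ, z.1 ^ 2 * Real.exp (-(w * z.1 ^ 2 - 2 * c * z.1 * z.2 + v * z.2 ^ 2)) ≤
      Real.pi * v := by
  have hp := Real.pi_pos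
  have := integral_mul_exp_quadratic hv h (g := fun a => a ^ 2) (by fun_prop) (sq_mul_exp_le hv).1
  refine ⟨this.1, ?_⟩
  rw [this.2]
  calc _ ≤ v * Real.sqrt (Real.pi * v) * Real.sqrt (Real.pi / v) := by
        gcongr
        exact (sq_mul_exp_le hv).2
    _ = Real.pi * v := by
        rw [mul_assoc, ← Real.sqrt_mul (by positivity),
          show Real.pi * v * (Real.pi / v) = Real.pi ^ 2 by field_simp, Real.sqrt_sq hp.le, mul_comm]

end Quadratic

section GaussMode

variable {V : Matrix (Fin 2) (Fin 2) ℝ}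

theorem integral_finTwo_eq (f : (Fin 2 → ℝ) → ℝ) : ∫ z, f z = ∫ z : ℝ × ℝ, f ![z.1, z.2] :=
  ((volume_preserving_finTwoArrow ℝ).symm.integral_comp' f).symm

theorem gaussMode_nonneg (w : Fin 2 → ℝ) : 0 ≤ gaussMode V w := by
  have := Real.pi_pos
  unfold gaussMode
  positivity

theorem gaussMode_eq (hs : V 1 0 = V 0 1) (hd : V.det = 1) (a b : ℝ) :
    gaussMode V ![a, b] =
      Real.pi⁻¹ * Real.exp (-(V 1 1 * a ^ 2 - 2 * V 0 1 * a * b + V 0 0 * b ^ 2)) := by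
  rw [gaussMode, dotProduct_inv_mulVec hs hd]
  rfl

theorem det_two (hs : V 1 0 = V 0 1) (hd : V.det = 1) : V 1 1 * V 0 0 - V 0 1 ^ 2 = 1 := by
  rw [Matrix.det_fin_two, hs] at hd
  linarith

theorem integrable_gaussMode (h0 : 0 < V 0 0) (hs : V 1 0 = V 0 1) (hd : V.det = 1) :
    Integrable (gaussMode V) := by
  rw [integrable_finTwo_iff]
  simp only [gaussMode_eq hs hd]
  exact (integral_exp_quadratic h0 (det_two hs hd)).1.const_mul _

theorem integral_gaussMode (h0 : 0 < V 0 0) (hs : V 1 0 = V 0 1) (hd : V.det = 1) :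
    ∫ z, gaussMode V z = 1 := by
  rw [integral_finTwo_eq]
  simp only [gaussMode_eq hs hd]
  rw [integral_const_mul, (integral_exp_quadratic h0 (det_two hs hd)).2,
    inv_mul_cancel₀ Real.pi_pos.ne']

/-- The density has covariance V/2, so the bound has a factor 2 to spare. The momentum case is the
position case with the coordinates exchanged. -/
theorem sq_mul_gaussMode (h0 : 0 < V 0 0) (h1 : 0 < V 1 1) (hs : V 1 0 = V 0 1) (hd : V.det = 1)
    (a : Fin 2) : Integrable (fun z => z a ^ 2 * gaussMode V z) ∧
      ∫ z, z a ^ 2 * gaussMode V z ≤ V a a := by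
  have hp := Real.pi_pos
  have hdd := det_two hs hd
  have e0 : ∀ z : ℝ × ℝ, z.1 ^ 2 * gaussMode V ![z.1, z.2] = Real.pi⁻¹ * (z.1 ^ 2 *
      Real.exp (-(V 1 1 * z.1 ^ 2 - 2 * V 0 1 * z.1 * z.2 + V 0 0 * z.2 ^ 2))) := fun z => by
    rw [gaussMode_eq hs hd]
    ring
  have e1 : ∀ z : ℝ × ℝ, z.2 ^ 2 * gaussMode V ![z.1, z.2] = Real.pi⁻¹ * (z.swap.1 ^ 2 *
      Real.exp (-(V 0 0 * z.swap.1 ^ 2 - 2 * V 0 1 * z.swap.1 * z.swap.2 +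
        V 1 1 * z.swap.2 ^ 2))) := fun z => by
    rw [gaussMode_eq hs hd]
    simp only [Prod.fst_swap, Prod.snd_swap]
    ring_nf
  have k0 := sq_fst_mul_exp_quadratic h0 hdd
  have k1 := sq_fst_mul_exp_quadratic h1 (c := V 0 1) (w := V 0 0) (by linarith)
  rw [integrable_finTwo_iff, integral_finTwo_eq]
  fin_cases a
  · simp only [Fin.zero_eta, Matrix.cons_val_zero, e0]
    refine ⟨k0.1.const_mul _, ?_⟩
    rw [integral_const_mul]
    calc _ ≤ Real.pi⁻¹ * (Real.pi * V 0 0) := by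
          gcongr
          exact k0.2
      _ = V 0 0 := by field_simp
  · simp only [Fin.mk_one, Matrix.cons_val_one, Matrix.cons_val_zero, e1]
    refine ⟨k1.1.swap.const_mul _, ?_⟩
    rw [integral_const_mul, Measure.volume_eq_prod, integral_prod_swap (fun z : ℝ × ℝ => z.1 ^ 2 *
      Real.exp (-(V 0 0 * z.1 ^ 2 - 2 * V 0 1 * z.1 * z.2 + V 1 1 * z.2 ^ 2)))]
    calc _ ≤ Real.pi⁻¹ * (Real.pi * V 1 1) := by
          gcongr
          exact k1.2
      _ = V 1 1 := by field_simp

end GaussMode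

/-! ### Tails of product densities -/

/-- Chebyshev's inequality with a union bound: outside S some coordinate is at least r from its
centre, so r² is at most the sum of all squared deviations. -/
theorem integral_outside_le {n : ℕ} {f : Fin n → (Fin 2 → ℝ) → ℝ} (hf0 : ∀ j z, 0 ≤ f j z)
    (hfi : ∀ j, Integrable (f j)) (hf1 : ∀ j, ∫ z, f j z = 1) (c : PhaseSpace n)
    {s : Fin n → Fin 2 → ℝ}
    (hm : ∀ j a, Integrable fun z => (z a - c (j, a)) ^ 2 * f j z)
    (hs : ∀ j a, ∫ z, (z a - c (j, a)) ^ 2 * f j z ≤ s j a) {r : ℝ} (hr : 0 < r)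
    {S : Set (PhaseSpace n)} (hS : MeasurableSet S) (hSr : ∀ u, (∀ i, |u i - c i| < r) → u ∈ S) :
    1 - ∫ u in S, ∏ j, f j (mode u j) ≤ (∑ j, ∑ a, s j a) / r ^ 2 := by
  have hF : Integrable fun u : PhaseSpace n => ∏ j, f j (mode u j) := integrable_prod_modes hfi
  have hF1 : ∫ u : PhaseSpace n, ∏ j, f j (mode u j) = 1 := by
    rw [integral_prod_modes]
    simp [hf1]
  have hF0 : ∀ u : PhaseSpace n, 0 ≤ ∏ j, f j (mode u j) := fun u =>
    Finset.prod_nonneg fun j _ => hf0 j _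
  -- the second moment of one coordinate
  have hupd : ∀ (j : Fin n) (a : Fin 2) (u : PhaseSpace n),
      (u (j, a) - c (j, a)) ^ 2 * ∏ i, f i (mode u i) =
        ∏ i, (if i = j then (fun z => (z a - c (j, a)) ^ 2 * f j z) else f i) (mode u i) :=
    fun j a u => by
      rw [← Finset.mul_prod_erase _ _ (Finset.mem_univ j),
        ← Finset.mul_prod_erase _ (fun i => (if i = j then _ else f i) (mode u i))
          (Finset.mem_univ j), if_pos rfl, ← mul_assoc]
      congr 1
      refine Finset.prod_congr rfl fun i hi => ?_
      rw [if_neg (Finset.ne_of_mem_erase hi)]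
  have hmi : ∀ j a, Integrable fun u : PhaseSpace n =>
      (u (j, a) - c (j, a)) ^ 2 * ∏ i, f i (mode u i) := fun j a => by
    simp_rw [hupd]
    refine integrable_prod_modes fun i => ?_
    split_ifs with h
    · exact hm j a
    · exact hfi i
  have hms : ∀ j a, ∫ u : PhaseSpace n, (u (j, a) - c (j, a)) ^ 2 * ∏ i, f i (mode u i) ≤ s j a :=
    fun j a => by
      simp_rw [hupd]
      rw [integral_prod_modes fun i => if i = j then (fun z => (z a - c (j, a)) ^ 2 * f j z) else f i,
        ← Finset.mul_prod_erase _ _ (Finset.mem_univ j), if_pos rfl, Finset.prod_eq_one, mul_one]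
      · exact hs j a
      · intro i hi
        rw [if_neg (Finset.ne_of_mem_erase hi)]
        exact hf1 i
  have hsum : Integrable fun u : PhaseSpace n =>
      ∑ j, ∑ a, (u (j, a) - c (j, a)) ^ 2 * ∏ i, f i (mode u i) :=
    integrable_finsetSum _ fun j _ => integrable_finsetSum _ fun a _ => hmi j a
  rw [← hF1, ← setIntegral_compl₀ hS.nullMeasurableSet hF, le_div_iff₀ (by positivity), mul_comm,
    ← integral_const_mul]
  calc ∫ u in Sᶜ, r ^ 2 * ∏ j, f j (mode u j)
      ≤ ∫ u in Sᶜ, ∑ j, ∑ a, (u (j, a) - c (j, a)) ^ 2 * ∏ i, f i (mode u i) := by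
        refine setIntegral_mono_on (hF.const_mul _).integrableOn hsum.integrableOn hS.compl ?_
        intro u hu
        have hex : ∃ i, r ≤ |u i - c i| := by
          by_contra! h
          exact hu (hSr u h)
        obtain ⟨⟨j, a⟩, hja⟩ := hex
        have h1 : r ^ 2 * ∏ j, f j (mode u j) ≤
            (u (j, a) - c (j, a)) ^ 2 * ∏ i, f i (mode u i) := by
          refine mul_le_mul_of_nonneg_right ?_ (hF0 u)
          rw [← sq_abs (u (j, a) - c (j, a))]
          gcongr
        have h2 : ∀ j a, 0 ≤ (u (j, a) - c (j, a)) ^ 2 * ∏ i, f i (mode u i) := fun j a =>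
          mul_nonneg (sq_nonneg _) (hF0 u)
        refine h1.trans ((Finset.single_le_sum (f := fun a =>
          (u (j, a) - c (j, a)) ^ 2 * ∏ i, f i (mode u i)) (fun a _ => h2 j a)
            (Finset.mem_univ a)).trans ?_)
        exact Finset.single_le_sum (f := fun j => ∑ a,
          (u (j, a) - c (j, a)) ^ 2 * ∏ i, f i (mode u i))
            (fun j _ => Finset.sum_nonneg fun a _ => h2 j a) (Finset.mem_univ j)
    _ ≤ ∫ u : PhaseSpace n, ∑ j, ∑ a, (u (j, a) - c (j, a)) ^ 2 * ∏ i, f i (mode u i) :=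
        setIntegral_le_integral hsum (ae_of_all _ fun u => Finset.sum_nonneg fun j _ =>
          Finset.sum_nonneg fun a _ => mul_nonneg (sq_nonneg _) (hF0 u))
    _ ≤ ∑ j, ∑ a, s j a := by
        rw [integral_finsetSum _ fun j _ => integrable_finsetSum _ fun a _ => hmi j a]
        refine Finset.sum_le_sum fun j _ => ?_
        rw [integral_finsetSum _ fun a _ => hmi j a]
        exact Finset.sum_le_sum fun a _ => hms j a

/-! ### Half-open cubes -/

/-- The half-open cube with centre `k` and side `s`. -/
def halfOpenCube {n : ℕ} (k : PhaseSpace n) (s : ℝ) : Set (PhaseSpace n) :=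
  {v | ∀ i, k i - s / 2 ≤ v i ∧ v i < k i + s / 2}

theorem halfOpenCube_eq {n : ℕ} (k : PhaseSpace n) (s : ℝ) : halfOpenCube k s =
    WithLp.ofLp ⁻¹' (Set.univ.pi fun i => Set.Ico (k i - s / 2) (k i + s / 2)) := by
  ext v
  simp [halfOpenCube, Set.mem_pi]

theorem cube_eq {n : ℕ} (k : PhaseSpace n) (s : ℝ) : cube k s =
    WithLp.ofLp ⁻¹' (Set.Icc (fun i => k i - s / 2) (fun i => k i + s / 2)) := by
  ext v
  simp only [cube, Set.mem_ofPred_eq, Set.mem_preimage, Set.mem_Icc, Pi.le_def, abs_le]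
  rw [← forall_and]
  refine forall_congr' fun i => ?_
  constructor <;> rintro ⟨h1, h2⟩ <;> constructor <;> linarith

theorem measurableSet_halfOpenCube {n : ℕ} (k : PhaseSpace n) (s : ℝ) :
    MeasurableSet (halfOpenCube k s) := by
  rw [halfOpenCube_eq]
  exact (PiLp.volume_preserving_ofLp _).measurable
    (MeasurableSet.univ_pi fun i => measurableSet_Ico)

/-- Closed cubes of a tiling share faces. Half-open ones are disjoint and have the same integrals.
-/
theorem cube_ae_eq {n : ℕ} (k : PhaseSpace n) (s : ℝ) :
    (cube k s : Set (PhaseSpace n)) =ᵐ[volume] halfOpenCube k s := by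
  rw [cube_eq, halfOpenCube_eq]
  exact (PiLp.volume_preserving_ofLp (Fin n × Fin 2)).quasiMeasurePreserving.preimage_ae_eq
    Measure.univ_pi_Ico_ae_eq_Icc.symm

theorem volume_real_halfOpenCube {n : ℕ} (k : PhaseSpace n) {s : ℝ} (hs : 0 ≤ s) :
    (volume : Measure (PhaseSpace n)).real (halfOpenCube k s) = s ^ (2 * n) := by
  rw [Measure.real, halfOpenCube_eq,
    (PiLp.volume_preserving_ofLp (Fin n × Fin 2)).measure_preimage
      (MeasurableSet.univ_pi fun i => measurableSet_Ico).nullMeasurableSet, volume_pi_pi]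
  simp only [Real.volume_Ico, add_sub_sub_cancel, add_halves]
  rw [Finset.prod_const, Finset.card_univ, Fintype.card_prod, Fintype.card_fin, Fintype.card_fin,
    ENNReal.toReal_pow, ENNReal.toReal_ofReal hs, mul_comm]

theorem volume_halfOpenCube_ne_top {n : ℕ} (k : PhaseSpace n) (s : ℝ) :
    (volume : Measure (PhaseSpace n)) (halfOpenCube k s) ≠ ⊤ := by
  rw [halfOpenCube_eq, (PiLp.volume_preserving_ofLp (Fin n × Fin 2)).measure_preimage
      (MeasurableSet.univ_pi fun i => measurableSet_Ico).nullMeasurableSet, volume_pi_pi]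
  exact ENNReal.prod_ne_top fun i _ => by simp

theorem norm_le_of_forall_abs_le {n : ℕ} {v : PhaseSpace n} {a : ℝ} (ha : 0 ≤ a)
    (h : ∀ i, |v i| ≤ a) : ‖v‖ ≤ Real.sqrt (2 * n) * a := by
  rw [EuclideanSpace.norm_eq, ← Real.sqrt_sq ha, ← Real.sqrt_mul (by positivity)]
  refine Real.sqrt_le_sqrt ?_
  calc ∑ i, ‖v i‖ ^ 2 ≤ ∑ _i : Fin n × Fin 2, a ^ 2 := by
        refine Finset.sum_le_sum fun i _ => ?_
        have := h i
        rw [Real.norm_eq_abs]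
        gcongr
    _ = 2 * n * a ^ 2 := by
        rw [Finset.sum_const, Finset.card_univ, Fintype.card_prod, Fintype.card_fin,
          Fintype.card_fin, nsmul_eq_mul]
        push_cast
        ring

/-! ### Grids -/

/-- The grid point of phase space with the given labels. -/
def gridPt {n : ℕ} (c : PhaseSpace n) (δ : ℝ) (z : Fin n → ℤ × ℤ) : PhaseSpace n :=
  ofModes fun j => gridPoint (mode c j) δ (z j)

/-- The labels of the cell of side `δ` that contains `v`, in the tiling with a cell centred at `c`. -/
def cellLabel {n : ℕ} (δ : ℝ) (c v : PhaseSpace n) (j : Fin n) : ℤ × ℤ :=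
  (⌊(v (j, 0) - c (j, 0)) / δ + 1 / 2⌋, ⌊(v (j, 1) - c (j, 1)) / δ + 1 / 2⌋)

@[simp] theorem gridPt_zero {n : ℕ} (c : PhaseSpace n) (δ : ℝ) (z : Fin n → ℤ × ℤ) (j : Fin n) :
    gridPt c δ z (j, 0) = c (j, 0) + δ * (z j).1 := rfl

@[simp] theorem gridPt_one {n : ℕ} (c : PhaseSpace n) (δ : ℝ) (z : Fin n → ℤ × ℤ) (j : Fin n) :
    gridPt c δ z (j, 1) = c (j, 1) + δ * (z j).2 := rfl

theorem floor_div_add_half_eq_iff {δ : ℝ} (hδ : 0 < δ) (y : ℝ) (m : ℤ) :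
    ⌊y / δ + 1 / 2⌋ = m ↔ δ * m - δ / 2 ≤ y ∧ y < δ * m + δ / 2 := by
  rw [Int.floor_eq_iff]
  have e : y = δ * (y / δ) := by field_simp
  constructor
  · rintro ⟨h1, h2⟩
    rw [e]
    constructor <;> nlinarith
  · rintro ⟨h1, h2⟩
    rw [e] at h1 h2
    constructor <;> nlinarith

theorem cellLabel_eq_iff {n : ℕ} {δ : ℝ} (hδ : 0 < δ) (c v : PhaseSpace n) (z : Fin n → ℤ × ℤ) :
    cellLabel δ c v = z ↔ v ∈ halfOpenCube (gridPt c δ z) δ := by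
  simp only [funext_iff, cellLabel, Prod.ext_iff, floor_div_add_half_eq_iff hδ, halfOpenCube,
    Set.mem_ofPred_eq, Prod.forall, Fin.forall_fin_two, gridPt_zero, gridPt_one]
  refine forall_congr' fun j => ?_
  constructor
  · rintro ⟨⟨h1, h2⟩, h3, h4⟩
    refine ⟨⟨?_, ?_⟩, ?_, ?_⟩ <;> linarith
  · rintro ⟨⟨h1, h2⟩, h3, h4⟩
    refine ⟨⟨?_, ?_⟩, ?_, ?_⟩ <;> linarith

theorem abs_sub_gridPt_le {n : ℕ} {δ : ℝ} {c v : PhaseSpace n} {z : Fin n → ℤ × ℤ}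
    (h : v ∈ halfOpenCube (gridPt c δ z) δ) (i : Fin n × Fin 2) :
    |(v - gridPt c δ z) i| ≤ δ / 2 := by
  rw [PiLp.sub_apply, abs_le]
  have := h i
  constructor <;> linarith

/-- The labels of the grid in the centred square. -/
def labelBox (n : ℕ) (h : ℤ) : Finset (Fin n → ℤ × ℤ) :=
  Fintype.piFinset fun _ => Finset.Icc (-h) h ×ˢ Finset.Icc (-h) h

theorem mem_labelBox {n : ℕ} {h : ℤ} {z : Fin n → ℤ × ℤ} :
    z ∈ labelBox n h ↔ ∀ j, |(z j).1| ≤ h ∧ |(z j).2| ≤ h := by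
  simp [labelBox, Fintype.mem_piFinset, abs_le]

theorem card_labelBox (n h : ℕ) : ((labelBox n h).card : ℝ) = (2 * h + 1) ^ (2 * n) := by
  rw [labelBox, Fintype.card_piFinset, Finset.prod_const, Finset.card_product, Int.card_Icc,
    Finset.card_univ, Fintype.card_fin]
  have : ((h : ℤ) + 1 - -(h : ℤ)).toNat = 2 * h + 1 := by omega
  rw [this]
  push_cast
  rw [← sq, ← pow_mul]

section Discretization

variable {n : ℕ} {F : PhaseSpace n → ℝ} {δ : ℝ} {c : PhaseSpace n} {R : Finset (Fin n → ℤ × ℤ)}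
  {b : (Fin n → ℤ × ℤ) → ℝ} {e : ℝ}

theorem pairwiseDisjoint_cells (hδ : 0 < δ) (c : PhaseSpace n) (s : Set (Fin n → ℤ × ℤ)) :
    s.PairwiseDisjoint fun z => halfOpenCube (gridPt c δ z) δ := by
  intro z _ z' _ hne
  refine Set.disjoint_left.2 fun v hv hv' => hne ?_
  rw [← (cellLabel_eq_iff hδ c v z).2 hv, (cellLabel_eq_iff hδ c v z').2 hv']

theorem setIntegral_cells (hδ : 0 < δ) (c : PhaseSpace n) (R : Finset (Fin n → ℤ × ℤ))
    (hF : Integrable F) : ∫ u in ⋃ z ∈ R, halfOpenCube (gridPt c δ z) δ, F u =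
      ∑ z ∈ R, ∫ u in halfOpenCube (gridPt c δ z) δ, F u :=
  integral_biUnion_finset R (fun _ _ => measurableSet_halfOpenCube _ _)
    (pairwiseDisjoint_cells hδ c _) fun _ _ => hF.integrableOn

theorem measurableSet_cells (δ : ℝ) (c : PhaseSpace n) (R : Finset (Fin n → ℤ × ℤ)) :
    MeasurableSet (⋃ z ∈ R, halfOpenCube (gridPt c δ z) δ) :=
  R.measurableSet_biUnion fun _ _ => measurableSet_halfOpenCube _ _

/-- Comparison of the masses of the cells with a discretized density. -/
theorem sum_abs_mass_sub_le (hδ : 0 < δ) (hF : Integrable F)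
    (hb : ∀ z ∈ R, ∀ u ∈ halfOpenCube (gridPt c δ z) δ,
      |δ ^ (2 * n) * F u - b z| ≤ δ ^ (2 * n) * e) :
    ∑ z ∈ R, |(∫ u in halfOpenCube (gridPt c δ z) δ, F u) - b z| ≤ R.card * δ ^ (2 * n) * e := by
  have h : ∀ z ∈ R, |(∫ u in halfOpenCube (gridPt c δ z) δ, F u) - b z| ≤ δ ^ (2 * n) * e := by
    intro z hz
    have hδn : 0 < δ ^ (2 * n) := by positivity
    have hc : ∫ _u in halfOpenCube (gridPt c δ z) δ, b z / δ ^ (2 * n) = b z := by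
      rw [setIntegral_const, volume_real_halfOpenCube _ hδ.le, smul_eq_mul]
      field_simp
    rw [← hc, ← integral_sub hF.integrableOn (integrableOn_const (volume_halfOpenCube_ne_top _ _)),
      ← Real.norm_eq_abs]
    refine (norm_setIntegral_le_of_norm_le_const
      (volume_halfOpenCube_ne_top _ _).lt_top (C := e) fun u hu => ?_).trans ?_
    · have := hb z hz u hu
      rw [Real.norm_eq_abs]
      have e1 : δ ^ (2 * n) * F u - b z = δ ^ (2 * n) * (F u - b z / δ ^ (2 * n)) := by field_simp
      rw [e1, abs_mul, abs_of_pos hδn] at this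
      exact le_of_mul_le_mul_left this hδn
    · rw [volume_real_halfOpenCube _ hδ.le, mul_comm]
  refine (Finset.sum_le_sum h).trans_eq ?_
  rw [Finset.sum_const, nsmul_eq_mul]
  ring

/-- Comparison of the expectation of `ψ` in a density with the expectation of its discretization
`w` in the normalized discretized density. -/
theorem abs_integral_sub_sum_div_le (hδ : 0 < δ) (hF : Integrable F) (hF0 : ∀ u, 0 ≤ F u)
    (hF1 : ∫ u, F u = 1) (hb0 : ∀ z ∈ R, 0 ≤ b z) (hbpos : 0 < ∑ z ∈ R, b z)
    (hb : ∀ z ∈ R, ∀ u ∈ halfOpenCube (gridPt c δ z) δ,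
      |δ ^ (2 * n) * F u - b z| ≤ δ ^ (2 * n) * e)
    {ψ : PhaseSpace n → ℝ} (hψm : AEStronglyMeasurable ψ volume) (hψ : ∀ u, |ψ u| ≤ 1)
    {w : (Fin n → ℤ × ℤ) → ℝ} (hw : ∀ z ∈ R, |w z| ≤ 1) {D : ℝ} (hD0 : 0 ≤ D)
    (hD : ∀ z ∈ R, ∀ u ∈ halfOpenCube (gridPt c δ z) δ, |ψ u - w z| ≤ D) :
    |(∫ u, F u * ψ u) - (∑ z ∈ R, b z * w z) / ∑ z ∈ R, b z| ≤
      D + (1 - ∫ u in ⋃ z ∈ R, halfOpenCube (gridPt c δ z) δ, F u) +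
        R.card * δ ^ (2 * n) * e + |1 - ∑ z ∈ R, b z| := by
  set S := ⋃ z ∈ R, halfOpenCube (gridPt c δ z) δ with hSdef
  set Bt := ∑ z ∈ R, b z with hBt
  have hS : MeasurableSet S := measurableSet_cells δ c R
  have hFψ : Integrable fun u => F u * ψ u := hF.mul_bdd hψm (ae_of_all _ hψ)
  have hmS : ∫ u in S, F u = ∑ z ∈ R, ∫ u in halfOpenCube (gridPt c δ z) δ, F u :=
    setIntegral_cells hδ c R hF
  have hsplit : ∫ u, F u * ψ u = (∑ z ∈ R, ∫ u in halfOpenCube (gridPt c δ z) δ, F u * ψ u) +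
      ∫ u in Sᶜ, F u * ψ u := by
    rw [← setIntegral_cells hδ c R hFψ, integral_add_compl hS hFψ]
  have hout : |∫ u in Sᶜ, F u * ψ u| ≤ 1 - ∫ u in S, F u := by
    rw [← hF1, ← setIntegral_compl₀ hS.nullMeasurableSet hF, ← Real.norm_eq_abs]
    refine norm_integral_le_of_norm_le hF.integrableOn (ae_of_all _ fun u => ?_)
    rw [norm_mul, Real.norm_of_nonneg (hF0 u)]
    exact mul_le_of_le_one_right (hF0 u) (hψ u)
  have hcell : ∀ z ∈ R, |(∫ u in halfOpenCube (gridPt c δ z) δ, F u * ψ u) -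
      (∫ u in halfOpenCube (gridPt c δ z) δ, F u) * w z| ≤
      D * ∫ u in halfOpenCube (gridPt c δ z) δ, F u := by
    intro z hz
    rw [← integral_mul_const, ← integral_sub hFψ.integrableOn (hF.mul_const _).integrableOn,
      ← integral_const_mul, ← Real.norm_eq_abs]
    refine norm_integral_le_of_norm_le (hF.const_mul D).integrableOn ?_
    refine (ae_restrict_iff' (measurableSet_halfOpenCube _ _)).2 (ae_of_all _ fun u hu => ?_)
    rw [← mul_sub, norm_mul, Real.norm_of_nonneg (hF0 u), mul_comm]
    exact mul_le_mul_of_nonneg_right (hD z hz u hu) (hF0 u)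
  have hmass := sum_abs_mass_sub_le hδ hF hb
  have hm1 : ∑ z ∈ R, ∫ u in halfOpenCube (gridPt c δ z) δ, F u ≤ 1 := by
    rw [← hmS, ← hF1]
    exact setIntegral_le_integral hF (ae_of_all _ hF0)
  -- Normalizing costs no more than the defect of the total weight, since |∑ b w| ≤ ∑ b.
  have hnorm : |(∑ z ∈ R, b z * w z) - (∑ z ∈ R, b z * w z) / Bt| ≤ |1 - Bt| := by
    have h1 : |∑ z ∈ R, b z * w z| ≤ Bt := by
      refine (Finset.abs_sum_le_sum_abs _ _).trans (Finset.sum_le_sum fun z hz => ?_)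
      rw [abs_mul, abs_of_nonneg (hb0 z hz)]
      exact mul_le_of_le_one_right (hb0 z hz) (hw z hz)
    have e1 : (∑ z ∈ R, b z * w z) - (∑ z ∈ R, b z * w z) / Bt =
        (∑ z ∈ R, b z * w z) / Bt * (Bt - 1) := by field_simp
    rw [e1, abs_mul, abs_sub_comm Bt 1, abs_div, abs_of_pos hbpos]
    exact mul_le_of_le_one_left (abs_nonneg _) ((div_le_one hbpos).2 h1)
  -- The four sources of error: variation of ψ within a cell, mass off the grid, cell masses against
  -- the weights b, and normalization.
  have e0 : (∫ u, F u * ψ u) - (∑ z ∈ R, b z * w z) / Bt =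
      (∑ z ∈ R, ((∫ u in halfOpenCube (gridPt c δ z) δ, F u * ψ u) -
        (∫ u in halfOpenCube (gridPt c δ z) δ, F u) * w z)) + (∫ u in Sᶜ, F u * ψ u) +
      (∑ z ∈ R, ((∫ u in halfOpenCube (gridPt c δ z) δ, F u) - b z) * w z) +
      ((∑ z ∈ R, b z * w z) - (∑ z ∈ R, b z * w z) / Bt) := by
    rw [hsplit, Finset.sum_sub_distrib]
    simp only [sub_mul]
    rw [Finset.sum_sub_distrib]
    ring
  have h1 : |∑ z ∈ R, ((∫ u in halfOpenCube (gridPt c δ z) δ, F u * ψ u) -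
        (∫ u in halfOpenCube (gridPt c δ z) δ, F u) * w z)| ≤ D := by
    refine (Finset.abs_sum_le_sum_abs _ _).trans ((Finset.sum_le_sum hcell).trans ?_)
    rw [← Finset.mul_sum]
    exact mul_le_of_le_one_right hD0 hm1
  have h2 : |∑ z ∈ R, ((∫ u in halfOpenCube (gridPt c δ z) δ, F u) - b z) * w z| ≤
      R.card * δ ^ (2 * n) * e := by
    refine (Finset.abs_sum_le_sum_abs _ _).trans (le_trans (Finset.sum_le_sum fun z hz => ?_) hmass)
    rw [abs_mul]
    exact mul_le_of_le_one_right (abs_nonneg _) (hw z hz)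
  rw [e0]
  refine (abs_add_le _ _).trans (add_le_add ((abs_add_le _ _).trans (add_le_add
    ((abs_add_le _ _).trans (add_le_add h1 hout)) h2)) hnorm)

theorem abs_mass_sub_sum_le (hδ : 0 < δ) (hF : Integrable F)
    (hb : ∀ z ∈ R, ∀ u ∈ halfOpenCube (gridPt c δ z) δ,
      |δ ^ (2 * n) * F u - b z| ≤ δ ^ (2 * n) * e) :
    |(∫ u in ⋃ z ∈ R, halfOpenCube (gridPt c δ z) δ, F u) - ∑ z ∈ R, b z| ≤
      R.card * δ ^ (2 * n) * e := by
  rw [setIntegral_cells hδ c R hF, ← Finset.sum_sub_distrib]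
  exact (Finset.abs_sum_le_sum_abs _ _).trans (sum_abs_mass_sub_le hδ hF hb)

end Discretization

/-- The grid cells with labels up to `h` cover the cube of side `(2 h + 1) δ`. -/
theorem mem_cells_of_abs_lt {n : ℕ} {δ : ℝ} (hδ : 0 < δ) {c u : PhaseSpace n} {h : ℕ}
    (hu : ∀ i, |u i - c i| < (2 * h + 1) * δ / 2) :
    u ∈ ⋃ z ∈ labelBox n h, halfOpenCube (gridPt c δ z) δ := by
  have key : ∀ y : ℝ, |y| < (2 * h + 1) * δ / 2 → |⌊y / δ + 1 / 2⌋| ≤ (h : ℤ) := by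
    intro y hy
    rw [abs_lt] at hy
    have e : y = δ * (y / δ) := by field_simp
    rw [e] at hy
    have h1 : y / δ < h + 1 / 2 := by nlinarith
    have h2 : -(h + 1 / 2 : ℝ) < y / δ := by nlinarith
    rw [abs_le]
    constructor
    · rw [Int.le_floor]
      push_cast
      linarith
    · rw [← Int.lt_add_one_iff, Int.floor_lt]
      push_cast
      linarith
  simp only [Set.mem_iUnion, exists_prop]
  refine ⟨cellLabel δ c u, mem_labelBox.2 fun j => ⟨key _ (hu _), key _ (hu _)⟩, ?_⟩
  exact (cellLabel_eq_iff hδ c u _).1 rfl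

/-! ### The law of the result of a computation -/

/-- The law of the result of a computation. -/
def Comp.res {α : Type} (m : Comp α) : PMF α := m.law.map Prod.fst

theorem res_pure {α : Type} (a : α) : (pure a : Comp α).res = PMF.pure a :=
  PMF.pure_map _ _

theorem res_bind {α β : Type} (m : Comp α) (f : α → Comp β) :
    (m >>= f).res = m.res.bind fun a => (f a).res := by
  change (m.law.bind fun r => (f r.1).law.map fun s => (s.1, r.2 + s.2)).map Prod.fst = _
  rw [PMF.map_bind, Comp.res, PMF.bind_map]
  congr 1
  ext1 r
  rw [PMF.map_comp]
  rfl

theorem res_tick (c : ℕ) : (tick c).res = PMF.pure () := PMF.pure_map _ _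

theorem res_draw {α : Type} (p : PMF α) : (draw p).res = p := by
  rw [draw, Comp.res, PMF.map_comp]
  exact PMF.map_id p

theorem res_tabulate {ι : Type} [DecidableEq ι] {f : ι → Comp ℝ} {g : ι → ℝ}
    (h : ∀ i, (f i).res = PMF.pure (g i)) : ∀ is : List ι,
    (tabulate is f).res = PMF.pure fun x => if x ∈ is then g x else 0
  | [] => by
    rw [tabulate]
    exact (res_pure _).trans (by simp; rfl)
  | i :: is => by
    rw [tabulate, res_bind, h, PMF.pure_bind, res_bind, res_tabulate h is, PMF.pure_bind, res_pure]
    congr 1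
    ext x
    by_cases hx : x = i
    · subst hx
      simp
    · simp [hx]

theorem res_total {ι : Type} (t : ι → ℝ) : ∀ is : List ι,
    (total is t).res = PMF.pure (is.map t).sum
  | [] => by
    rw [total, res_pure]
    simp
  | i :: is => by
    rw [total, res_bind, res_total t is, PMF.pure_bind, res_bind, res_tick, PMF.pure_bind, res_pure]
    simp

theorem res_drawFromTable (pts : List (ℤ × ℤ)) (f : ℤ × ℤ → ℝ) (δ : ℝ) :
    (drawFromTable pts f δ).res = tableLaw pts fun x => if x ∈ pts then
      (if x ∈ pts then f x * δ ^ 2 else 0) /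
        (pts.map fun x => if x ∈ pts then f x * δ ^ 2 else 0).sum else 0 := by
  rw [drawFromTable, res_bind, res_tabulate (g := fun z => f z * δ ^ 2), PMF.pure_bind, res_bind,
    res_total, PMF.pure_bind, res_bind, res_tabulate (g := fun z =>
      (if z ∈ pts then f z * δ ^ 2 else 0) /
        (pts.map fun x => if x ∈ pts then f x * δ ^ 2 else 0).sum), PMF.pure_bind, res_bind,
    res_tick, PMF.pure_bind, res_draw]
  · congr!
  · intro i
    rw [res_bind, res_tick, PMF.pure_bind, res_pure]
    congr!
  · intro i
    rw [res_bind, res_tick, PMF.pure_bind, res_pure]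

theorem toReal_tableLaw {ι : Type} [Inhabited ι] [DecidableEq ι] (G : Finset ι) {t : ι → ℝ}
    (h0 : ∀ x ∈ G, 0 ≤ t x) (hpos : 0 < ∑ x ∈ G, t x) (x : ι) :
    (tableLaw G.toList t x).toReal = if x ∈ G then t x / ∑ x ∈ G, t x else 0 := by
  classical
  have hsum : (∑' i, if i ∈ G.toList then ENNReal.ofReal (t i) else 0) =
      ENNReal.ofReal (∑ x ∈ G, t x) := by
    rw [ENNReal.ofReal_sum_of_nonneg h0, tsum_eq_sum (s := G)]
    · refine Finset.sum_congr rfl fun i hi => ?_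
      rw [if_pos (Finset.mem_toList.2 hi)]
    · intro i hi
      rw [if_neg (by simpa using hi)]
  have hcond : (∑' i, if i ∈ G.toList then ENNReal.ofReal (t i) else 0) ≠ 0 ∧
      (∑' i, if i ∈ G.toList then ENNReal.ofReal (t i) else 0) ≠ ⊤ := by
    rw [hsum]
    exact ⟨(ENNReal.ofReal_pos.2 hpos).ne', ENNReal.ofReal_ne_top⟩
  have hdef : tableLaw G.toList t = PMF.normalize
      (fun i => if i ∈ G.toList then ENNReal.ofReal (t i) else 0) hcond.1 hcond.2 := by
    unfold tableLaw
    rw [dif_pos (by convert hcond)]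
    congr!
  rw [hdef, PMF.normalize_apply, hsum, ENNReal.toReal_mul, ENNReal.toReal_inv,
    ENNReal.toReal_ofReal hpos.le]
  simp only [Finset.mem_toList]
  split_ifs with hx
  · rw [ENNReal.toReal_ofReal (h0 x hx), div_eq_mul_inv]
  · simp

/-- The factor δ² cancels in the normalization of the table, after which the weights already sum to
one. -/
theorem toReal_res_drawFromTable (G : Finset (ℤ × ℤ)) {f : ℤ × ℤ → ℝ} {δ : ℝ} (hδ : 0 < δ)
    (h0 : ∀ x ∈ G, 0 ≤ f x) (hpos : 0 < ∑ x ∈ G, f x) (x : ℤ × ℤ) :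
    ((drawFromTable G.toList f δ).res x).toReal = if x ∈ G then f x / ∑ x ∈ G, f x else 0 := by
  have hs : (G.toList.map fun x => if x ∈ G.toList then f x * δ ^ 2 else 0).sum =
      (∑ x ∈ G, f x) * δ ^ 2 := by
    rw [Finset.sum_map_toList, Finset.sum_mul]
    refine Finset.sum_congr rfl fun y hy => ?_
    rw [if_pos (Finset.mem_toList.2 hy)]
  have hS : 0 < (∑ x ∈ G, f x) * δ ^ 2 := by positivity
  rw [res_drawFromTable, hs]
  have e : ∀ y ∈ G, (if y ∈ G.toList then (if y ∈ G.toList then f y * δ ^ 2 else 0) /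
      ((∑ x ∈ G, f x) * δ ^ 2) else 0) = f y / ∑ x ∈ G, f x := fun y hy => by
    rw [if_pos (Finset.mem_toList.2 hy), if_pos (Finset.mem_toList.2 hy)]
    field_simp
  have e1 : ∑ y ∈ G, (if y ∈ G.toList then (if y ∈ G.toList then f y * δ ^ 2 else 0) /
      ((∑ x ∈ G, f x) * δ ^ 2) else 0) = 1 := by
    rw [Finset.sum_congr rfl e, ← Finset.sum_div, div_self hpos.ne']
  rw [toReal_tableLaw]
  · rw [e1, div_one]
    split_ifs with hx h1
    · field_simp
    · exact absurd (Finset.mem_toList.2 hx) h1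
    · rfl
  · intro y hy
    rw [e y hy]
    exact div_nonneg (h0 y hy) hpos.le
  · rw [e1]
    exact one_pos

/-! ### Product laws -/

/-- The product of the laws `p j`. -/
def productLaw {α : Type} : {n : ℕ} → (Fin n → PMF α) → PMF (Fin n → α)
  | 0, _ => PMF.pure fun j => j.elim0
  | _ + 1, p => (p 0).bind fun a =>
      (productLaw fun j => p j.succ).bind fun as => PMF.pure (Fin.cons (α := fun _ => α) a as)

theorem res_forModes {α : Type} : ∀ {n : ℕ} (f : Fin n → Comp α),
    (forModes f).res = productLaw fun j => (f j).res
  | 0, f => res_pure _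
  | n + 1, f => by
    rw [forModes, res_bind, productLaw]
    congr 1
    ext1 a
    rw [res_bind, res_forModes]
    congr 1
    ext1 as
    rw [res_pure]

theorem productLaw_map {α β : Type} : ∀ {n : ℕ} (p : Fin n → PMF α) (g : Fin n → α → β),
    (productLaw fun j => (p j).map (g j)) = (productLaw p).map fun z j => g j (z j)
  | 0, p, g => by
    rw [productLaw, productLaw, PMF.pure_map]
    congr 1
    ext j
    exact j.elim0
  | n + 1, p, g => by
    rw [productLaw, productLaw, PMF.bind_map, PMF.map_bind]
    congr 1
    ext1 a
    rw [Function.comp_apply, productLaw_map (fun j => p j.succ) (fun j => g j.succ), PMF.bind_map,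
      PMF.map_bind]
    congr 1
    ext1 as
    rw [Function.comp_apply, PMF.pure_map]
    congr 1
    ext j
    refine Fin.cases ?_ (fun j => ?_) j
    · rfl
    · rfl

theorem productLaw_apply {α : Type} : ∀ {n : ℕ} (p : Fin n → PMF α) (z : Fin n → α),
    productLaw p z = ∏ j, p j (z j)
  | 0, p, z => by
    rw [productLaw, PMF.pure_apply, if_pos (Subsingleton.elim _ _)]
    simp
  | n + 1, p, z => by
    rw [productLaw, PMF.bind_apply, tsum_eq_single (z 0), PMF.bind_apply,
      tsum_eq_single (fun j : Fin n => z j.succ), PMF.pure_apply, if_pos, mul_one,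
      productLaw_apply, Fin.prod_univ_succ]
    · ext j
      refine Fin.cases ?_ (fun j => ?_) j
      · rfl
      · rfl
    · intro as has
      rw [PMF.pure_apply, if_neg, mul_zero]
      intro hz
      exact has (by ext j; exact (congrFun hz j.succ).symm)
    · intro a ha
      rw [PMF.bind_apply]
      refine mul_eq_zero_of_right _ (ENNReal.tsum_eq_zero.2 fun as => ?_)
      rw [PMF.pure_apply, if_neg, mul_zero]
      rintro rfl
      exact ha rfl

/-! ### Signed combinations of probabilities -/

section Signed

variable {α β : Type}

theorem toReal_le_one (p : PMF α) (a : α) : (p a).toReal ≤ 1 :=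
  ENNReal.toReal_le_of_le_ofReal zero_le_one (by simpa using p.coe_le_one a)

theorem hasSum_toReal (p : PMF α) : HasSum (fun a => (p a).toReal) 1 := by
  have h := p.tsum_coe
  have h1 : Summable fun a => (p a).toReal := ENNReal.summable_toReal (by rw [h]; simp)
  rw [h1.hasSum_iff, ← ENNReal.tsum_toReal_eq fun a => p.apply_ne_top a, h, ENNReal.toReal_one]

theorem hasSum_toReal_bind (p : PMF α) (f : α → PMF β) (b : β) :
    HasSum (fun a => (p a).toReal * (f a b).toReal) ((p.bind f) b).toReal := by
  have h1 : Summable fun a => (p a).toReal * (f a b).toReal :=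
    Summable.of_nonneg_of_le (fun a => by positivity)
      (fun a => mul_le_of_le_one_right ENNReal.toReal_nonneg (toReal_le_one (f a) b))
      (hasSum_toReal p).summable
  rw [h1.hasSum_iff, PMF.bind_apply, ENNReal.tsum_toReal_eq]
  · simp_rw [ENNReal.toReal_mul]
  · exact fun a => ENNReal.mul_ne_top (p.apply_ne_top a) ((f a).apply_ne_top b)

/-- The combination `∑ s(b) q(b)` over a finite set of outcomes. -/
def signedSum (K : Finset β) (s : β → ℝ) (q : PMF β) : ℝ := ∑ b ∈ K, s b * (q b).toReal

theorem hasSum_signedSum_bind (K : Finset β) (s : β → ℝ) (p : PMF α) (f : α → PMF β) :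
    HasSum (fun a => (p a).toReal * signedSum K s (f a)) (signedSum K s (p.bind f)) := by
  have := hasSum_sum (s := K) fun b _ => (hasSum_toReal_bind p f b).mul_left (s b)
  refine this.congr_fun fun a => ?_
  rw [signedSum, Finset.mul_sum]
  exact Finset.sum_congr rfl fun b _ => by ring

/-- X is the p-average of the constant X, so a bound for each possible intermediate result survives
averaging. This handles an arbitrary randomized subroutine for the affine map. -/
theorem abs_sub_signedSum_bind_le (K : Finset β) (s : β → ℝ) (p : PMF α) (f : α → PMF β)
    {X D : ℝ} (h : ∀ a ∈ p.support, |X - signedSum K s (f a)| ≤ D) :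
    |X - signedSum K s (p.bind f)| ≤ D := by
  have h1 := ((hasSum_toReal p).mul_right X).sub (hasSum_signedSum_bind K s p f)
  have h2 := (hasSum_toReal p).mul_right D
  rw [one_mul] at h1 h2
  have hle : ∀ a, |(p a).toReal * X - (p a).toReal * signedSum K s (f a)| ≤ (p a).toReal * D := by
    intro a
    rw [← mul_sub, abs_mul, abs_of_nonneg ENNReal.toReal_nonneg]
    by_cases ha : a ∈ p.support
    · exact mul_le_mul_of_nonneg_left (h a ha) ENNReal.toReal_nonneg
    · rw [PMF.mem_support_iff, not_not] at ha
      simp [ha]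
  rw [abs_le]
  constructor
  · exact hasSum_le (fun a => (abs_le.1 (hle a)).1) h2.neg h1
  · exact hasSum_le (fun a => (abs_le.1 (hle a)).2) h1 h2

theorem abs_signedSum_le (K : Finset β) {s : β → ℝ} (hs : ∀ b, |s b| ≤ 1) (q : PMF β) :
    |signedSum K s q| ≤ 1 := by
  refine (Finset.abs_sum_le_sum_abs _ _).trans (le_trans (Finset.sum_le_sum fun b _ => ?_)
    (sum_le_hasSum K (fun b _ => ENNReal.toReal_nonneg) (hasSum_toReal q)))
  rw [abs_mul, abs_of_nonneg ENNReal.toReal_nonneg]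
  exact mul_le_of_le_one_left ENNReal.toReal_nonneg (hs b)

end Signed

/-! ### The law of the sampler -/

section Sampler

variable {n : ℕ} (I : SimInput n) (V : Fin n → Matrix (Fin 2) (Fin 2) ℝ)

/-- The range of the labels of the grid. -/
def SimInput.range : ℤ := ⌊Real.sqrt I.A / (2 * I.δ)⌋

/-- The labels of the grid of one mode. -/
def SimInput.labels : Finset (ℤ × ℤ) :=
  Finset.Icc (-I.range) I.range ×ˢ Finset.Icc (-I.range) I.range

/-- The table of the discretized Gaussian. -/
def gaussTable (δ : ℝ) (V : Matrix (Fin 2) (Fin 2) ℝ) (z : ℤ × ℤ) : ℝ :=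
  Real.exp (-((gridPoint 0 δ z) ⬝ᵥ (V⁻¹.mulVec (gridPoint 0 δ z))))

/-- The law of the labels in the first stage. -/
def inputLaw : PMF (Fin n → ℤ × ℤ) := productLaw fun j =>
  (drawFromTable (gridLabels I.A I.δ) (fun z => max 0 (I.oracle j z)) I.δ).res

/-- The law of the labels in the third stage. -/
def noiseLaw : PMF (Fin n → ℤ × ℤ) := productLaw fun j =>
  (drawFromTable (gridLabels I.A I.δ) (gaussTable I.δ (V j)) I.δ).res

/-- The centre of the output cell. -/
def outputCentre (y : PhaseSpace n) : PhaseSpace n :=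
  WithLp.toLp 2 fun i => rebin (I.origin i) I.Γ (y i)

theorem gridLabels_eq : gridLabels I.A I.δ = I.labels.toList := rfl

theorem res_simulate (aff : PhaseSpace n → Comp (PhaseSpace n)) :
    (simulate I V aff).res = (inputLaw I).bind fun z =>
      (aff (ofModes fun j => gridPoint (mode I.mean j) I.δ (z j))).res.bind fun v =>
        (noiseLaw I V).bind fun z' => PMF.pure (outputCentre I
          (ofModes fun j => gridPoint (mode v j) I.δ (z' j))) := by
  have h1 : ∀ j, (sampleMode I j).res = (drawFromTable (gridLabels I.A I.δ)
      (fun z => max 0 (I.oracle j z)) I.δ).res.map (gridPoint (mode I.mean j) I.δ) := fun j => by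
    rw [sampleMode, res_bind, ← PMF.bind_pure_comp]
    congr 1
    ext1 z
    rw [res_bind, res_tick, PMF.pure_bind, res_pure]
    rfl
  have h3 : ∀ v j, (measureMode I V v j).res = (drawFromTable (gridLabels I.A I.δ)
      (gaussTable I.δ (V j)) I.δ).res.map
        fun z a => rebin (I.origin (j, a)) I.Γ (gridPoint (mode v j) I.δ z a) := fun v j => by
    rw [measureMode, res_bind, ← PMF.bind_pure_comp]
    congr 1
    ext1 z
    rw [res_bind, res_tick, PMF.pure_bind, res_pure]
    rfl
  rw [simulate, res_bind, res_forModes]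
  simp_rw [h1]
  rw [productLaw_map, PMF.bind_map]
  congr 1
  ext1 z
  rw [Function.comp_apply, res_bind]
  congr 1
  ext1 v
  rw [res_bind, res_forModes]
  simp_rw [h3]
  rw [productLaw_map (fun j => (drawFromTable (gridLabels I.A I.δ) (gaussTable I.δ (V j)) I.δ).res)
    (fun j z a => rebin (I.origin (j, a)) I.Γ (gridPoint (mode v j) I.δ z a)), PMF.bind_map]
  congr 1
  ext1 z'
  rw [Function.comp_apply, res_pure]
  rfl

theorem toReal_inputLaw (hδ : 0 < I.δ)
    (hpos : 0 < ∏ j, ∑ z ∈ I.labels, max 0 (I.oracle j z)) (z : Fin n → ℤ × ℤ) :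
    (inputLaw I z).toReal = if ∀ j, z j ∈ I.labels then
      (∏ j, max 0 (I.oracle j (z j))) / ∏ j, ∑ z ∈ I.labels, max 0 (I.oracle j z) else 0 := by
  have h0 : ∀ j, 0 < ∑ z ∈ I.labels, max 0 (I.oracle j z) := fun j =>
    lt_of_le_of_ne (Finset.sum_nonneg fun z _ => le_max_left _ _) fun h =>
      hpos.ne' (Finset.prod_eq_zero (Finset.mem_univ j) h.symm)
  rw [inputLaw, productLaw_apply, ENNReal.toReal_prod]
  simp_rw [gridLabels_eq, toReal_res_drawFromTable I.labels hδ (fun z _ => le_max_left _ _) (h0 _)]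
  split_ifs with h
  · rw [← Finset.prod_div_distrib]
    exact Finset.prod_congr rfl fun j _ => if_pos (h j)
  · push Not at h
    obtain ⟨j, hj⟩ := h
    exact Finset.prod_eq_zero (Finset.mem_univ j) (if_neg hj)

theorem toReal_noiseLaw (hδ : 0 < I.δ) (hne : I.labels.Nonempty) (z : Fin n → ℤ × ℤ) :
    (noiseLaw I V z).toReal = if ∀ j, z j ∈ I.labels then
      (∏ j, gaussTable I.δ (V j) (z j)) / ∏ j, ∑ z ∈ I.labels, gaussTable I.δ (V j) z else 0 := by
  have h0 : ∀ j, 0 < ∑ z ∈ I.labels, gaussTable I.δ (V j) z := fun j =>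
    Finset.sum_pos (fun z _ => Real.exp_pos _) hne
  rw [noiseLaw, productLaw_apply, ENNReal.toReal_prod]
  have e : ∀ j, ((drawFromTable (gridLabels I.A I.δ) (gaussTable I.δ (V j)) I.δ).res (z j)).toReal =
      if z j ∈ I.labels then gaussTable I.δ (V j) (z j) / ∑ z ∈ I.labels, gaussTable I.δ (V j) z
      else 0 := fun j => by
    rw [gridLabels_eq]
    exact toReal_res_drawFromTable I.labels hδ (fun z _ => (Real.exp_pos _).le) (h0 j) _
  simp_rw [e]
  split_ifs with h
  · rw [← Finset.prod_div_distrib]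
    exact Finset.prod_congr rfl fun j _ => if_pos (h j)
  · push Not at h
    obtain ⟨j, hj⟩ := h
    exact Finset.prod_eq_zero (Finset.mem_univ j) (if_neg hj)

end Sampler

/-! ### Lipschitz bounds -/

theorem abs_sub_le_of_norm_gradient_le {F : Type*} [NormedAddCommGroup F] [InnerProductSpace ℝ F]
    [CompleteSpace F] {f : F → ℝ} {C : ℝ} (hf : Differentiable ℝ f) (h : ∀ u, ‖gradient f u‖ ≤ C)
    (u v : F) : |f u - f v| ≤ C * ‖u - v‖ := by
  refine Convex.norm_image_sub_le_of_norm_fderiv_le (𝕜 := ℝ) (fun x _ => hf x) (fun x _ => ?_)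
    convex_univ (Set.mem_univ v) (Set.mem_univ u)
  have := h x
  rwa [gradient, LinearIsometryEquiv.norm_map] at this

/-- The factors are exchanged one at a time. Bounding all of them by one keeps the oracle errors
additive over the modes. -/
theorem abs_prod_sub_prod_le {ι : Type*} (s : Finset ι) {a b : ι → ℝ}
    (ha : ∀ i ∈ s, |a i| ≤ 1) (hb : ∀ i ∈ s, |b i| ≤ 1) :
    |∏ i ∈ s, a i - ∏ i ∈ s, b i| ≤ ∑ i ∈ s, |a i - b i| := by
  classical
  induction s using Finset.induction_on with
  | empty => simp
  | insert i s hi ih =>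
    rw [Finset.prod_insert hi, Finset.prod_insert hi, Finset.sum_insert hi]
    have h1 := ih (fun j hj => ha j (Finset.mem_insert_of_mem hj))
      (fun j hj => hb j (Finset.mem_insert_of_mem hj))
    have h2 : |∏ i ∈ s, a i| ≤ 1 := by
      rw [Finset.abs_prod]
      exact Finset.prod_le_one (fun j _ => abs_nonneg _)
        fun j hj => ha j (Finset.mem_insert_of_mem hj)
    have h3 := hb i (Finset.mem_insert_self i s)
    calc |a i * ∏ i ∈ s, a i - b i * ∏ i ∈ s, b i|
        = |(a i - b i) * ∏ i ∈ s, a i + b i * (∏ i ∈ s, a i - ∏ i ∈ s, b i)| := by ring_nf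
      _ ≤ |a i - b i| * |∏ i ∈ s, a i| + |b i| * |∏ i ∈ s, a i - ∏ i ∈ s, b i| := by
        rw [← abs_mul, ← abs_mul]
        exact abs_add_le _ _
      _ ≤ _ := add_le_add (mul_le_of_le_one_right (abs_nonneg _) h2)
        ((mul_le_of_le_one_left (abs_nonneg _) h3).trans h1)

theorem gaussMode_apply {V : Matrix (Fin 2) (Fin 2) ℝ} (hs : V 1 0 = V 0 1) (hd : V.det = 1)
    (w : Fin 2 → ℝ) : gaussMode V w = Real.pi⁻¹ *
      Real.exp (-(V 1 1 * w 0 ^ 2 - 2 * V 0 1 * w 0 * w 1 + V 0 0 * w 1 ^ 2)) := by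
  rw [← gaussMode_eq hs hd]
  congr 1
  ext a
  fin_cases a <;> rfl

/-! ### Smoothness, mass and tails of the measurement noise -/

section Noise

variable {n : ℕ} {V : Fin n → Matrix (Fin 2) (Fin 2) ℝ}

theorem differentiable_noiseDensity (hs : ∀ j, V j 1 0 = V j 0 1) (hd : ∀ j, (V j).det = 1) :
    Differentiable ℝ (noiseDensity V) := by
  have : noiseDensity V = fun w => ∏ j, Real.pi⁻¹ * Real.exp (-(V j 1 1 * w (j, 0) ^ 2 -
      2 * V j 0 1 * w (j, 0) * w (j, 1) + V j 0 0 * w (j, 1) ^ 2)) := by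
    ext w
    exact Finset.prod_congr rfl fun j _ => gaussMode_apply (hs j) (hd j) _
  rw [this]
  fun_prop

theorem noiseDensity_nonneg (w : PhaseSpace n) : 0 ≤ noiseDensity V w :=
  Finset.prod_nonneg fun _ _ => gaussMode_nonneg _

theorem integrable_noiseDensity (h0 : ∀ j, 0 < V j 0 0) (hs : ∀ j, V j 1 0 = V j 0 1)
    (hd : ∀ j, (V j).det = 1) : Integrable (noiseDensity V) :=
  integrable_prod_modes fun j => integrable_gaussMode (h0 j) (hs j) (hd j)

theorem integral_noiseDensity (h0 : ∀ j, 0 < V j 0 0) (hs : ∀ j, V j 1 0 = V j 0 1)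
    (hd : ∀ j, (V j).det = 1) : ∫ w, noiseDensity V w = 1 := by
  have := integral_prod_modes fun j => gaussMode (V j)
  rw [Finset.prod_congr rfl fun j _ => integral_gaussMode (h0 j) (hs j) (hd j),
    Finset.prod_const_one] at this
  exact this

/-- The mass of the Gaussian noise outside a large cube. -/
theorem integral_noiseDensity_outside_le (h0 : ∀ j, 0 < V j 0 0) (h1 : ∀ j, 0 < V j 1 1)
    (hs : ∀ j, V j 1 0 = V j 0 1) (hd : ∀ j, (V j).det = 1) {r : ℝ} (hr : 0 < r)
    {S : Set (PhaseSpace n)} (hS : MeasurableSet S) (hSr : ∀ u, (∀ i, |u i| < r) → u ∈ S) :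
    1 - ∫ u in S, noiseDensity V u ≤ (∑ j, (V j 0 0 + V j 1 1)) / r ^ 2 := by
  have := integral_outside_le (f := fun j => gaussMode (V j)) (fun _ => gaussMode_nonneg)
    (fun j => integrable_gaussMode (h0 j) (hs j) (hd j))
    (fun j => integral_gaussMode (h0 j) (hs j) (hd j)) 0 (s := fun j a => V j a a)
    (fun j a => by simpa using (sq_mul_gaussMode (h0 j) (h1 j) (hs j) (hd j) a).1)
    (fun j a => by simpa using (sq_mul_gaussMode (h0 j) (h1 j) (hs j) (hd j) a).2) hr hS
    (by simpa using hSr)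
  simpa [Fin.sum_univ_two, noiseDensity] using this

end Noise

/-! ### Discretization of the laws of the sampler -/

section Pick

variable {α β : Type} (K : Finset β) (s : β → ℝ)

theorem signedSum_bind_eq_div {R : Finset α} {b : α → ℝ} {p : PMF α}
    [DecidablePred (· ∈ R)] (hp : ∀ z, (p z).toReal = if z ∈ R then b z / ∑ z ∈ R, b z else 0)
    (f : α → PMF β) :
    signedSum K s (p.bind f) = (∑ z ∈ R, b z * signedSum K s (f z)) / ∑ z ∈ R, b z := by
  have h1 := hasSum_signedSum_bind K s p f
  have h2 : HasSum (fun z => (p z).toReal * signedSum K s (f z))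
      (∑ z ∈ R, (p z).toReal * signedSum K s (f z)) :=
    hasSum_sum_of_ne_finset_zero fun z hz => by rw [hp, if_neg hz, zero_mul]
  rw [h1.unique h2, Finset.sum_div]
  refine Finset.sum_congr rfl fun z hz => ?_
  rw [hp, if_pos hz]
  ring

/-- The function that is `s` on `K` and vanishes elsewhere. -/
def pick (a : β) : ℝ := signedSum K s (PMF.pure a)

theorem abs_pick_le (hs : ∀ b, |s b| ≤ 1) (a : β) : |pick K s a| ≤ 1 := abs_signedSum_le K hs _

theorem pick_eq [DecidableEq β] (a : β) : pick K s a = ∑ b ∈ K, if a = b then s b else 0 := by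
  rw [pick, signedSum]
  refine Finset.sum_congr rfl fun b _ => ?_
  rw [PMF.pure_apply]
  by_cases h : a = b
  · simp [h]
  · simp [h, Ne.symm h]

theorem measurable_pick [MeasurableSpace β] [MeasurableSingletonClass β] :
    Measurable (pick K s) := by
  classical
  rw [show pick K s = _ from funext (pick_eq K s)]
  exact Finset.measurable_sum _ fun b _ =>
    Measurable.ite (measurableSet_singleton b) measurable_const measurable_const

end Pick

/-! ### Compatibility of the fine and the coarse tilings -/

section Rebin

theorem rebin_eq_iff {o Γ : ℝ} (hΓ : 0 < Γ) (y : ℝ) (m : ℤ) : rebin o Γ y = o + Γ * m ↔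
    o + Γ * m - Γ / 2 ≤ y ∧ y < o + Γ * m + Γ / 2 := by
  have h := floor_div_add_half_eq_iff hΓ (y - o) m
  rw [rebin]
  have e : o + Γ * (⌊(y - o) / Γ + 1 / 2⌋ : ℤ) = o + Γ * m ↔ ⌊(y - o) / Γ + 1 / 2⌋ = m := by
    rw [add_right_inj, mul_right_inj' hΓ.ne', Int.cast_inj]
  rw [e, h]
  constructor <;> rintro ⟨h1, h2⟩ <;> constructor <;> linarith

/-- The cells of the coarse tiling are unions of cells of the fine tiling. -/
theorem rebin_eq_of_floor_eq {o δ Γ : ℝ} (hδ : 0 < δ) {g : ℕ} (hΓ : Γ = (2 * g + 1) * δ)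
    {y y' : ℝ} (h : ⌊(y - o) / δ + 1 / 2⌋ = ⌊(y' - o) / δ + 1 / 2⌋) :
    rebin o Γ y = rebin o Γ y' := by
  -- Because Γ/δ = 2g + 1 is odd, (t + 1/2 + g)/(2g + 1) = t/(2g + 1) + 1/2 for t = (y - o)/δ. The
  -- coarse index is thus an integer quotient of the fine one.
  have key : ∀ y, ⌊(y - o) / Γ + 1 / 2⌋ = (⌊(y - o) / δ + 1 / 2⌋ + g) / ((2 * g + 1 : ℕ) : ℤ) := by
    intro y
    rw [← Int.floor_add_natCast, ← Int.floor_div_natCast]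
    congr 1
    rw [hΓ]
    push_cast
    field_simp
    ring
  rw [rebin, rebin, key, key, h]

theorem rebin_mem {o δ : ℝ} (hδ : 0 < δ) (y : ℝ) :
    rebin o δ y - δ / 2 ≤ y ∧ y < rebin o δ y + δ / 2 := by
  have := (rebin_eq_iff (o := o) hδ y ⌊(y - o) / δ + 1 / 2⌋).1 rfl
  rwa [rebin]

/-- The coarse cell is constant on the fine cells that are shifted by grid vectors. -/
theorem rebin_eq_of_mem {o δ Γ : ℝ} (hδ : 0 < δ) {g : ℕ} (hΓ : Γ = (2 * g + 1) * δ)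
    {y v : ℝ} {m : ℤ} (h1 : rebin o δ v + δ * m - δ / 2 ≤ y) (h2 : y < rebin o δ v + δ * m + δ / 2) :
    rebin o Γ y = rebin o Γ (v + δ * m) := by
  refine rebin_eq_of_floor_eq hδ hΓ ?_
  have h3 := rebin_mem (o := o) hδ v
  -- If v lies in the fine cell M, then y and v + δ m both lie in the fine cell M + m.
  set M := ⌊(v - o) / δ + 1 / 2⌋ with hM
  have e : rebin o δ v = o + δ * M := rfl
  rw [e] at h1 h2 h3
  have key : ∀ y, o + δ * M + δ * m - δ / 2 ≤ y → y < o + δ * M + δ * m + δ / 2 →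
      ⌊(y - o) / δ + 1 / 2⌋ = M + m := fun y h1 h2 => by
    rw [floor_div_add_half_eq_iff hδ]
    push_cast
    constructor <;> linarith
  rw [key y h1 h2, key (v + δ * m) (by linarith) (by linarith)]

end Rebin

/-! ### Errors of the two random stages -/

section Stages

variable {n : ℕ} {I : SimInput n} {V : Fin n → Matrix (Fin 2) (Fin 2) ℝ} {h g : ℕ}

theorem range_eq (hδ : 0 < I.δ) (hA : Real.sqrt I.A = (2 * h + 1) * I.δ) : I.range = h := by
  rw [SimInput.range, hA, Int.floor_eq_iff]
  have e : (2 * (h : ℝ) + 1) * I.δ / (2 * I.δ) = h + 1 / 2 := by field_simp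
  rw [e]
  push_cast
  constructor <;> linarith

theorem labels_eq (hδ : 0 < I.δ) (hA : Real.sqrt I.A = (2 * h + 1) * I.δ) :
    I.labels = Finset.Icc (-(h : ℤ)) h ×ˢ Finset.Icc (-(h : ℤ)) h := by
  rw [SimInput.labels, range_eq hδ hA]

theorem mem_labelBox_iff (hδ : 0 < I.δ) (hA : Real.sqrt I.A = (2 * h + 1) * I.δ)
    (z : Fin n → ℤ × ℤ) : z ∈ labelBox n h ↔ ∀ j, z j ∈ I.labels := by
  rw [labels_eq hδ hA, labelBox, Fintype.mem_piFinset]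

theorem card_labelBox_mul (hA0 : 0 < I.A) (hA : Real.sqrt I.A = (2 * h + 1) * I.δ) :
    ((labelBox n h).card : ℝ) * I.δ ^ (2 * n) = I.A ^ n := by
  rw [card_labelBox, ← mul_pow, ← hA, pow_mul, Real.sq_sqrt hA0.le]

/-- Normalized products of tables, rewritten with a common factor. -/
theorem product_table_eq (hδ : 0 < I.δ) (hA : Real.sqrt I.A = (2 * h + 1) * I.δ)
    {f : Fin n → ℤ × ℤ → ℝ} {C : ℝ} (hC : C ≠ 0) {b : (Fin n → ℤ × ℤ) → ℝ}
    (hb : ∀ z, b z = C * ∏ j, f j (z j)) {q : ℝ} {z : Fin n → ℤ × ℤ}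
    (hq : q = if ∀ j, z j ∈ I.labels then
      (∏ j, f j (z j)) / ∏ j, ∑ z ∈ I.labels, f j z else 0) :
    q = if z ∈ labelBox n h then b z / ∑ z ∈ labelBox n h, b z else 0 := by
  have e : ∏ j, ∑ z ∈ I.labels, f j z = ∑ z ∈ labelBox n h, ∏ j, f j (z j) := by
    rw [Finset.prod_univ_sum, labels_eq hδ hA, labelBox]
  rw [hq, e]
  simp_rw [mem_labelBox_iff hδ hA, hb, ← Finset.mul_sum, mul_div_mul_left _ _ hC]

/-- The discretized density of the noise. -/
def noiseWeight (I : SimInput n) (V : Fin n → Matrix (Fin 2) (Fin 2) ℝ) (z : Fin n → ℤ × ℤ) : ℝ :=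
  I.δ ^ (2 * n) * noiseDensity V (gridPt 0 I.δ z)

theorem noiseWeight_pos (hδ : 0 < I.δ) (z : Fin n → ℤ × ℤ) : 0 < noiseWeight I V z := by
  unfold noiseWeight
  refine mul_pos (by positivity) (Finset.prod_pos fun j _ => ?_)
  unfold gaussMode
  have := Real.pi_pos
  positivity

theorem toReal_noiseLaw_eq (hδ : 0 < I.δ) (hA : Real.sqrt I.A = (2 * h + 1) * I.δ)
    (z : Fin n → ℤ × ℤ) : (noiseLaw I V z).toReal = if z ∈ labelBox n h then
      noiseWeight I V z / ∑ z ∈ labelBox n h, noiseWeight I V z else 0 := by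
  have hne : I.labels.Nonempty := by
    rw [labels_eq hδ hA]
    exact ⟨(0, 0), by simp⟩
  -- The tables hold bare exponentials; this common factor makes them cell volume times density and
  -- cancels in the quotient.
  refine product_table_eq hδ hA (C := I.δ ^ (2 * n) * Real.pi⁻¹ ^ n) (by positivity) (fun z => ?_)
    (toReal_noiseLaw I V hδ hne z)
  rw [noiseWeight, noiseDensity, mul_assoc]
  congr 1
  rw [← Fin.prod_const, ← Finset.prod_mul_distrib]
  refine Finset.prod_congr rfl fun j _ => ?_
  rw [gaussMode, gaussTable, gridPt, mode_ofModes]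
  rfl

/-- The density is compared at u - v and at a grid vector. These arguments differ by the offset of u
within its cell, at most half a diagonal, and by c - v. The grid centre c stays free so that it can
be aligned with the output tiling. -/
theorem abs_noiseWeight_sub_le (hδ : 0 < I.δ) (hs : ∀ j, V j 1 0 = V j 0 1)
    (hd : ∀ j, (V j).det = 1) {L : ℝ} (hL : ∀ w, ‖gradient (noiseDensity V) w‖ ≤ L)
    (v c : PhaseSpace n) (z : Fin n → ℤ × ℤ) {u : PhaseSpace n}
    (hu : u ∈ halfOpenCube (gridPt c I.δ z) I.δ) :
    |I.δ ^ (2 * n) * noiseDensity V (u - v) - noiseWeight I V z| ≤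
      I.δ ^ (2 * n) * (L * (Real.sqrt (2 * n) * (I.δ / 2) + ‖c - v‖)) := by
  rw [noiseWeight, ← mul_sub, abs_mul, abs_of_nonneg (by positivity)]
  refine mul_le_mul_of_nonneg_left ?_ (by positivity)
  refine (abs_sub_le_of_norm_gradient_le (differentiable_noiseDensity hs hd) hL _ _).trans ?_
  have hL0 : 0 ≤ L := (norm_nonneg _).trans (hL 0)
  refine mul_le_mul_of_nonneg_left ?_ hL0
  have e : u - v - gridPt 0 I.δ z = (u - gridPt c I.δ z) + (c - v) := by
    ext ⟨j, a⟩
    fin_cases a <;> simp <;> ring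
  rw [e]
  refine (norm_add_le _ _).trans (add_le_add_left ?_ _)
  exact norm_le_of_forall_abs_le (by positivity) (abs_sub_gridPt_le hu)

/-- The discretized noise is almost normalized. -/
theorem abs_one_sub_sum_noiseWeight_le (hδ : 0 < I.δ) (hA0 : 0 < I.A)
    (hA : Real.sqrt I.A = (2 * h + 1) * I.δ) (h0 : ∀ j, 0 < V j 0 0) (h1 : ∀ j, 0 < V j 1 1)
    (hs : ∀ j, V j 1 0 = V j 0 1) (hd : ∀ j, (V j).det = 1) {L : ℝ}
    (hL : ∀ w, ‖gradient (noiseDensity V) w‖ ≤ L) :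
    |1 - ∑ z ∈ labelBox n h, noiseWeight I V z| ≤ (∑ j, (V j 0 0 + V j 1 1)) / (I.A / 4) +
      I.A ^ n * (L * (Real.sqrt (2 * n) * (I.δ / 2))) := by
  set S := ⋃ z ∈ labelBox n h, halfOpenCube (gridPt 0 I.δ z) I.δ with hS
  have hr : ((2 * h + 1) * I.δ / 2) ^ 2 = I.A / 4 := by
    rw [← hA, div_pow, Real.sq_sqrt hA0.le]
    norm_num
  have ht := integral_noiseDensity_outside_le h0 h1 hs hd (r := (2 * h + 1) * I.δ / 2)
    (by positivity) (measurableSet_cells I.δ 0 (labelBox n h))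
    (fun u hu => mem_cells_of_abs_lt hδ (by simpa using hu))
  have hm := abs_mass_sub_sum_le (c := 0) (R := labelBox n h) (b := noiseWeight I V) hδ
    (integrable_noiseDensity h0 hs hd) (e := L * (Real.sqrt (2 * n) * (I.δ / 2)))
    (fun z _ u hu => by simpa using abs_noiseWeight_sub_le hδ hs hd hL 0 0 z hu)
  rw [hr] at ht
  rw [card_labelBox_mul hA0 hA] at hm
  have h1' : ∫ u in S, noiseDensity V u ≤ 1 := by
    rw [← integral_noiseDensity h0 hs hd]
    exact setIntegral_le_integral (integrable_noiseDensity h0 hs hd)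
      (ae_of_all _ noiseDensity_nonneg)
  rw [abs_le] at hm ⊢
  constructor <;> linarith

variable {K : Finset (PhaseSpace n)} {s : PhaseSpace n → ℝ}

theorem measurable_outputCentre (I : SimInput n) : Measurable (outputCentre I) := by
  refine (PiLp.volume_preserving_toLp (Fin n × Fin 2)).measurable.comp (measurable_pi_lambda _ fun i => ?_)
  have : Measurable fun y : PhaseSpace n => y i := by fun_prop
  unfold rebin
  have hf : Measurable fun y : PhaseSpace n => ⌊(y i - I.origin i) / I.Γ + 1 / 2⌋ :=
    Int.measurable_floor.comp (by fun_prop)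
  have hc : Measurable fun y : PhaseSpace n => ((⌊(y i - I.origin i) / I.Γ + 1 / 2⌋ : ℤ) : ℝ) :=
    (measurable_from_top (f := fun m : ℤ => (m : ℝ))).comp hf
  exact (hc.const_mul _).const_add _

/-- The third stage approximates the Gaussian noise. -/
theorem abs_integral_noise_sub_le (hδ : 0 < I.δ) (hA0 : 0 < I.A)
    (hA : Real.sqrt I.A = (2 * h + 1) * I.δ) (hΓ : I.Γ = (2 * g + 1) * I.δ)
    (h0 : ∀ j, 0 < V j 0 0) (h1 : ∀ j, 0 < V j 1 1)
    (hs : ∀ j, V j 1 0 = V j 0 1) (hd : ∀ j, (V j).det = 1) {L : ℝ}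
    (hL : ∀ w, ‖gradient (noiseDensity V) w‖ ≤ L) (hs1 : ∀ k, |s k| ≤ 1) {v v' : PhaseSpace n}
    {d : ℝ} (hvd : ‖v' - v‖ ≤ d) :
    |(∫ κ, noiseDensity V (κ - v) * pick K s (outputCentre I κ)) -
        signedSum K s ((noiseLaw I V).bind fun z => PMF.pure (outputCentre I (gridPt v' I.δ z)))| ≤
      2 * ((∑ j, (V j 0 0 + V j 1 1)) / (I.A / 4)) +
        I.A ^ n * (L * (3 * Real.sqrt (2 * n) * I.δ + 2 * d)) := by
  classical
  -- The computed point is rounded to the fine tiling aligned with the output cubes, so that no fine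
  -- cell is cut by the boundary of an output cube. The rounding moves it by at most half a
  -- diagonal.
  set c : PhaseSpace n := WithLp.toLp 2 fun i => rebin (I.origin i) I.δ (v' i) with hc
  have hL0 : 0 ≤ L := (norm_nonneg _).trans (hL 0)
  have hcv : ‖c - v‖ ≤ Real.sqrt (2 * n) * (I.δ / 2) + d := by
    rw [show c - v = (c - v') + (v' - v) by abel]
    refine (norm_add_le _ _).trans (add_le_add (norm_le_of_forall_abs_le (by positivity) fun i => ?_)
      hvd)
    have := rebin_mem (o := I.origin i) hδ (v' i)
    have e : (c - v') i = rebin (I.origin i) I.δ (v' i) - v' i := rfl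
    rw [e, abs_le]
    constructor <;> linarith
  have hF : Integrable fun κ => noiseDensity V (κ - v) :=
    (integrable_noiseDensity h0 hs hd).comp_sub_right v
  have hF1 : ∫ κ, noiseDensity V (κ - v) = 1 := by
    rw [integral_sub_right_eq_self, integral_noiseDensity h0 hs hd]
  have hb : ∀ z ∈ labelBox n h, ∀ u ∈ halfOpenCube (gridPt c I.δ z) I.δ,
      |I.δ ^ (2 * n) * noiseDensity V (u - v) - noiseWeight I V z| ≤
        I.δ ^ (2 * n) * (L * (Real.sqrt (2 * n) * I.δ + d)) := fun z _ u hu => by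
    refine (abs_noiseWeight_sub_le hδ hs hd hL v c z hu).trans ?_
    refine mul_le_mul_of_nonneg_left (mul_le_mul_of_nonneg_left ?_ hL0) (by positivity)
    linarith
  have hpos : 0 < ∑ z ∈ labelBox n h, noiseWeight I V z :=
    Finset.sum_pos (fun z _ => noiseWeight_pos hδ z) ⟨0, mem_labelBox.2 fun j => by simp⟩
  have hφ : Measurable fun κ => pick K s (outputCentre I κ) :=
    (measurable_pick K s).comp (measurable_outputCentre I)
  have hdisc := abs_integral_sub_sum_div_le hδ hF (fun u => noiseDensity_nonneg _) hF1
    (fun z _ => (noiseWeight_pos hδ z).le) hpos hb hφ.aestronglyMeasurable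
    (fun u => abs_pick_le K s hs1 _) (w := fun z => pick K s (outputCentre I (gridPt v' I.δ z)))
    -- The variation is zero: every point of a fine cell has the same output cube as the sampler's
    -- shifted point.
    (fun z _ => abs_pick_le K s hs1 _) le_rfl (fun z _ u hu => by
      have : outputCentre I u = outputCentre I (gridPt v' I.δ z) := by
        ext ⟨j, a⟩
        have hu' := hu (j, a)
        fin_cases a
        · exact rebin_eq_of_mem hδ hΓ hu'.1 hu'.2
        · exact rebin_eq_of_mem hδ hΓ hu'.1 hu'.2
      rw [this, sub_self, abs_zero])
  rw [card_labelBox_mul hA0 hA] at hdisc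
  have hm := abs_mass_sub_sum_le hδ hF hb
  rw [card_labelBox_mul hA0 hA] at hm
  have hn := abs_one_sub_sum_noiseWeight_le hδ hA0 hA h0 h1 hs hd hL
  rw [signedSum_bind_eq_div K s (toReal_noiseLaw_eq hδ hA)]
  refine hdisc.trans ?_
  have hm' := (abs_le.1 hm).1
  have hn' := (abs_le.1 hn).2
  -- The cell error enters twice, directly and through the mass estimate, and the normalization
  -- error of the weights centred at zero enters twice with half a diagonal each: 2 · 1 + 2 · 1/2 =
  -- 3.
  have e : I.A ^ n * (L * (3 * Real.sqrt (2 * n) * I.δ + 2 * d)) =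
      2 * (I.A ^ n * (L * (Real.sqrt (2 * n) * I.δ + d))) +
        2 * (I.A ^ n * (L * (Real.sqrt (2 * n) * (I.δ / 2)))) := by ring
  have h5 : 1 - ∑ z ∈ labelBox n h, noiseWeight I V z ≤ |1 - ∑ z ∈ labelBox n h, noiseWeight I V z| :=
    le_abs_self _
  rw [e]
  linarith

/-- The discretized density of the input. -/
def inputWeight (I : SimInput n) (z : Fin n → ℤ × ℤ) : ℝ :=
  I.δ ^ (2 * n) * ∏ j, max 0 (I.oracle j (z j))

theorem inputWeight_nonneg (hδ : 0 < I.δ) (z : Fin n → ℤ × ℤ) : 0 ≤ inputWeight I z :=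
  mul_nonneg (by positivity) (Finset.prod_nonneg fun j _ => le_max_left _ _)

theorem toReal_inputLaw_eq (hδ : 0 < I.δ) (hA : Real.sqrt I.A = (2 * h + 1) * I.δ)
    (hpos : 0 < ∑ z ∈ labelBox n h, inputWeight I z)
    (z : Fin n → ℤ × ℤ) : (inputLaw I z).toReal = if z ∈ labelBox n h then
      inputWeight I z / ∑ z ∈ labelBox n h, inputWeight I z else 0 := by
  refine product_table_eq (f := fun j z => max 0 (I.oracle j z)) hδ hA (C := I.δ ^ (2 * n))
    (by positivity) (fun z => rfl) (toReal_inputLaw I hδ ?_ z)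
  rw [Finset.prod_univ_sum, labels_eq hδ hA]
  unfold inputWeight at hpos
  rw [← Finset.mul_sum] at hpos
  exact pos_of_mul_pos_right hpos (by positivity)

/-- The gradient bound moves u to the grid point; there the oracle values replace the factors one by
one. Truncation at zero does no harm since W ≥ 0, and all factors are at most one because W ≤ 1/π
and η ≤ 1/8. -/
theorem abs_inputWeight_sub_le {ρ : Fin n → ModeState} (hρ : ∀ j z, 0 ≤ (ρ j).wigner z)
    (hδ : 0 < I.δ) (hdiff : Differentiable ℝ (wignerProd ρ)) {L η : ℝ}
    (hL : ∀ w, ‖gradient (wignerProd ρ) w‖ ≤ L) (hη : η ≤ 1 / 8)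
    (hO : ∀ j z, |I.oracle j z - (ρ j).wigner (gridPoint (mode I.mean j) I.δ z)| < η)
    (z : Fin n → ℤ × ℤ) {u : PhaseSpace n} (hu : u ∈ halfOpenCube (gridPt I.mean I.δ z) I.δ) :
    |I.δ ^ (2 * n) * wignerProd ρ u - inputWeight I z| ≤
      I.δ ^ (2 * n) * (L * (Real.sqrt (2 * n) * (I.δ / 2)) + n * η) := by
  rw [inputWeight, ← mul_sub, abs_mul, abs_of_nonneg (by positivity)]
  refine mul_le_mul_of_nonneg_left ?_ (by positivity)
  have hL0 : 0 ≤ L := (norm_nonneg _).trans (hL 0)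
  have h1 : |wignerProd ρ u - wignerProd ρ (gridPt I.mean I.δ z)| ≤
      L * (Real.sqrt (2 * n) * (I.δ / 2)) := by
    refine (abs_sub_le_of_norm_gradient_le hdiff hL _ _).trans (mul_le_mul_of_nonneg_left ?_ hL0)
    exact norm_le_of_forall_abs_le (by positivity) (abs_sub_gridPt_le hu)
  have hpi : Real.pi⁻¹ ≤ 1 / 2 := by
    rw [inv_le_comm₀ Real.pi_pos (by norm_num)]
    linarith [Real.pi_gt_three]
  have h2 : |wignerProd ρ (gridPt I.mean I.δ z) - ∏ j, max 0 (I.oracle j (z j))| ≤ n * η := by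
    refine (abs_prod_sub_prod_le Finset.univ (fun j _ => ?_) (fun j _ => ?_)).trans ?_
    · rw [abs_of_nonneg (hρ j _)]
      linarith [(ρ j).wigner_le (mode (gridPt I.mean I.δ z) j)]
    · rw [abs_of_nonneg (le_max_left _ _), max_le_iff]
      have := (abs_lt.1 (hO j (z j))).2
      exact ⟨zero_le_one, by linarith [(ρ j).wigner_le (gridPoint (mode I.mean j) I.δ (z j))]⟩
    · refine (Finset.sum_le_card_nsmul _ _ η fun j _ => ?_).trans_eq (by simp)
      rw [gridPt, mode_ofModes]
      have h3 := abs_lt.1 (hO j (z j))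
      have h4 := hρ j (gridPoint (mode I.mean j) I.δ (z j))
      rw [abs_le]
      rcases max_cases 0 (I.oracle j (z j)) with ⟨h5, h6⟩ | ⟨h5, h6⟩ <;> rw [h5] <;>
        constructor <;> linarith
  exact (abs_sub_le _ _ _).trans (add_le_add h1 h2)

end Stages

section Accuracy

variable {n : ℕ}

/-! ### Consequences of the hypotheses on the experiment -/

namespace Experiment

variable (E : Experiment n)

theorem VM_diag_pos (j : Fin n) (a : Fin 2) : 0 < E.VM j a a := (E.VM_posDef j).diag_pos

theorem VM_symm (j : Fin n) : E.VM j 1 0 = E.VM j 0 1 := by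
  have := congrFun (congrFun (E.VM_posDef j).1 0) 1
  simpa [Matrix.conjTranspose_apply] using this

/-- The product of the diagonal entries is 1 plus a square, so this is the arithmetic-geometric mean
inequality. It makes the area large in absolute terms. -/
theorem two_le_trace_VM (j : Fin n) : 2 ≤ E.VM j 0 0 + E.VM j 1 1 := by
  have h := det_two (E.VM_symm j) (E.VM_det j)
  nlinarith [E.VM_diag_pos j 0, E.VM_diag_pos j 1, sq_nonneg (E.VM j 0 0 - E.VM j 1 1),
    sq_nonneg (E.VM j 0 1)]

theorem integrable_wigner (j : Fin n) : Integrable (E.ρ j).wigner := by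
  refine (E.meanCov j).integrable.mono (E.ρ j).measurable_wigner.aestronglyMeasurable
    (ae_of_all _ fun z => ?_)
  rw [norm_mul, Real.norm_of_nonneg (by positivity : 0 ≤ 1 + ‖z‖ ^ 2)]
  exact le_mul_of_one_le_left (norm_nonneg _) (by nlinarith [sq_nonneg ‖z‖])

theorem integrable_sq_mul_wigner (j : Fin n) (a : Fin 2) :
    Integrable fun z => (z a - mode E.mean j a) ^ 2 * (E.ρ j).wigner z := by
  set m := mode E.mean j a
  -- The constant comes from (z - m)² ≤ 2z² + 2m² ≤ (2 + 2m²)(1 + ‖z‖²).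
  refine ((E.meanCov j).integrable.const_mul (2 + 2 * m ^ 2)).mono (Measurable.aestronglyMeasurable
    (Measurable.mul (by fun_prop) (E.ρ j).measurable_wigner)) (ae_of_all _ fun z => ?_)
  rw [norm_mul, norm_mul, norm_mul, ← mul_assoc]
  refine mul_le_mul_of_nonneg_right ?_ (norm_nonneg _)
  rw [Real.norm_of_nonneg (sq_nonneg _), Real.norm_of_nonneg (by positivity),
    Real.norm_of_nonneg (by positivity)]
  have h1 : z a ^ 2 ≤ ‖z‖ ^ 2 := by
    rw [← sq_abs]
    have := norm_le_pi_norm z a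
    rw [Real.norm_eq_abs] at this
    gcongr
  nlinarith [sq_nonneg (z a + m), sq_nonneg (m * ‖z‖), sq_nonneg ‖z‖]

theorem Vρ_diag_nonneg (j : Fin n) (a : Fin 2) : 0 ≤ E.Vρ j a a := by
  rw [← (E.meanCov j).cov a a]
  exact integral_nonneg fun z => mul_nonneg (mul_self_nonneg _) (E.wigner_nonneg j z)

theorem wignerProd_nonneg (u : PhaseSpace n) : 0 ≤ wignerProd E.ρ u :=
  Finset.prod_nonneg fun j _ => E.wigner_nonneg j _

theorem integral_wignerProd : ∫ u, wignerProd E.ρ u = 1 := by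
  have := integral_prod_modes fun j => (E.ρ j).wigner
  rw [Finset.prod_congr rfl fun j _ => (E.ρ j).integral_wigner (E.integrable_wigner j),
    Finset.prod_const_one] at this
  exact this

/-- The mass of the Wigner function outside a large cube around the mean. -/
theorem integral_wignerProd_outside_le {r : ℝ} (hr : 0 < r)
    {S : Set (PhaseSpace n)} (hS : MeasurableSet S)
    (hSr : ∀ u, (∀ i, |u i - E.mean i| < r) → u ∈ S) :
    1 - ∫ u in S, wignerProd E.ρ u ≤ (∑ j, (E.Vρ j 0 0 + E.Vρ j 1 1)) / r ^ 2 := by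
  have := integral_outside_le (f := fun j => (E.ρ j).wigner) E.wigner_nonneg E.integrable_wigner
    (fun j => (E.ρ j).integral_wigner (E.integrable_wigner j)) E.mean (s := fun j a => E.Vρ j a a)
    E.integrable_sq_mul_wigner
    (fun j a => by
      rw [← (E.meanCov j).cov a a]
      simp_rw [← sq]
      exact le_rfl) hr hS hSr
  simpa [Fin.sum_univ_two, wignerProd] using this

theorem measurable_wignerProd : Measurable (wignerProd E.ρ) :=
  Finset.measurable_prod _ fun j _ => (E.ρ j).measurable_wigner.comp (measurable_mode j)

theorem bornDensity_eq_integral (k : PhaseSpace n) : bornDensity E.ρ E.U E.VM k =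
    ∫ u, wignerProd E.ρ u * noiseDensity E.VM (k - (act E.T u + E.x)) :=
  bornDensity_eq E.integrable_wigner E.symplectic E.implements (fun j => E.VM_diag_pos j 0)
    E.VM_symm E.VM_det k

theorem integrable_joint : Integrable (Function.uncurry fun (u κ : PhaseSpace n) =>
    wignerProd E.ρ u * noiseDensity E.VM (κ - (act E.T u + E.x))) := by
  have hN := integrable_noiseDensity (fun j => E.VM_diag_pos j 0) E.VM_symm E.VM_det
  have hc := (differentiable_noiseDensity E.VM_symm E.VM_det).continuous
  rw [Measure.volume_eq_prod, integrable_prod_iff]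
  · refine ⟨ae_of_all _ fun u => by
      simpa only [Function.uncurry_apply_pair] using
        (hN.comp_sub_right (act E.T u + E.x)).const_mul (wignerProd E.ρ u), ?_⟩
    have e : ∀ u, ∫ κ, ‖wignerProd E.ρ u * noiseDensity E.VM (κ - (act E.T u + E.x))‖ =
        wignerProd E.ρ u := fun u => by
      simp_rw [norm_mul, Real.norm_of_nonneg (E.wignerProd_nonneg u),
        Real.norm_of_nonneg (noiseDensity_nonneg _)]
      rw [integral_const_mul, integral_sub_right_eq_self (noiseDensity E.VM),
        integral_noiseDensity (fun j => E.VM_diag_pos j 0) E.VM_symm E.VM_det, mul_one]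
    simp only [Function.uncurry_apply_pair, e]
    exact integrable_wignerProd E.integrable_wigner
  · refine Measurable.aestronglyMeasurable ?_
    exact (E.measurable_wignerProd.comp measurable_fst).mul
      (hc.comp (by fun_prop : Continuous fun p : PhaseSpace n × PhaseSpace n =>
        p.2 - (act E.T p.1 + E.x))).measurable

variable {K : Finset (PhaseSpace n)} {s : PhaseSpace n → ℝ}

/-- Signed combinations of the outcome probabilities as phase space averages. -/
theorem sum_quantProb_eq (I : SimInput n) (hΓ : 0 < I.Γ) (hs : ∀ k, |s k| ≤ 1)
    (hK : ∀ k ∈ K, ∃ r : Fin n × Fin 2 → ℤ, k = WithLp.toLp 2 fun i => I.origin i + I.Γ * r i) :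
    ∑ k ∈ K, s k * quantProb E.ρ E.U E.VM I.Γ k = ∫ u, wignerProd E.ρ u *
      ∫ κ, noiseDensity E.VM (κ - (act E.T u + E.x)) * pick K s (outputCentre I κ) := by
  classical
  have hφm : Measurable fun κ => pick K s (outputCentre I κ) :=
    (measurable_pick K s).comp (measurable_outputCentre I)
  have hbi : Integrable (bornDensity E.ρ E.U E.VM) := by
    rw [show bornDensity E.ρ E.U E.VM = _ from funext E.bornDensity_eq_integral]
    exact E.integrable_joint.integral_prod_right
  -- Only for centres of the tiling is the output event a cube, hence the restriction on K.
  have hcell : ∀ k ∈ K, ∀ κ, outputCentre I κ = k ↔ κ ∈ halfOpenCube k I.Γ := by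
    intro k hk κ
    obtain ⟨r, rfl⟩ := hK k hk
    simp only [outputCentre, halfOpenCube, Set.mem_ofPred_eq, ← rebin_eq_iff hΓ]
    exact ⟨fun h i => congrFun (congrArg WithLp.ofLp h) i, fun h => by
      ext i
      exact h i⟩
  have h1 : ∑ k ∈ K, s k * quantProb E.ρ E.U E.VM I.Γ k =
      ∫ κ, bornDensity E.ρ E.U E.VM κ * pick K s (outputCentre I κ) := by
    have e : ∀ κ, bornDensity E.ρ E.U E.VM κ * pick K s (outputCentre I κ) =
        ∑ k ∈ K, s k * (halfOpenCube k I.Γ).indicator (bornDensity E.ρ E.U E.VM) κ := fun κ => by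
      rw [pick_eq, Finset.mul_sum]
      refine Finset.sum_congr rfl fun k hk => ?_
      by_cases h : outputCentre I κ = k
      · rw [if_pos h, Set.indicator_of_mem ((hcell k hk κ).1 h), mul_comm]
      · rw [if_neg h, Set.indicator_of_notMem fun h' => h ((hcell k hk κ).2 h'), mul_zero, mul_zero]
    simp_rw [e]
    rw [integral_finsetSum _ fun k _ =>
      (hbi.indicator (measurableSet_halfOpenCube k I.Γ)).const_mul _]
    refine Finset.sum_congr rfl fun k _ => ?_
    rw [integral_const_mul, integral_indicator (measurableSet_halfOpenCube k I.Γ), quantProb,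
      setIntegral_congr_set (cube_ae_eq k I.Γ)]
  rw [h1]
  simp_rw [E.bornDensity_eq_integral, ← integral_mul_const, ← integral_const_mul, ← mul_assoc]
  refine (integral_integral_swap ?_).symm
  have hj := E.integrable_joint
  rw [Measure.volume_eq_prod] at hj
  exact hj.mul_bdd (c := 1) (hφm.comp measurable_snd).aestronglyMeasurable
    (ae_of_all _ fun p => abs_pick_le K s hs _)

end Experiment

/-! ### Consequences of admissibility -/

namespace Admissible

variable {E : Experiment n} {I : SimInput n} {ε β Λ η : ℝ}

theorem one_le_modes (hA : Admissible E I ε β Λ η) : (1 : ℝ) ≤ n := by exact_mod_cast hA.modes_pos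

theorem trace_le (hA : Admissible E I ε β Λ η) (i j : Fin n) :
    16 * n * (E.Vρ i 0 0 + E.Vρ i 1 1 + E.VM j 0 0 + E.VM j 1 1) ≤ I.A * ε :=
  (div_le_iff₀ hA.ε_pos).1 (hA.A_ge i j)

theorem modes_le (hA : Admissible E I ε β Λ η) : 32 * n ≤ I.A * ε := by
  have h := hA.trace_le ⟨0, hA.modes_pos⟩ ⟨0, hA.modes_pos⟩
  have h1 := E.two_le_trace_VM ⟨0, hA.modes_pos⟩
  have h2 := E.Vρ_diag_nonneg ⟨0, hA.modes_pos⟩ 0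
  have h3 := E.Vρ_diag_nonneg ⟨0, hA.modes_pos⟩ 1
  have h4 := hA.one_le_modes
  nlinarith

theorem area_ge (hA : Admissible E I ε β Λ η) : 32 * n ≤ I.A :=
  hA.modes_le.trans (mul_le_of_le_one_right hA.A_pos.le hA.ε_lt.le)

theorem one_le_area_pow (hA : Admissible E I ε β Λ η) : 1 ≤ I.A ^ n :=
  one_le_pow₀ (by linarith [hA.area_ge, hA.one_le_modes])

theorem error_le (hA : Admissible E I ε β Λ η) : n * I.A ^ n * η ≤ ε / 8 := by
  have h := hA.η_le
  have h1 := hA.one_le_modes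
  have h2 := hA.one_le_area_pow
  rw [le_div_iff₀ (by positivity)] at h
  linarith

theorem η_le_eighth (hA : Admissible E I ε β Λ η) : η ≤ 1 / 8 := by
  by_contra! h
  have h1 := hA.error_le
  have h2 : 1 ≤ n * I.A ^ n := one_le_mul_of_one_le_of_one_le hA.one_le_modes hA.one_le_area_pow
  nlinarith [hA.ε_lt]

theorem β_nonneg (hA : Admissible E I ε β Λ η) : 0 ≤ β := by
  have h := (norm_nonneg _).trans (hA.wigner_grad 0)
  have h1 := hA.one_le_modes
  have h2 := hA.one_le_area_pow
  rw [le_div_iff₀ (by positivity), zero_mul] at h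
  exact nonneg_of_mul_nonneg_right h (by positivity)

theorem noise_grad (hA : Admissible E I ε β Λ η) (w : PhaseSpace n) :
    ‖gradient (noiseDensity E.VM) w‖ ≤ n * Λ / I.A ^ n := by
  have h := hA.kernel_grad w 0
  simp only [gaussKernel_eq E.VM_det, sub_zero] at h
  exact h

theorem Λ_nonneg (hA : Admissible E I ε β Λ η) : 0 ≤ Λ := by
  have h := (norm_nonneg _).trans (hA.noise_grad 0)
  have h1 := hA.one_le_modes
  have h2 := hA.one_le_area_pow
  rw [le_div_iff₀ (by positivity), zero_mul] at h
  exact nonneg_of_mul_nonneg_right h (by positivity)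

theorem spacing_le (hA : Admissible E I ε β Λ η) :
    16 * ((1 + opNorm E.T) * Λ + β) * n * Real.sqrt (2 * n) * I.δ ≤ ε := by
  have h := hA.δ_le.trans (min_le_left _ _)
  have h0 : 0 ≤ opNorm E.T := norm_nonneg _
  have h1 : 0 ≤ 16 * ((1 + opNorm E.T) * Λ + β) * n * Real.sqrt (2 * n) := by
    have := hA.β_nonneg
    have := hA.Λ_nonneg
    positivity
  -- If the coefficient vanished, `spacingBound` would be a division by zero, but the claim would be
  -- trivial.
  rcases h1.eq_or_lt with h2 | h2
  · rw [← h2, zero_mul]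
    exact hA.ε_pos.le
  · rwa [spacingBound, le_div_iff₀ h2, mul_comm] at h

/-- The truncation cube has half-side √A/2, whence the A/4 of Chebyshev's bound. Each mode
contributes traces of at most Aε/(16n), and n modes give (ε/4)(A/4). -/
theorem tails_le (hA : Admissible E I ε β Λ η) :
    (∑ j, (E.Vρ j 0 0 + E.Vρ j 1 1)) / (I.A / 4) + (∑ j, (E.VM j 0 0 + E.VM j 1 1)) / (I.A / 4) ≤
      ε / 4 := by
  have hp := hA.A_pos
  rw [← add_div, ← Finset.sum_add_distrib, div_le_iff₀ (by positivity)]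
  have hn : (0 : ℝ) < n := by linarith [hA.one_le_modes]
  have h : ∀ j ∈ Finset.univ, E.Vρ j 0 0 + E.Vρ j 1 1 + (E.VM j 0 0 + E.VM j 1 1) ≤
      I.A * ε / (16 * n) := fun j _ => by
    rw [le_div_iff₀ (by positivity)]
    linarith [hA.trace_le j j]
  refine (Finset.sum_le_card_nsmul _ _ _ h).trans_eq ?_
  rw [Finset.card_univ, Fintype.card_fin, nsmul_eq_mul]
  field_simp
  ring

theorem sum_traces_nonneg (E : Experiment n) (I : SimInput n) (hp : 0 < I.A) :
    0 ≤ (∑ j, (E.VM j 0 0 + E.VM j 1 1)) / (I.A / 4) :=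
  div_nonneg (Finset.sum_nonneg fun j _ => (zero_le_two.trans (E.two_le_trace_VM j)))
    (by positivity)

variable {K : Finset (PhaseSpace n)} {s : PhaseSpace n → ℝ}

/-- The error of the sampler for a point `u` in the grid cell with labels `z`. -/
theorem abs_cell_error_le (hA : Admissible E I ε β Λ η)
    {aff : PhaseSpace n → Comp (PhaseSpace n)} (haff : AffineAccurate I E.T E.x aff)
    (hs : ∀ k, |s k| ≤ 1) {z : Fin n → ℤ × ℤ} (hz : ∀ j, z j ∈ I.labels) {u : PhaseSpace n}
    (hu : u ∈ halfOpenCube (gridPt I.mean I.δ z) I.δ) :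
    |(∫ κ, noiseDensity E.VM (κ - (act E.T u + E.x)) * pick K s (outputCentre I κ)) -
      signedSum K s ((aff (gridPt I.mean I.δ z)).res.bind fun v =>
        (noiseLaw I E.VM).bind fun z' => PMF.pure (outputCentre I (gridPt v I.δ z')))| ≤
      2 * ((∑ j, (E.VM j 0 0 + E.VM j 1 1)) / (I.A / 4)) +
        4 * ((1 + opNorm E.T) * Λ * n * Real.sqrt (2 * n) * I.δ) := by
  obtain ⟨h, hh⟩ := hA.A_odd
  obtain ⟨g, hg⟩ := hA.Γ_odd
  refine abs_sub_signedSum_bind_le K s _ _ fun v hv => ?_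
  have hδ := hA.δ_pos
  have hT : 0 ≤ opNorm E.T := norm_nonneg _
  have hd : ‖v - (act E.T u + E.x)‖ ≤ opNorm E.T * (Real.sqrt (2 * n) * I.δ) := by
    rw [Comp.res, PMF.support_map] at hv
    obtain ⟨r, hr, rfl⟩ := hv
    have h1 := haff z (fun j => by
      rw [gridLabels_eq]
      exact Finset.mem_toList.2 (hz j)) r hr
    have h2 : ‖act E.T (gridPt I.mean I.δ z) - act E.T u‖ ≤
        opNorm E.T * (Real.sqrt (2 * n) * (I.δ / 2)) := by
      rw [← map_sub]
      refine ((act E.T).le_opNorm _).trans (mul_le_mul_of_nonneg_left ?_ hT)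
      rw [norm_sub_rev]
      exact norm_le_of_forall_abs_le (by positivity) (abs_sub_gridPt_le hu)
    -- The tolerated numerical error equals the bound for the displacement by half a cell diagonal
    -- under T, so the total deviation is a full diagonal times ‖T‖.
    have h3 : I.ε₂ ≤ opNorm E.T * (Real.sqrt (2 * n) * (I.δ / 2)) := by
      refine hA.ε₂_le.trans_eq ?_
      have e : Real.sqrt (2 * n) = 2 * Real.sqrt (n / 2) := by
        rw [show (2 * n : ℝ) = 2 ^ 2 * (n / 2) by ring, Real.sqrt_mul (by positivity),
          Real.sqrt_sq zero_le_two]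
      rw [e]
      ring
    have e : r.1 - (act E.T u + E.x) = (r.1 - (act E.T (gridPt I.mean I.δ z) + E.x)) +
        (act E.T (gridPt I.mean I.δ z) - act E.T u) := by abel
    rw [e]
    refine (norm_add_le _ _).trans ((add_le_add (h1.trans h3) h2).trans_eq ?_)
    ring
  refine (abs_integral_noise_sub_le hδ hA.A_pos hh hg (fun j => E.VM_diag_pos j 0)
    (fun j => E.VM_diag_pos j 1) E.VM_symm E.VM_det hA.noise_grad hs hd).trans ?_
  have hAn : 0 < I.A ^ n := pow_pos hA.A_pos n
  have e : I.A ^ n * (n * Λ / I.A ^ n * (3 * Real.sqrt (2 * n) * I.δ +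
      2 * (opNorm E.T * (Real.sqrt (2 * n) * I.δ)))) =
      (3 + 2 * opNorm E.T) * (Λ * n * Real.sqrt (2 * n) * I.δ) := by
    field_simp
  rw [e]
  have h5 : 0 ≤ Λ * n * Real.sqrt (2 * n) * I.δ := by
    have := hA.Λ_nonneg
    positivity
  nlinarith [mul_nonneg hT h5]

/-- The error of the sampler in signed combinations of the probabilities. -/
theorem abs_signed_error_le (hA : Admissible E I ε β Λ η)
    {aff : PhaseSpace n → Comp (PhaseSpace n)} (haff : AffineAccurate I E.T E.x aff)
    (hs : ∀ k, |s k| ≤ 1)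
    (hK : ∀ k ∈ K, ∃ r : Fin n × Fin 2 → ℤ, k = WithLp.toLp 2 fun i => I.origin i + I.Γ * r i) :
    |∑ k ∈ K, s k * (quantProb E.ρ E.U E.VM I.Γ k - simProb I E.VM aff k)| ≤ ε := by
  classical
  obtain ⟨h, hh⟩ := hA.A_odd
  have hδ := hA.δ_pos
  have hAn : 0 < I.A ^ n := pow_pos hA.A_pos n
  have hΓ : 0 < I.Γ := hδ.trans_le (hA.δ_le.trans (min_le_right _ _))
  have hF := integrable_wignerProd E.integrable_wigner
  have hη := hA.error_le
  have hsp := hA.spacing_le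
  have hε := hA.ε_lt
  have hΛ : 0 ≤ (1 + opNorm E.T) * Λ * n * Real.sqrt (2 * n) * I.δ := by
    have := hA.Λ_nonneg
    have : 0 ≤ opNorm E.T := norm_nonneg _
    positivity
  have hb : ∀ z ∈ labelBox n h, ∀ u ∈ halfOpenCube (gridPt I.mean I.δ z) I.δ,
      |I.δ ^ (2 * n) * wignerProd E.ρ u - inputWeight I z| ≤ I.δ ^ (2 * n) *
        (n * β / I.A ^ n * (Real.sqrt (2 * n) * (I.δ / 2)) + n * η) := fun z _ u hu =>
    abs_inputWeight_sub_le E.wigner_nonneg hδ hA.wigner_diff hA.wigner_grad hA.η_le_eighth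
      (by rw [hA.mean_eq]; exact hA.oracle_acc) z hu
  have hm := abs_mass_sub_sum_le hδ hF hb
  rw [card_labelBox_mul hA.A_pos hh] at hm
  have hr : ((2 * h + 1) * I.δ / 2) ^ 2 = I.A / 4 := by
    rw [← hh, div_pow, Real.sq_sqrt hA.A_pos.le]
    norm_num
  have ht := E.integral_wignerProd_outside_le (r := (2 * h + 1) * I.δ / 2)
    (by positivity) (measurableSet_cells I.δ I.mean (labelBox n h))
    (fun u hu => mem_cells_of_abs_lt hδ (by rw [hA.mean_eq]; exact hu))
  rw [hr] at ht
  have h1 : ∫ u in ⋃ z ∈ labelBox n h, halfOpenCube (gridPt I.mean I.δ z) I.δ, wignerProd E.ρ u ≤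
      1 := by
    rw [← E.integral_wignerProd]
    exact setIntegral_le_integral hF (ae_of_all _ E.wignerProd_nonneg)
  have e : I.A ^ n * (n * β / I.A ^ n * (Real.sqrt (2 * n) * (I.δ / 2)) + n * η) =
      β * n * Real.sqrt (2 * n) * I.δ / 2 + n * I.A ^ n * η := by
    field_simp
  rw [e] at hm
  have hgap : |1 - ∑ z ∈ labelBox n h, inputWeight I z| ≤
      (∑ j, (E.Vρ j 0 0 + E.Vρ j 1 1)) / (I.A / 4) +
        (β * n * Real.sqrt (2 * n) * I.δ / 2 + n * I.A ^ n * η) := by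
    rw [abs_le] at hm ⊢
    constructor <;> linarith
  have htails := hA.tails_le
  have h3 := sum_traces_nonneg E I hA.A_pos
  -- The total weight is off by less than one, so the oracle table cannot vanish and the first stage
  -- is a genuine draw.
  have hpos : 0 < ∑ z ∈ labelBox n h, inputWeight I z := by
    have := (abs_le.1 hgap).2
    linarith
  rw [← Finset.sum_congr rfl fun k _ => (mul_sub _ _ _).symm, Finset.sum_sub_distrib,
    E.sum_quantProb_eq I hΓ hs hK]
  have hsim : ∑ k ∈ K, s k * simProb I E.VM aff k =
      (∑ z ∈ labelBox n h, inputWeight I z *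
        signedSum K s ((aff (gridPt I.mean I.δ z)).res.bind fun v =>
          (noiseLaw I E.VM).bind fun z' => PMF.pure (outputCentre I (gridPt v I.δ z')))) /
        ∑ z ∈ labelBox n h, inputWeight I z := by
    rw [← signedSum_bind_eq_div K s (toReal_inputLaw_eq hδ hh hpos)]
    change signedSum K s (simulate I E.VM aff).res = _
    rw [res_simulate]
    rfl
  rw [hsim]
  have hψm : AEStronglyMeasurable (fun u => ∫ κ, noiseDensity E.VM (κ - (act E.T u + E.x)) *
      pick K s (outputCentre I κ)) volume := by
    have hc := (differentiable_noiseDensity E.VM_symm E.VM_det).continuous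
    refine (StronglyMeasurable.integral_prod_right (Measurable.stronglyMeasurable ?_)).aestronglyMeasurable
    exact ((hc.comp (by fun_prop : Continuous fun p : PhaseSpace n × PhaseSpace n =>
        p.2 - (act E.T p.1 + E.x))).measurable).mul
      (((measurable_pick K s).comp (measurable_outputCentre I)).comp measurable_snd)
  have hN := integrable_noiseDensity (fun j => E.VM_diag_pos j 0) E.VM_symm E.VM_det
  have hψ1 : ∀ u, |∫ κ, noiseDensity E.VM (κ - (act E.T u + E.x)) * pick K s (outputCentre I κ)| ≤
      1 := fun u => by
    rw [← Real.norm_eq_abs, ← integral_noiseDensity (fun j => E.VM_diag_pos j 0) E.VM_symm E.VM_det,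
      ← integral_sub_right_eq_self (noiseDensity E.VM) (act E.T u + E.x)]
    refine norm_integral_le_of_norm_le (hN.comp_sub_right _) (ae_of_all _ fun κ => ?_)
    rw [norm_mul, Real.norm_of_nonneg (noiseDensity_nonneg _)]
    exact mul_le_of_le_one_right (noiseDensity_nonneg _) (abs_pick_le K s hs _)
  refine (abs_integral_sub_sum_div_le hδ hF E.wignerProd_nonneg E.integral_wignerProd
    (fun z _ => inputWeight_nonneg hδ z) hpos hb hψm hψ1 (fun z _ => abs_signedSum_le K hs _)
    (D := 2 * ((∑ j, (E.VM j 0 0 + E.VM j 1 1)) / (I.A / 4)) +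
        4 * ((1 + opNorm E.T) * Λ * n * Real.sqrt (2 * n) * I.δ)) (by linarith)
    (fun z hz u hu => hA.abs_cell_error_le haff hs ((mem_labelBox_iff hδ hh z).1 hz) hu)).trans ?_
  rw [card_labelBox_mul hA.A_pos hh, e]
  have hβ : 0 ≤ β * n * Real.sqrt (2 * n) * I.δ := by
    have := hA.β_nonneg
    positivity
  -- Both kinds of tail count twice, giving ε/2; the spacing terms stay within ε/4; the oracle term
  -- n Aⁿ η counts twice and stays within ε/4.
  linarith

/-- The sampler is accurate. -/
theorem closeToBorn (hA : Admissible E I ε β Λ η)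
    {aff : PhaseSpace n → Comp (PhaseSpace n)} (haff : AffineAccurate I E.T E.x aff) :
    CloseToBorn E I aff ε := by
  classical
  unfold CloseToBorn
  intro d
  have hΓ : 0 < I.Γ := hA.δ_pos.trans_le (hA.δ_le.trans (min_le_right _ _))
  have h0 : 0 ≤ d := fun r => abs_nonneg _
  set kk : (Fin n × Fin 2 → ℤ) → PhaseSpace n :=
    fun r => WithLp.toLp 2 fun i => I.origin i + I.Γ * r i with hkk
  have hinj : Function.Injective kk := fun r r' h => by
    ext i
    have := congrFun (congrArg WithLp.ofLp h) i
    simpa [hkk, hΓ.ne'] using this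
  set D : PhaseSpace n → ℝ := fun k => quantProb E.ρ E.U E.VM I.Γ k - simProb I E.VM aff k
  have hle : ∀ F : Finset (Fin n × Fin 2 → ℤ), ∑ r ∈ F, d r ≤ ε := by
    intro F
    -- With s the sign of the difference, the signed combination is the partial sum of the 1-norm.
    refine le_trans (le_of_eq ?_) ((le_abs_self _).trans (hA.abs_signed_error_le (K := F.image kk)
      (s := fun k => if 0 ≤ D k then 1 else -1) haff (fun k => by split_ifs <;> simp)
      fun k hk => ?_))
    · rw [Finset.sum_image fun r _ r' _ h => hinj h]
      refine Finset.sum_congr rfl fun r _ => ?_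
      change |D (kk r)| = (if 0 ≤ D (kk r) then 1 else -1) * D (kk r)
      split_ifs with h
      · rw [abs_of_nonneg h, one_mul]
      · rw [abs_of_neg (not_le.1 h), neg_one_mul]
    · obtain ⟨r, -, rfl⟩ := Finset.mem_image.1 hk
      exact ⟨r, rfl⟩
  exact ⟨summable_of_sum_le h0 hle, Real.tsum_le_of_sum_le h0 hle⟩

end Admissible

end Accuracy

/-! ### Running times -/

/-- Every run yields a result with property `P` in at most `t` steps. -/
def Comp.Within {α : Type} (m : Comp α) (P : α → Prop) (t : ℝ) : Prop :=
  ∀ r ∈ m.law.support, P r.1 ∧ (r.2 : ℝ) ≤ t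

section Within

variable {α β : Type} {P : α → Prop} {Q : β → Prop} {t t' : ℝ}

theorem Comp.Within.mono {m : Comp α} {P' : α → Prop} (h : m.Within P t) (hP : ∀ a, P a → P' a)
    (ht : t ≤ t') : m.Within P' t' := fun r hr => ⟨hP _ (h r hr).1, (h r hr).2.trans ht⟩

theorem within_pure {a : α} (ha : P a) : (pure a : Comp α).Within P 0 := by
  intro r hr
  change r ∈ (PMF.pure (a, 0)).support at hr
  rw [PMF.support_pure, Set.mem_singleton_iff] at hr
  subst hr
  exact ⟨ha, by simp⟩

theorem within_tick (c : ℕ) : (tick c).Within (fun _ => True) c := by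
  intro r hr
  change r ∈ (PMF.pure ((), c)).support at hr
  rw [PMF.support_pure, Set.mem_singleton_iff] at hr
  subst hr
  exact ⟨trivial, le_rfl⟩

theorem within_draw {p : PMF α} (h : ∀ a ∈ p.support, P a) : (draw p).Within P 0 := by
  intro r hr
  rw [draw, PMF.support_map] at hr
  obtain ⟨a, ha, rfl⟩ := hr
  exact ⟨h a ha, by simp⟩

theorem Comp.Within.bind {m : Comp α} {f : α → Comp β} (hm : m.Within P t)
    (hf : ∀ a, P a → (f a).Within Q t') : (m >>= f).Within Q (t + t') := by
  intro r hr
  change r ∈ (m.law.bind fun r => (f r.1).law.map fun s => (s.1, r.2 + s.2)).support at hr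
  rw [PMF.mem_support_bind_iff] at hr
  obtain ⟨q, hq, hr⟩ := hr
  rw [PMF.support_map] at hr
  obtain ⟨s, hs, rfl⟩ := hr
  obtain ⟨h1, h2⟩ := hm q hq
  obtain ⟨h3, h4⟩ := hf _ h1 s hs
  refine ⟨h3, ?_⟩
  push_cast
  linarith

theorem within_tick_pure {c : ℕ} {a : α} (ha : P a) :
    (tick c >>= fun _ => pure a : Comp α).Within P c := by
  have := (within_tick c).bind (f := fun _ => pure a) fun _ _ => within_pure ha
  rwa [add_zero] at this

theorem within_tabulate {ι : Type} [DecidableEq ι] {f : ι → Comp ℝ} {P : ι → ℝ → Prop} : ∀ is : List ι,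
    (∀ i ∈ is, (f i).Within (P i) t) →
      (tabulate is f).Within (fun v => ∀ i ∈ is, P i (v i)) (is.length * t)
  | [], _ => by
    rw [tabulate, List.length_nil, Nat.cast_zero, zero_mul]
    exact within_pure (by simp)
  | i :: is, h => by
    rw [tabulate]
    refine ((h i List.mem_cons_self).bind fun a ha => (within_tabulate is fun k hk =>
      h k (List.mem_cons_of_mem _ hk)).bind fun v hv => within_pure fun k hk => ?_).mono
        (fun _ => id) (le_of_eq (by rw [List.length_cons]; push_cast; ring))
    by_cases hki : k = i
    · subst hki
      simpa using ha
    · rw [Function.update_of_ne hki]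
      exact hv k ((List.mem_cons.1 hk).resolve_left hki)

theorem within_total {ι : Type} (v : ι → ℝ) : ∀ is : List ι,
    (total is v).Within (fun _ => True) is.length
  | [] => by
    rw [total, List.length_nil, Nat.cast_zero]
    exact within_pure trivial
  | i :: is => by
    rw [total]
    refine ((within_total v is).bind fun s _ => within_tick_pure trivial).mono (fun _ => id)
      (le_of_eq (by rw [List.length_cons]; push_cast; ring))

theorem within_forModes : ∀ {n : ℕ} {f : Fin n → Comp α} {P : Fin n → α → Prop},
    (∀ j, (f j).Within (P j) t) → (forModes f).Within (fun v => ∀ j, P j (v j)) (n * t)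
  | 0, f, P, _ => by
    rw [forModes, Nat.cast_zero, zero_mul]
    exact within_pure fun j => j.elim0
  | n + 1, f, P, h => by
    rw [forModes]
    refine ((h 0).bind fun a ha => (within_forModes fun j => h j.succ).bind fun v hv => within_pure fun j => ?_).mono
        (fun _ => id) (le_of_eq (by push_cast; ring))
    refine Fin.cases ?_ (fun j => ?_) j
    · exact ha
    · exact hv j

/-- A degenerate table makes the law fall back on `default`, which must therefore be a legitimate
label. -/
theorem mem_of_mem_support_tableLaw {ι : Type} [Inhabited ι] {pts : List ι} {v : ι → ℝ}
    (hd : default ∈ pts) {i : ι} (hi : i ∈ (tableLaw pts v).support) : i ∈ pts := by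
  classical
  unfold tableLaw at hi
  split_ifs at hi with h
  · rw [PMF.mem_support_normalize_iff] at hi
    by_contra hn
    exact hi (if_neg hn)
  · rw [PMF.support_pure, Set.mem_singleton_iff] at hi
    rwa [hi]

/-- Per entry: two steps to tabulate, one to add, one to normalize, one to scan. -/
theorem within_drawFromTable {pts : List (ℤ × ℤ)} (h0 : (0, 0) ∈ pts) (f : ℤ × ℤ → ℝ) (δ : ℝ) :
    (drawFromTable pts f δ).Within (fun z => z ∈ pts) (5 * pts.length) := by
  have h1 : (tabulate pts fun z => do
      tick 2
      pure (f z * δ ^ 2)).Within (fun _ => True) (pts.length * (2 : ℕ)) :=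
    (within_tabulate (P := fun _ _ => True) pts fun z _ => within_tick_pure trivial).mono
      (fun _ _ => trivial) le_rfl
  rw [drawFromTable]
  refine (h1.bind fun v _ => (within_total v pts).bind fun s _ => Comp.Within.bind
    (P := fun _ => True) (t := pts.length * (1 : ℕ))
    ((within_tabulate (P := fun _ _ => True) pts fun z _ => within_tick_pure trivial).mono
      (fun _ _ => trivial) le_rfl) fun v' _ => (within_tick _).bind fun _ _ => within_draw
        fun z hz => mem_of_mem_support_tableLaw h0 hz).mono (fun _ => id) (le_of_eq ?_)
  push_cast
  ring

end Within

/-! ### Running time of the sampler apart from the affine map -/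

section SamplerCost

variable {n : ℕ} {I : SimInput n} {V : Fin n → Matrix (Fin 2) (Fin 2) ℝ} {h : ℕ}

theorem length_gridLabels (hδ : 0 < I.δ) (hA : Real.sqrt I.A = (2 * h + 1) * I.δ) :
    ((gridLabels I.A I.δ).length : ℝ) = (2 * h + 1) ^ 2 := by
  rw [gridLabels_eq, Finset.length_toList, labels_eq hδ hA, Finset.card_product, Int.card_Icc]
  have : ((h : ℤ) + 1 - -(h : ℤ)).toNat = 2 * h + 1 := by omega
  rw [this]
  push_cast
  ring

theorem mem_gridLabels (hδ : 0 < I.δ) (hA : Real.sqrt I.A = (2 * h + 1) * I.δ) {z : ℤ × ℤ} :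
    z ∈ gridLabels I.A I.δ ↔ |z.1| ≤ h ∧ |z.2| ≤ h := by
  rw [gridLabels_eq, Finset.mem_toList, labels_eq hδ hA]
  simp [abs_le]

/-- The running time of the sampler with a given subroutine for the affine map. -/
theorem within_simulate (hδ : 0 < I.δ) (hA : Real.sqrt I.A = (2 * h + 1) * I.δ)
    {aff : PhaseSpace n → Comp (PhaseSpace n)} {t : ℝ}
    (haff : ∀ z : Fin n → ℤ × ℤ, (∀ j, |(z j).1| ≤ h ∧ |(z j).2| ≤ h) →
      (aff (gridPt I.mean I.δ z)).Within (fun _ => True) t) :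
    (simulate I V aff).Within (fun _ => True) (30 * n * (2 * h + 1) ^ 2 + t) := by
  have h0 : ((0, 0) : ℤ × ℤ) ∈ gridLabels I.A I.δ := (mem_gridLabels hδ hA).2 (by simp)
  have hL := length_gridLabels hδ hA
  have h1 : ∀ j, (sampleMode I j).Within (fun u => ∃ z : ℤ × ℤ, (|z.1| ≤ h ∧ |z.2| ≤ h) ∧
      u = gridPoint (mode I.mean j) I.δ z) (5 * (2 * h + 1) ^ 2 + 4) := fun j => by
    rw [sampleMode, ← hL]
    exact (within_drawFromTable h0 _ _).bind fun z hz =>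
      within_tick_pure ⟨z, (mem_gridLabels hδ hA).1 hz, rfl⟩
  have h3 : ∀ v j, (measureMode I V v j).Within (fun _ => True) (5 * (2 * h + 1) ^ 2 + 16) :=
    fun v j => by
      rw [measureMode, ← hL]
      exact (within_drawFromTable h0 _ _).bind fun z hz => within_tick_pure trivial
  rw [simulate]
  refine ((within_forModes h1).bind fun u hu => Comp.Within.bind (P := fun _ => True) (t := t) ?_
    fun v _ => (within_forModes (h3 v)).bind fun k _ => within_pure trivial).mono (fun _ => id) ?_
  · choose z hz hzu using hu
    have e : ofModes u = gridPt I.mean I.δ z := by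
      rw [gridPt]
      congr 1
      ext1 j
      exact hzu j
    rw [e]
    exact haff z hz
  -- The fixed costs 4 and 16 per mode are absorbed into the tables: 5 + 5 + 4 + 16 = 30.
  · have h4 : (1 : ℝ) ≤ (2 * h + 1) ^ 2 := one_le_pow₀ (by linarith [(Nat.cast_nonneg h : (0 : ℝ) ≤ h)])
    have h5 : (n : ℝ) * 1 ≤ n * (2 * h + 1) ^ 2 := by gcongr
    linarith

end SamplerCost

/-! ### Fixed-point arithmetic -/

section FixedPoint

variable {Z ℓ : ℝ}

theorem within_mulInt (hℓ : ∀ a : ℤ, |(a : ℝ)| ≤ Z → (bitLen a : ℝ) ≤ ℓ) {a b : ℤ}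
    (ha : |(a : ℝ)| ≤ Z) (hb : |(b : ℝ)| ≤ Z) :
    (mulInt a b).Within (fun m => m = a * b) (ℓ ^ 2) := by
  rw [mulInt]
  refine (within_tick_pure (P := fun m => m = a * b) rfl).mono (fun _ => id) ?_
  push_cast
  rw [sq]
  exact mul_le_mul (hℓ a ha) (hℓ b hb) (Nat.cast_nonneg _) ((Nat.cast_nonneg _).trans (hℓ a ha))

theorem within_addInt (hℓ : ∀ a : ℤ, |(a : ℝ)| ≤ Z → (bitLen a : ℝ) ≤ ℓ) {a b : ℤ}
    (ha : |(a : ℝ)| ≤ Z) (hb : |(b : ℝ)| ≤ Z) :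
    (addInt a b).Within (fun m => m = a + b) (2 * ℓ) := by
  rw [addInt]
  refine (within_tick_pure (P := fun m => m = a + b) rfl).mono (fun _ => id) ?_
  push_cast
  linarith [hℓ a ha, hℓ b hb]

/-- The invariant reserves M² for every remaining term, so no intermediate operand outgrows Z and
each operation is charged with the one length bound ℓ. -/
theorem within_dotInt {ι : Type} (hℓ : ∀ a : ℤ, |(a : ℝ)| ≤ Z → (bitLen a : ℝ) ≤ ℓ)
    {a b : ι → ℤ} {M : ℝ} (ha : ∀ k, |(a k : ℝ)| ≤ M) (hb : ∀ k, |(b k : ℝ)| ≤ M) (hM : M ≤ Z)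
    (hM2 : M ^ 2 ≤ Z) : ∀ (ks : List ι) (acc : ℤ), |(acc : ℝ)| + ks.length * M ^ 2 ≤ Z →
    (dotInt ks a b acc).Within (fun s => s = acc + (ks.map fun k => a k * b k).sum)
      (ks.length * (ℓ ^ 2 + 2 * ℓ))
  | [], acc, _ => by
    rw [dotInt, List.length_nil, Nat.cast_zero, zero_mul]
    exact within_pure (by simp)
  | k :: ks, acc, h => by
    rw [dotInt]
    rw [List.length_cons] at h
    push_cast at h
    have hab : |((a k * b k : ℤ) : ℝ)| ≤ M ^ 2 := by
      push_cast
      rw [abs_mul, sq]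
      exact mul_le_mul (ha k) (hb k) (abs_nonneg _) ((abs_nonneg _).trans (ha k))
    have hl : (0 : ℝ) ≤ ks.length * M ^ 2 := by positivity
    refine ((within_mulInt hℓ ((ha k).trans hM) ((hb k).trans hM)).bind
      (Q := fun s => s = acc + ((k :: ks).map fun k => a k * b k).sum)
      (t' := 2 * ℓ + ks.length * (ℓ ^ 2 + 2 * ℓ)) fun m hm => ?_).mono
        (fun _ => id) (le_of_eq (by rw [List.length_cons]; push_cast; ring))
    subst hm
    refine (within_addInt hℓ (by nlinarith) (hab.trans hM2)).bind fun s hs => ?_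
    subst hs
    refine (within_dotInt hℓ ha hb hM hM2 ks _ ?_).mono (fun s hs => ?_) le_rfl
    · have := abs_add_le (acc : ℝ) ((a k * b k : ℤ) : ℝ)
      rw [Int.cast_add]
      linarith
    · rw [hs, List.map_cons, List.sum_cons, add_assoc]

theorem abs_toFixed_sub_le (p : ℕ) (y : ℝ) : |(toFixed p y : ℝ) - 2 ^ p * y| ≤ 1 / 2 := by
  rw [abs_sub_comm]
  exact abs_sub_round _

theorem abs_toFixed_le (p : ℕ) {y Q : ℝ} (hy : |y| + 1 ≤ Q) : |(toFixed p y : ℝ)| ≤ 2 ^ p * Q := by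
  have h1 := abs_toFixed_sub_le p y
  have h2 : (1 : ℝ) ≤ 2 ^ p := one_le_pow₀ one_le_two
  have h3 : |(2 : ℝ) ^ p * y| = 2 ^ p * |y| := by rw [abs_mul, abs_of_nonneg (by positivity)]
  have h4 := abs_add_le ((toFixed p y : ℝ) - 2 ^ p * y) (2 ^ p * y)
  rw [sub_add_cancel, h3] at h4
  nlinarith

/-- Accuracy and running time of the affine map in fixed-point arithmetic. -/
theorem within_fixedPointAffine {n : ℕ} (hn : 1 ≤ n) (p : ℕ)
    {T : Matrix (Fin n × Fin 2) (Fin n × Fin 2) ℝ} {x u : PhaseSpace n} {Q : ℝ}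
    (hT : ∀ i k, |T i k| + 1 ≤ Q) (hx : ∀ i, |x i| + 1 ≤ Q) (hu : ∀ i, |u i| + 1 ≤ Q)
    (hℓ : ∀ a : ℤ, |(a : ℝ)| ≤ 3 * n * (2 ^ p * Q) ^ 2 → (bitLen a : ℝ) ≤ ℓ) (hℓ1 : 1 ≤ ℓ) :
    (fixedPointAffine p T x u).Within
      (fun v => ‖v - (act T u + x)‖ ≤ Real.sqrt (2 * n) * (3 * n * Q / 2 ^ p))
      (18 * n ^ 2 * ℓ ^ 2) := by
  have hn1 : (1 : ℝ) ≤ n := by exact_mod_cast hn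
  have hQ1 : 1 ≤ Q := by linarith [hx (⟨0, hn⟩, 0), abs_nonneg (x (⟨0, hn⟩, 0))]
  have h2p : (1 : ℝ) ≤ 2 ^ p := one_le_pow₀ one_le_two
  set M : ℝ := 2 ^ p * Q with hMdef
  have hM1 : 1 ≤ M := one_le_mul_of_one_le_of_one_le h2p hQ1
  have h2M : (2 : ℝ) ^ p ≤ M := le_mul_of_one_le_right (by positivity) hQ1
  have hlen : ((Finset.univ : Finset (Fin n × Fin 2)).toList.length : ℝ) = 2 * n := by
    rw [Finset.length_toList, Finset.card_univ, Fintype.card_prod, Fintype.card_fin,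
      Fintype.card_fin]
    push_cast
    ring
  have hMM : M ≤ M ^ 2 := by nlinarith
  have hMZ : M ^ 2 ≤ 3 * n * M ^ 2 := by nlinarith [sq_nonneg M]
  have hrow : ∀ i, (do
      let x0 ← mulInt (2 ^ p) (toFixed p (x i))
      let s ← dotInt (Finset.univ : Finset (Fin n × Fin 2)).toList
        (fun k => toFixed p (T i k)) (fun k => toFixed p (u k)) x0
      pure ((s : ℝ) / 4 ^ p)).Within
        (fun y => |y - ((∑ k, T i k * u k) + x i)| ≤ 3 * n * Q / 2 ^ p)
        (ℓ ^ 2 + 2 * n * (ℓ ^ 2 + 2 * ℓ)) := by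
    intro i
    refine (within_mulInt hℓ (a := 2 ^ p) (b := toFixed p (x i)) ?_ ?_).bind fun x0 hx0 => ?_
    · push_cast
      rw [abs_of_nonneg (by positivity)]
      linarith
    · exact (abs_toFixed_le p (hx i)).trans (by linarith)
    · subst hx0
      rw [← hlen]
      refine ((within_dotInt hℓ (M := M) (fun k => abs_toFixed_le p (hT i k))
        (fun k => abs_toFixed_le p (hu k)) (by linarith) hMZ _ _ ?_).bind
          fun s hs => within_pure ?_).mono (fun _ => id) (le_of_eq (add_zero _))
      · rw [hlen]
        push_cast
        rw [abs_mul, abs_of_nonneg (by positivity : (0 : ℝ) ≤ 2 ^ p)]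
        have h1 := abs_toFixed_le p (hx i)
        have h2 : (2 : ℝ) ^ p * |(toFixed p (x i) : ℝ)| ≤ M * M :=
          mul_le_mul h2M h1 (abs_nonneg _) (by linarith)
        nlinarith
      · rw [hs, Finset.sum_map_toList]
        push_cast
        have e4 : (4 : ℝ) ^ p = 2 ^ p * 2 ^ p := by rw [← mul_pow]; norm_num
        have e : ((2 : ℝ) ^ p * (toFixed p (x i) : ℝ) +
            ∑ k, (toFixed p (T i k) : ℝ) * (toFixed p (u k) : ℝ)) / 4 ^ p -
              ((∑ k, T i k * u k) + x i) = (((toFixed p (x i) : ℝ) - 2 ^ p * x i) * 2 ^ p +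
            ∑ k, (((toFixed p (T i k) : ℝ) - 2 ^ p * T i k) * toFixed p (u k) +
              2 ^ p * T i k * ((toFixed p (u k) : ℝ) - 2 ^ p * u k))) / (2 ^ p * 2 ^ p) := by
          have e1 : ∑ k, (((toFixed p (T i k) : ℝ) - 2 ^ p * T i k) * toFixed p (u k) +
              2 ^ p * T i k * ((toFixed p (u k) : ℝ) - 2 ^ p * u k)) =
              ∑ k, (toFixed p (T i k) : ℝ) * (toFixed p (u k) : ℝ) -
                2 ^ p * 2 ^ p * ∑ k, T i k * u k := by
            rw [Finset.mul_sum, ← Finset.sum_sub_distrib]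
            exact Finset.sum_congr rfl fun k _ => by ring
          rw [e1, e4]
          field_simp
          ring
        -- Each product has two rounding errors of at most 1/2 against a factor of at most M. Summed
        -- over 2n terms, with the error of x, this is at most 3nM; division by 4ᵖ gives 3nQ/2ᵖ.
        have hk : ∀ k ∈ (Finset.univ : Finset (Fin n × Fin 2)),
            |((toFixed p (T i k) : ℝ) - 2 ^ p * T i k) * toFixed p (u k) +
              2 ^ p * T i k * ((toFixed p (u k) : ℝ) - 2 ^ p * u k)| ≤ M := fun k _ => by
          refine (abs_add_le _ _).trans ?_
          rw [abs_mul, abs_mul, abs_mul, abs_of_nonneg (by positivity : (0 : ℝ) ≤ 2 ^ p)]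
          have h1 := mul_le_mul (abs_toFixed_sub_le p (T i k)) (abs_toFixed_le p (hu k))
            (abs_nonneg _) (by norm_num)
          have h2 : (2 : ℝ) ^ p * |T i k| ≤ M :=
            mul_le_mul_of_nonneg_left (by linarith [hT i k]) (by positivity)
          have h3 := mul_le_mul h2 (abs_toFixed_sub_le p (u k)) (abs_nonneg _) (by linarith)
          linarith
        have hsum := (Finset.abs_sum_le_sum_abs _ _).trans (Finset.sum_le_card_nsmul _ _ _ hk)
        rw [← Finset.length_toList, nsmul_eq_mul, hlen] at hsum
        have h0 : |((toFixed p (x i) : ℝ) - 2 ^ p * x i) * 2 ^ p| ≤ M := by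
          rw [abs_mul, abs_of_nonneg (by positivity : (0 : ℝ) ≤ 2 ^ p)]
          nlinarith [abs_toFixed_sub_le p (x i)]
        rw [e, abs_div, abs_of_pos (by positivity : (0 : ℝ) < 2 ^ p * 2 ^ p),
          div_le_div_iff₀ (by positivity) (by positivity)]
        have h5 : |((toFixed p (x i) : ℝ) - 2 ^ p * x i) * 2 ^ p +
            ∑ k, (((toFixed p (T i k) : ℝ) - 2 ^ p * T i k) * toFixed p (u k) +
              2 ^ p * T i k * ((toFixed p (u k) : ℝ) - 2 ^ p * u k))| ≤ 3 * n * M := by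
          refine (abs_add_le _ _).trans ((add_le_add h0 hsum).trans ?_)
          nlinarith
        refine (mul_le_mul_of_nonneg_right h5 (by positivity)).trans_eq ?_
        rw [hMdef]
        ring
  rw [fixedPointAffine]
  refine ((within_tabulate _ fun i _ => hrow i).bind fun v hv => within_pure ?_).mono
    (fun _ => id) ?_
  · refine norm_le_of_forall_abs_le (by positivity) fun i => ?_
    rw [PiLp.sub_apply, PiLp.add_apply, act_apply]
    exact hv i (by simp)
  · rw [hlen, add_zero]
    have h1 : ℓ ≤ ℓ ^ 2 := by nlinarith
    have h2 : (0 : ℝ) ≤ n * (n - 1) := by nlinarith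
    nlinarith [mul_nonneg h2 (sq_nonneg ℓ), mul_nonneg (sq_nonneg (n : ℝ)) (sub_nonneg.2 h1)]

/-- Integers of absolute value at most `Z` have about `log Z` binary digits. -/
theorem bitLen_le {a : ℤ} (hZ : 1 ≤ Z) (ha : |(a : ℝ)| ≤ Z) : (bitLen a : ℝ) ≤ 2 + 2 * Real.log Z := by
  have hlog : 0 ≤ Real.log Z := Real.log_nonneg hZ
  rw [bitLen]
  push_cast
  rcases Nat.eq_zero_or_pos (Nat.size a.natAbs) with h0 | h0
  · rw [h0]
    push_cast
    linarith
  · have h1 : 2 ^ (Nat.size a.natAbs - 1) ≤ a.natAbs := Nat.lt_size.1 (by omega)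
    have h2 : (2 : ℝ) ^ (Nat.size a.natAbs - 1) ≤ Z := by
      refine le_trans ?_ ha
      rw [← Int.cast_abs, Int.abs_eq_natAbs]
      exact_mod_cast h1
    have h3 := Real.log_le_log (by positivity) h2
    rw [Real.log_pow, Nat.cast_sub h0] at h3
    -- Only log 2 > 1/2 is needed, which turns base 2 into the factor 2.
    have h4 := Real.log_two_gt_d9
    have h5 : (1 : ℝ) ≤ Nat.size a.natAbs := by exact_mod_cast h0
    push_cast at h3
    nlinarith

end FixedPoint

/-! ### Norm bounds and the cost in terms of the accuracy -/

theorem abs_entry_le_opNorm {ι : Type} [Fintype ι] [DecidableEq ι] (T : Matrix ι ι ℝ) (i k : ι) :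
    |T i k| ≤ opNorm T := by
  have h1 : act T (EuclideanSpace.single k 1) i = T i k := by
    rw [act_apply]
    simp
  rw [← h1, ← Real.norm_eq_abs]
  refine (PiLp.norm_apply_le _ i).trans (((act T).le_opNorm _).trans_eq ?_)
  rw [PiLp.norm_single, norm_one, mul_one, opNorm]

theorem abs_symplForm_le {n : ℕ} (u v : PhaseSpace n) :
    |symplForm u v| ≤ (‖u‖ ^ 2 + ‖v‖ ^ 2) / 2 := by
  have hu : ∀ u : PhaseSpace n, ‖u‖ ^ 2 = ∑ j, (u (j, 0) ^ 2 + u (j, 1) ^ 2) := fun u => by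
    rw [EuclideanSpace.norm_sq_eq, Fintype.sum_prod_type]
    simp [Fin.sum_univ_two]
  rw [hu, hu, ← Finset.sum_add_distrib, Finset.sum_div, symplForm]
  refine (Finset.abs_sum_le_sum_abs _ _).trans (Finset.sum_le_sum fun j _ => ?_)
  rw [abs_le]
  constructor <;> nlinarith [sq_nonneg (u (j, 0) - v (j, 1)), sq_nonneg (u (j, 1) + v (j, 0)),
    sq_nonneg (u (j, 0) + v (j, 1)), sq_nonneg (u (j, 1) - v (j, 0))]

/-- For a conjugate pair of unit vectors, 1 = σ(a, b) = σ(T a, T b) ≤ ‖T‖². -/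
theorem IsSymplectic.one_le_opNorm {n : ℕ} (hn : 1 ≤ n) {T : Matrix (Fin n × Fin 2) (Fin n × Fin 2) ℝ}
    (hT : IsSymplectic T) : 1 ≤ opNorm T := by
  set a : PhaseSpace n := EuclideanSpace.single (⟨0, hn⟩, 0) 1
  set b : PhaseSpace n := EuclideanSpace.single (⟨0, hn⟩, 1) 1
  have hab : symplForm a b = 1 := by
    simp [symplForm, a, b]
  have ha : ‖act T a‖ ≤ opNorm T := ((act T).le_opNorm a).trans_eq (by
    rw [PiLp.norm_single, norm_one, mul_one, opNorm])
  have hb : ‖act T b‖ ≤ opNorm T := ((act T).le_opNorm b).trans_eq (by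
    rw [PiLp.norm_single, norm_one, mul_one, opNorm])
  have h := (le_abs_self _).trans (abs_symplForm_le (act T a) (act T b))
  rw [hT, hab] at h
  nlinarith [norm_nonneg (act T a), norm_nonneg (act T b)]

/-- Since log y = 2 log √y ≤ 2(√y - 1), the logarithmic length is traded for √y. Schoolbook
multiplication, quadratic in the length, then costs O(y) and no logarithm survives in the final
bound. -/
theorem bitLen_le_sqrt {K y : ℝ} (hK : 1 ≤ K) (hy : 1 ≤ y) {a : ℤ} (ha : |(a : ℝ)| ≤ K * y ^ 11) :
    (bitLen a : ℝ) ≤ (46 + 2 * K) * Real.sqrt y := by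
  have h1 := bitLen_le (one_le_mul_of_one_le_of_one_le hK (one_le_pow₀ hy)) ha
  have hs : 1 ≤ Real.sqrt y := Real.one_le_sqrt.2 hy
  rw [Real.log_mul (by positivity) (by positivity), Real.log_pow] at h1
  have h2 := Real.log_le_sub_one_of_pos (by linarith : 0 < K)
  have h3 := Real.log_le_sub_one_of_pos (by linarith : 0 < Real.sqrt y)
  rw [Real.log_sqrt (by linarith)] at h3
  have h4 : K ≤ K * Real.sqrt y := le_mul_of_one_le_right (by linarith) hs
  push_cast at h1
  linarith

/-- The constant in the bound on the number of steps. -/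
def costConst (c B : ℝ) : ℝ :=
  (30 + 18 * (46 + 2 * (3 * (2 * (12 * c * (B + 4) + 1)) ^ 2 * (B + 4) ^ 2)) ^ 2) * (131072 * c ^ 3)

namespace Admissible

variable {n : ℕ} {E : Experiment n} {I : SimInput n} {ε β Λ η : ℝ}

theorem one_le_opNorm (hA : Admissible E I ε β Λ η) : 1 ≤ opNorm E.T :=
  E.symplectic.one_le_opNorm hA.modes_pos

/-- One diagonal entry of the first covariance matrix is at least 1, so along a suitable axis the
noise density drops from π⁻ⁿ to at most π⁻ⁿ/e within unit distance. A gradient of at most nΛ/Aⁿ then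
forces 2nΛ ≥ (A/π)ⁿ ≥ A/π ≥ 8n. -/
theorem one_le_Λ (hA : Admissible E I ε β Λ η) : 1 ≤ Λ := by
  set j0 : Fin n := ⟨0, hA.modes_pos⟩
  have hn := hA.one_le_modes
  have hp := Real.pi_pos
  have hex : ∃ a : Fin 2, noiseDensity E.VM (EuclideanSpace.single (j0, a) 1) ≤
      Real.pi⁻¹ ^ n * Real.exp (-1) := by
    have hN : ∀ a : Fin 2, noiseDensity E.VM (EuclideanSpace.single (j0, a) 1) =
        Real.pi⁻¹ ^ n * Real.exp (-(if a = 0 then E.VM j0 1 1 else E.VM j0 0 0)) := fun a => by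
      have e : ∀ j, gaussMode (E.VM j) (mode (EuclideanSpace.single (j0, a) 1 : PhaseSpace n) j) =
          Real.pi⁻¹ * if j = j0 then Real.exp (-(if a = 0 then E.VM j0 1 1 else E.VM j0 0 0))
            else 1 := fun j => by
        rw [gaussMode_apply (E.VM_symm j) (E.VM_det j)]
        by_cases hj : j = j0
        · rw [if_pos hj, hj]
          congr 2
          fin_cases a <;> simp [mode]
        · rw [if_neg hj]
          simp [mode, hj]
      rw [noiseDensity, Finset.prod_congr rfl fun j _ => e j, Finset.prod_mul_distrib,
        Finset.prod_const, Finset.card_univ, Fintype.card_fin, Finset.prod_ite_eq' Finset.univ j0]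
      simp
    have htr := E.two_le_trace_VM j0
    by_cases h1 : 1 ≤ E.VM j0 1 1
    · refine ⟨0, (hN 0).trans_le (mul_le_mul_of_nonneg_left (Real.exp_le_exp.2 ?_) (by positivity))⟩
      rw [if_pos rfl]
      linarith
    · refine ⟨1, (hN 1).trans_le (mul_le_mul_of_nonneg_left (Real.exp_le_exp.2 ?_) (by positivity))⟩
      rw [if_neg (by norm_num)]
      linarith
  obtain ⟨a, ha⟩ := hex
  have h0 : noiseDensity E.VM 0 = Real.pi⁻¹ ^ n := by
    have e : ∀ j, gaussMode (E.VM j) (mode (0 : PhaseSpace n) j) = Real.pi⁻¹ := fun j => by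
      rw [gaussMode_apply (E.VM_symm j) (E.VM_det j)]
      simp [mode]
    rw [noiseDensity, Finset.prod_congr rfl fun j _ => e j]
    simp
  have hlip := (le_abs_self _).trans (abs_sub_le_of_norm_gradient_le
    (differentiable_noiseDensity E.VM_symm E.VM_det) hA.noise_grad 0
      (EuclideanSpace.single (j0, a) 1))
  rw [zero_sub, norm_neg, PiLp.norm_single, norm_one, mul_one, h0] at hlip
  have hexp : Real.exp (-1) ≤ 1 / 2 := by
    have := Real.exp_neg_one_lt_half
    linarith
  have hpn : 0 < Real.pi⁻¹ ^ n := by positivity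
  have h1 : Real.pi⁻¹ ^ n * (1 / 2) ≤ n * Λ / I.A ^ n := by nlinarith
  have hAn : 0 < I.A ^ n := pow_pos hA.A_pos n
  rw [le_div_iff₀ hAn, mul_right_comm, ← mul_pow] at h1
  have h8 : 8 * (n : ℝ) ≤ Real.pi⁻¹ * I.A := by
    rw [← div_eq_inv_mul, le_div_iff₀ hp]
    nlinarith [hA.area_ge, Real.pi_le_four]
  have h2 : Real.pi⁻¹ * I.A ≤ (Real.pi⁻¹ * I.A) ^ n :=
    le_self_pow₀ (by linarith) (by have := hA.modes_pos; omega)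
  nlinarith

/-- The spacing is small. -/
theorem spacing_bounds (hA : Admissible E I ε β Λ η) : n * I.δ ≤ 1 ∧ opNorm E.T * I.δ ≤ 1 ∧ I.δ ≤ 1 := by
  have hn := hA.one_le_modes
  have hδ := hA.δ_pos
  have hT := hA.one_le_opNorm
  have hs : 1 ≤ Real.sqrt (2 * n) := by
    rw [Real.one_le_sqrt]
    linarith
  -- With Λ ≥ 1 the accuracy condition on δ becomes a bound in terms of n and ‖T‖ alone.
  have h1 : 1 + opNorm E.T ≤ (1 + opNorm E.T) * Λ + β := by
    nlinarith [hA.one_le_Λ, hA.β_nonneg]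
  have h2 : 16 * (1 + opNorm E.T) * n * 1 * I.δ ≤ ε := by
    have := hA.Λ_nonneg
    have := hA.β_nonneg
    refine le_trans ?_ hA.spacing_le
    gcongr
  have h3 : ε < 1 := hA.ε_lt
  have h4 : I.δ ≤ n * I.δ := le_mul_of_one_le_left hδ.le hn
  have h5 : opNorm E.T * I.δ ≤ opNorm E.T * (n * I.δ) := by gcongr
  have h6 : 0 ≤ opNorm E.T * (n * I.δ) := by positivity
  refine ⟨?_, ?_, ?_⟩ <;> nlinarith

variable {c B : ℝ}

/-- The left side is the order of the table work. Proportionality bounds Aε by 32 c n S and ε² by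
512 c² Y² n³ δ², while ‖T‖ ≥ 1 gives Y² ≤ 8(Λ²‖T‖² + β²). The constant is 32 · 512 · 8. -/
theorem costScale_ge (hA : Admissible E I ε β Λ η) (hP : Proportional E I ε β Λ c B)
    (hc : 0 < c) : n * I.A / I.δ ^ 2 ≤ 131072 * c ^ 3 * costScale E ε β Λ := by
  have hn := hA.one_le_modes
  have hδ := hA.δ_pos
  have hε := hA.ε_pos
  have hT := hA.one_le_opNorm
  have hΛ := hA.one_le_Λ
  have hβ := hA.β_nonneg
  obtain ⟨i, j, hij⟩ := hP.A_le
  set S := (⨆ i, opNorm (E.Vρ i)) + ⨆ j, opNorm (E.VM j) with hS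
  set Y := (1 + opNorm E.T) * Λ + β with hY
  have hY0 : 0 < Y := by positivity
  have hS1 : opNorm (E.Vρ i) + opNorm (E.VM j) ≤ S :=
    add_le_add (le_ciSup (Set.finite_range fun i => opNorm (E.Vρ i)).bddAbove i)
      (le_ciSup (Set.finite_range fun j => opNorm (E.VM j)).bddAbove j)
  have hS0 : 0 ≤ S := le_trans (add_nonneg (norm_nonneg _) (norm_nonneg _)) hS1
  have h1 : I.A * ε ≤ 32 * c * n * S := by
    rw [areaBound, ← mul_div_assoc, le_div_iff₀ hε] at hij
    refine hij.trans ?_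
    have e1 := (le_abs_self _).trans (abs_entry_le_opNorm (E.Vρ i) 0 0)
    have e2 := (le_abs_self _).trans (abs_entry_le_opNorm (E.Vρ i) 1 1)
    have e3 := (le_abs_self _).trans (abs_entry_le_opNorm (E.VM j) 0 0)
    have e4 := (le_abs_self _).trans (abs_entry_le_opNorm (E.VM j) 1 1)
    calc c * (16 * n * (E.Vρ i 0 0 + E.Vρ i 1 1 + E.VM j 0 0 + E.VM j 1 1))
        ≤ c * (16 * n * (2 * S)) := by
          gcongr
          linarith
      _ = 32 * c * n * S := by ring
  have h2 : ε ^ 2 ≤ 512 * c ^ 2 * Y ^ 2 * n ^ 3 * I.δ ^ 2 := by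
    have h := hP.δ_ge
    rw [spacingBound, div_le_iff₀ (by positivity)] at h
    calc ε ^ 2 ≤ (c * I.δ * (16 * Y * n * Real.sqrt (2 * n))) ^ 2 := by gcongr
      _ = 256 * c ^ 2 * Y ^ 2 * n ^ 2 * I.δ ^ 2 * Real.sqrt (2 * n) ^ 2 := by ring
      _ = 512 * c ^ 2 * Y ^ 2 * n ^ 3 * I.δ ^ 2 := by
        rw [Real.sq_sqrt (by positivity)]
        ring
  have h3 : Y ^ 2 ≤ 8 * (Λ ^ 2 * opNorm E.T ^ 2 + β ^ 2) := by
    have h4 : Y ≤ 2 * (Λ * opNorm E.T) + β := by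
      rw [hY]
      nlinarith
    calc Y ^ 2 ≤ (2 * (Λ * opNorm E.T) + β) ^ 2 := by gcongr
      _ ≤ _ := by nlinarith [sq_nonneg (2 * (Λ * opNorm E.T) - β), sq_nonneg β]
  have hA0 := hA.A_pos
  rw [costScale, ← mul_div_assoc, div_le_div_iff₀ (by positivity) (by positivity)]
  calc n * I.A * ε ^ 3 = n * (I.A * ε) * ε ^ 2 := by ring
    _ ≤ n * (32 * c * n * S) * (512 * c ^ 2 * Y ^ 2 * n ^ 3 * I.δ ^ 2) := by gcongr
    _ = 16384 * c ^ 3 * n ^ 5 * S * I.δ ^ 2 * Y ^ 2 := by ring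
    _ ≤ 16384 * c ^ 3 * n ^ 5 * S * I.δ ^ 2 * (8 * (Λ ^ 2 * opNorm E.T ^ 2 + β ^ 2)) := by gcongr
    _ = _ := by ring

theorem pos_of_proportional (hA : Admissible E I ε β Λ η) (hP : Proportional E I ε β Λ c B) :
    0 < c ∧ 0 ≤ B ∧ I.δ / 2 ≤ c * I.ε₂ := by
  have hn := hA.one_le_modes
  have hδ := hA.δ_pos
  have hT := hA.one_le_opNorm
  have hs : 1 / 2 ≤ Real.sqrt (n / 2) := Real.le_sqrt_of_sq_le (by linarith)
  have h1 : I.δ / 2 ≤ opNorm E.T * I.δ * Real.sqrt (n / 2) := by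
    calc I.δ / 2 = 1 * I.δ * (1 / 2) := by ring
      _ ≤ _ := by gcongr
  have h2 : 0 ≤ spacingBound E ε β Λ := by
    have := hA.one_le_Λ
    have := hA.β_nonneg
    have := hA.ε_pos
    rw [spacingBound]
    positivity
  have h3 : 0 ≤ c := nonneg_of_mul_nonneg_left (h2.trans hP.δ_ge) hδ
  refine ⟨lt_of_le_of_ne h3 fun h => ?_, (abs_nonneg _).trans (hP.mean_le (⟨0, hA.modes_pos⟩, 0)),
    h1.trans hP.ε₂_ge⟩
  have := h1.trans hP.ε₂_ge
  rw [← h, zero_mul] at this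
  linarith

/-- A suitable number of binary digits. -/
theorem exists_digits (hA : Admissible E I ε β Λ η) (hP : Proportional E I ε β Λ c B) :
    ∃ p : ℕ, AffineAccurate I E.T E.x (fixedPointAffine p E.T E.x) ∧
      RunsIn E I (fixedPointAffine p E.T E.x) (costConst c B * costScale E ε β Λ) := by
  obtain ⟨hc, hB, hε₂⟩ := hA.pos_of_proportional hP
  obtain ⟨hnδ, hTδ, hδ1⟩ := hA.spacing_bounds
  have hn := hA.one_le_modes
  have hδ := hA.δ_pos
  have hT := hA.one_le_opNorm
  have hA32 := hA.area_ge
  obtain ⟨h, hh⟩ := hA.A_odd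
  -- A single scale dominating n, A and ‖T‖; every size below is a power of y times a constant
  -- depending on c and B.
  set y := I.A / I.δ with hy
  have hA1 : 1 ≤ I.A := by linarith
  have hyδ : y * I.δ = I.A := div_mul_cancel₀ _ hδ.ne'
  have le_y : ∀ a : ℝ, a * I.δ ≤ I.A → a ≤ y := fun a ha => (le_div_iff₀ hδ).2 ha
  have hAy : I.A ≤ y := le_y _ (mul_le_of_le_one_right hA.A_pos.le hδ1)
  have hny : (n : ℝ) ≤ y := le_y _ (hnδ.trans hA1)
  have hTy : opNorm E.T ≤ y := le_y _ (hTδ.trans hA1)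
  have hy1 : 1 ≤ y := hA1.trans hAy
  set Q := B + I.A + opNorm E.T + 2 with hQ
  have hQ0 : 0 < Q := by positivity
  have hQy : Q ≤ (B + 4) * y := by
    have := le_mul_of_one_le_right hB hy1
    linarith only [this, hAy, hTy, hy1, hQ]
  have hε₂0 : 0 < I.ε₂ := pos_of_mul_pos_right (lt_of_lt_of_le (by positivity) hε₂) hc.le
  -- the number of digits
  set G := 12 * c * (B + 4) * y ^ 4 with hG
  -- With m + 1 digits, 2^(m + 1) exceeds G, enough for the accuracy, yet is at most 2(G + 1), which
  -- controls the lengths.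
  obtain ⟨m, hm1, hm2⟩ := exists_nat_pow_near (x := G + 1) (y := 2)
    (by rw [hG]; linarith [show 0 ≤ 12 * c * (B + 4) * y ^ 4 by positivity]) one_lt_two
  have hDε : 6 * n ^ 2 * Q ≤ I.ε₂ * 2 ^ (m + 1) := by
    -- The required accuracy is not too fine: δ/2 ≤ c ε₂ and A ≥ 1.
    have h1 : 1 ≤ 2 * c * y * I.ε₂ := by
      have : 1 * I.δ ≤ 2 * c * y * I.ε₂ * I.δ := by
        calc 1 * I.δ = I.δ * 1 := by ring
          _ ≤ I.δ * I.A := by gcongr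
          _ ≤ 2 * (c * I.ε₂) * I.A := by
            gcongr
            linarith
          _ = 2 * c * y * I.ε₂ * I.δ := by rw [← hyδ]; ring
      exact le_of_mul_le_mul_right this hδ
    calc 6 * n ^ 2 * Q ≤ 6 * y ^ 2 * ((B + 4) * y) * 1 := by
          rw [mul_one]
          gcongr
      _ ≤ 6 * y ^ 2 * ((B + 4) * y) * (2 * c * y * I.ε₂) := by gcongr
      _ = I.ε₂ * G := by rw [hG]; ring
      _ ≤ I.ε₂ * 2 ^ (m + 1) := by
        gcongr
        linarith
  set K1 := 2 * (12 * c * (B + 4) + 1) with hK1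
  have h2p : (2 : ℝ) ^ (m + 1) ≤ K1 * y ^ 4 := by
    have : 1 ≤ y ^ 4 := one_le_pow₀ hy1
    rw [pow_succ, hK1]
    linarith only [hm1, hG, this]
  set K2 := 3 * K1 ^ 2 * (B + 4) ^ 2 with hK2
  have hK2' : 1 ≤ K2 := by
    have h1 : 1 ≤ K1 ^ 2 := one_le_pow₀ (by
      rw [hK1]
      linarith [show 0 ≤ 12 * c * (B + 4) by positivity])
    have h2 : 1 ≤ (B + 4) ^ 2 := one_le_pow₀ (by linarith)
    rw [hK2]
    nlinarith
  -- One power from n and 2 · (4 + 1) from the square.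
  have hZ : 3 * n * (2 ^ (m + 1) * Q) ^ 2 ≤ K2 * y ^ 11 := by
    calc 3 * n * (2 ^ (m + 1) * Q) ^ 2 ≤ 3 * y * (K1 * y ^ 4 * ((B + 4) * y)) ^ 2 := by gcongr
      _ = K2 * y ^ 11 := by rw [hK2]; ring
  set ℓ := (46 + 2 * K2) * Real.sqrt y with hℓ
  have hsy : 1 ≤ Real.sqrt y := Real.one_le_sqrt.2 hy1
  have hbits : ∀ a : ℤ, |(a : ℝ)| ≤ 3 * n * (2 ^ (m + 1) * Q) ^ 2 → (bitLen a : ℝ) ≤ ℓ := by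
    intro a ha
    exact bitLen_le_sqrt hK2' hy1 (ha.trans hZ)
  have hℓ1 : 1 ≤ ℓ := one_le_mul_of_one_le_of_one_le (by linarith) hsy
  have hℓ2 : ℓ ^ 2 = (46 + 2 * K2) ^ 2 * y := by
    rw [hℓ, mul_pow, Real.sq_sqrt (by linarith)]
  have hsqrtA : Real.sqrt I.A ≤ I.A := by
    rw [Real.sqrt_le_left hA.A_pos.le]
    exact le_self_pow₀ hA1 two_ne_zero
  have haff : ∀ z : Fin n → ℤ × ℤ, (∀ j, |(z j).1| ≤ h ∧ |(z j).2| ≤ h) →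
      (fixedPointAffine (m + 1) E.T E.x (gridPt I.mean I.δ z)).Within
        (fun v => ‖v - (act E.T (gridPt I.mean I.δ z) + E.x)‖ ≤
          Real.sqrt (2 * n) * (3 * n * Q / 2 ^ (m + 1))) (18 * n ^ 2 * ℓ ^ 2) := by
    intro z hz
    refine within_fixedPointAffine hA.modes_pos (m + 1) (fun i k => ?_) (fun i => ?_) (fun i => ?_)
      hbits hℓ1
    · linarith [abs_entry_le_opNorm E.T i k]
    · have := (PiLp.norm_apply_le E.x i).trans hP.x_le
      rw [Real.norm_eq_abs] at this
      linarith
    · have key : ∀ (i : Fin n × Fin 2) (l : ℤ), |l| ≤ h → |I.mean i + I.δ * l| + 1 ≤ Q := by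
        intro i l hl
        have h1 := abs_add_le (I.mean i) (I.δ * l)
        have h2 : |(l : ℝ)| ≤ h := by exact_mod_cast hl
        rw [abs_mul, abs_of_pos hδ] at h1
        have h3 := hP.mean_le i
        rw [← hA.mean_eq] at h3
        have h4 : I.δ * |(l : ℝ)| ≤ I.δ * h := by gcongr
        have h5 : 0 ≤ I.δ * h := by positivity
        linarith
      obtain ⟨j, a⟩ := i
      fin_cases a
      · exact key (j, 0) _ (hz j).1
      · exact key (j, 1) _ (hz j).2
  refine ⟨m + 1, fun z hz r hr => ?_, fun r hr => ?_⟩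
  · refine ((haff z fun j => (mem_gridLabels hδ hh).1 (hz j)) r hr).1.trans ?_
    rw [← mul_div_assoc, div_le_iff₀ (by positivity)]
    refine le_trans ?_ hDε
    have h1 : Real.sqrt (2 * n) ≤ 2 * n := Real.sqrt_le_left (by positivity) |>.2
      (le_self_pow₀ (by linarith only [hn]) two_ne_zero)
    calc Real.sqrt (2 * n) * (3 * n * Q) ≤ 2 * n * (3 * n * Q) := by gcongr
      _ = 6 * n ^ 2 * Q := by ring
  · refine ((within_simulate hδ hh fun z hz => (haff z hz).mono (fun _ _ => trivial) le_rfl)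
      r hr).2.trans ?_
    have h1 : (2 * (h : ℝ) + 1) ^ 2 = I.A / I.δ ^ 2 := by
      rw [eq_div_iff (by positivity), ← mul_pow, ← hh, Real.sq_sqrt hA.A_pos.le]
    -- Since n δ ≤ 1, the bit cost n² y of the affine map is of no larger order than the table work.
    have h2 : n ^ 2 * y ≤ n * I.A / I.δ ^ 2 := by
      rw [le_div_iff₀ (by positivity)]
      calc n ^ 2 * y * I.δ ^ 2 = n * (n * I.δ) * (y * I.δ) := by ring
        _ ≤ n * 1 * I.A := by
          rw [hyδ]
          have := hA.A_pos
          gcongr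
        _ = n * I.A := by ring
    rw [h1, hℓ2, costConst, mul_assoc]
    calc 30 * (n * (I.A / I.δ ^ 2)) + 18 * n ^ 2 * ((46 + 2 * K2) ^ 2 * y)
        = 30 * (n * I.A / I.δ ^ 2) + 18 * (46 + 2 * K2) ^ 2 * (n ^ 2 * y) := by ring
      _ ≤ 30 * (n * I.A / I.δ ^ 2) + 18 * (46 + 2 * K2) ^ 2 * (n * I.A / I.δ ^ 2) := by gcongr
      _ = (30 + 18 * (46 + 2 * K2) ^ 2) * (n * I.A / I.δ ^ 2) := by ring
      _ ≤ (30 + 18 * (46 + 2 * K2) ^ 2) * (131072 * c ^ 3 * costScale E ε β Λ) := by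
        gcongr
        exact hA.costScale_ge hP hc
      _ = _ := by ring

theorem costScale_le (hA : Admissible E I ε β Λ η) (hVρ : ∀ j, opNorm (E.Vρ j) ≤ B)
    (hVM : ∀ j, opNorm (E.VM j) ≤ B) (hT : opNorm E.T ≤ B) (hβ : β ≤ B) (hΛ : Λ ≤ B) :
    costScale E ε β Λ ≤ 2 * B * (B ^ 4 + B ^ 2) * (n / ε) ^ 5 := by
  have hε := hA.ε_pos
  have hT1 := hA.one_le_opNorm
  have hΛ1 := hA.one_le_Λ
  have hβ0 := hA.β_nonneg
  have hB : 1 ≤ B := hT1.trans hT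
  have : Nonempty (Fin n) := ⟨⟨0, hA.modes_pos⟩⟩
  have hS : (⨆ i, opNorm (E.Vρ i)) + ⨆ j, opNorm (E.VM j) ≤ 2 * B := by
    linarith [ciSup_le hVρ, ciSup_le hVM]
  have h1 : Λ ^ 2 * opNorm E.T ^ 2 + β ^ 2 ≤ B ^ 4 + B ^ 2 := by
    calc Λ ^ 2 * opNorm E.T ^ 2 + β ^ 2 ≤ B ^ 2 * B ^ 2 + B ^ 2 := by gcongr
      _ = _ := by ring
  rw [costScale, div_pow, ← mul_div_assoc]
  calc n ^ 5 * ((⨆ i, opNorm (E.Vρ i)) + ⨆ j, opNorm (E.VM j)) *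
        (Λ ^ 2 * opNorm E.T ^ 2 + β ^ 2) / ε ^ 3
      ≤ n ^ 5 * (2 * B) * (B ^ 4 + B ^ 2) / ε ^ 3 := by gcongr
    -- As ε < 1, the exponent of 1/ε may be raised to that of n, leaving a power of n/ε.
    _ ≤ n ^ 5 * (2 * B) * (B ^ 4 + B ^ 2) / ε ^ 5 := by
      refine div_le_div_of_nonneg_left (by positivity) (by positivity) ?_
      exact pow_le_pow_of_le_one hε.le hA.ε_lt.le (by norm_num)
    _ = _ := by ring

end Admissible

end PhaseSim

end

theorem theorem1 :
    -- accuracy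
    (∀ (n : ℕ) (E : PhaseSim.Experiment n) (I : PhaseSim.SimInput n) (ε β Λ η : ℝ),
      PhaseSim.Admissible E I ε β Λ η →
      ∀ aff : PhaseSim.PhaseSpace n → PhaseSim.Comp (PhaseSim.PhaseSpace n),
        PhaseSim.AffineAccurate I E.T E.x aff → PhaseSim.CloseToBorn E I aff ε) ∧
    -- cost
    (∀ c B : ℝ, ∃ C : ℝ, ∀ (n : ℕ) (E : PhaseSim.Experiment n) (I : PhaseSim.SimInput n)
      (ε β Λ η : ℝ), PhaseSim.Admissible E I ε β Λ η → PhaseSim.Proportional E I ε β Λ c B →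
      ∃ p : ℕ, PhaseSim.AffineAccurate I E.T E.x (PhaseSim.fixedPointAffine p E.T E.x) ∧
        PhaseSim.RunsIn E I (PhaseSim.fixedPointAffine p E.T E.x)
          (C * PhaseSim.costScale E ε β Λ)) ∧
    -- efficiency
    (∀ c B : ℝ, ∃ (C : ℝ) (d : ℕ), ∀ (n : ℕ) (E : PhaseSim.Experiment n)
      (I : PhaseSim.SimInput n) (ε β Λ η : ℝ),
      PhaseSim.Admissible E I ε β Λ η → PhaseSim.Proportional E I ε β Λ c B →
      (∀ j, PhaseSim.opNorm (E.Vρ j) ≤ B) → (∀ j, PhaseSim.opNorm (E.VM j) ≤ B) →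
      PhaseSim.opNorm E.T ≤ B → β ≤ B → Λ ≤ B →
      ∃ p : ℕ, PhaseSim.CloseToBorn E I (PhaseSim.fixedPointAffine p E.T E.x) ε ∧
        PhaseSim.RunsIn E I (PhaseSim.fixedPointAffine p E.T E.x) (C * (n / ε) ^ d)) := by
  refine ⟨fun n E I ε β Λ η hA aff haff => hA.closeToBorn haff, fun c B =>
    ⟨PhaseSim.costConst c B, fun n E I ε β Λ η hA hP => hA.exists_digits hP⟩, fun c B =>
    ⟨PhaseSim.costConst c B * (2 * B * (B ^ 4 + B ^ 2)), 5,
      fun n E I ε β Λ η hA hP hVρ hVM hT hβ hΛ => ?_⟩⟩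
  obtain ⟨p, hacc, hrun⟩ := hA.exists_digits hP
  obtain ⟨hc, -, -⟩ := hA.pos_of_proportional hP
  refine ⟨p, hA.closeToBorn hacc, fun r hr => (hrun r hr).trans ?_⟩
  rw [mul_assoc]
  refine mul_le_mul_of_nonneg_left (hA.costScale_le hVρ hVM hT hβ hΛ) ?_
  unfold PhaseSim.costConst
  positivity
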